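/- Let $n=p_1p_2p_3$, where $p_1<p_2<p_3$ are primes with $p_i\equiv 1 \pmod{p_j}$ whenever $i>j$. **Hopf–Galois structures.** Let $L/K$ be a finite Galois extension of fields. A Hopf–Galois structure on $L/K$ is a cocommutative $K$-Hopf algebra $H$ with a $K$-linear action on $L$ (making $L$ an $H$-module) such that $h\cdot(xy)=\sum (h_{(1)}\cdot x)(h_{(2)}\cdot y)$, $h\cdot 1=\varepsilon(h)1$, and the map $L\otimes_K L\to \mathrm{Hom}_K(H,L)$, $x\otimes y\mapsto (h\mapsto x(h\cdot y))$, is bijective. Structures are counted up to isomorphisms of Hopf algebras compatible with the actions. The structure has type $G$ (a group) if $K^c\otimes_K H\cong K^c[G]$ as Hopf algebras over the algebraic closure $K^c$ of $K$. **Groups of order $n$.** For $\gcd(d,e)=1$ and $k$ of multiplicative order $d$ modulo $e$, let $$G(d,e,k)=\langle \sigma,\tau : \sigma^e=\tau^d=1,\ \tau\sigma\tau^{-1}=\sigma^k\rangle .$$ If a group $G$ is isomorphic to $G(d,e,k)$ and $z=\gcd(k-1,e)$, $g=e/z$, we say that $G$ comes from the factorisation $n=dgz$. Every group of order $n$ comes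 from exactly one of the following six factorisations. | Factorisation | $d$ | $g$ | $z$ | |---|---|---|---| | 1 | $1$ | $1$ | $p_1p_2p_3$ | | 2 | $p_1$ | $p_2$ | $p_3$ | | 3 | $p_1$ | $p_3$ | $p_2$ | | 4 | $p_1$ | $p_2p_3$ | $1$ | | 5 | $p_2$ | $p_3$ | $p_1$ | | 6 | $p_1p_2$ | $p_3$ | $1$ | For $\Gamma\cong G(p_1,p_2p_3,\kappa)$ from Factorisation 4, let $\widehat\Gamma=G(p_1,p_2p_3,\widehat\kappa)$, where $\widehat\kappa\equiv\kappa \pmod{p_2}$ and $\widehat\kappa\equiv\kappa^{-1}\pmod{p_3}$. **Theorem.** Let $\Gamma$, $G$ be groups of order $n$, and let $L/K$ be a Galois extension of fields with $\mathrm{Gal}(L/K)\cong\Gamma$. The number $e(\Gamma,G)$ of Hopf–Galois structures of type $G$ on $L/K$ is finite, and is given by the following tables, where the row is the factorisation from which $\Gamma$ comes and the column is the factorisation from which $G$ comes. If $p_1=2$: | $\Gamma\backslash G$ | 1 | 2 | 3 | 4 | 5 | 6 | |---|---|---|---|---|---|---| | 1 | $1$ | $2$ | $2$ | $4$ | $2(p_2-1)$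 | $2(p_2-1)$ | | 2 | $p_2$ | $2$ | $2p_2$ | $4$ | $0$ | $0$ | | 3 | $p_3$ | $2p_3$ | $2$ | $4$ | $2(p_2-1)p_3$ | $2(p_2-1)p_3$ | | 4 | $p_2p_3$ | $2p_3$ | $2p_2$ | $4$ | $0$ | $0$ | | 5 | $p_3$ | $2p_3$ | $2p_3$ | $4p_3$ | $2+2(p_2-2)p_3$ | $2(p_2-1)p_3$ | | 6 | $p_3$ | $2p_3$ | $2p_3$ | $4p_3$ | $2(p_2-1)p_3$ | $2+2(p_2-2)p_3$ | If $p_1>2$: | $\Gamma\backslash G$ | 1 | 2 | 3 | 4 | 5 | 6 | |---|---|---|---|---|---|---| | 1 | $1$ | $2(p_1-1)$ | $2(p_1-1)$ | $4(p_1-1)$ | $2(p_2-1)$ | $2(p_1-1)(p_2-1)$ | | 2 | $p_2$ | $2+2(p_1-2)p_2$ | $2(p_1-1)p_2$ | $4+4(p_1-2)p_2$ | $0$ | $0$ | | 3 | $p_3$ | $2(p_1-1)p_3$ | $2+2(p_1-2)p_3$ | $4+4(p_1-2)p_3$ | $2(p_2-1)p_3$ | $2(p_1-1)(p_2-1)p_3$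 | | 4 | $p_2p_3$ | $2p_3+2(p_1-2)p_2p_3$ | $2p_2+2(p_1-2)p_2p_3$ | $(\ast)$ | $0$ | $0$ | | 5 | $p_3$ | $2(p_1-1)p_3$ | $2(p_1-1)p_3$ | $4(p_1-1)p_3$ | $2+2(p_2-2)p_3$ | $2(p_1-1)(p_2-1)p_3$ | | 6 | $p_3$ | $2(p_1-1)p_3$ | $2(p_1-1)p_3$ | $4(p_1-1)p_3$ | $2(p_2-1)p_3$ | $2+2(p_1p_2-p_1-p_2)p_3$ | where $$(\ast)=\begin{cases}4p_1p_2p_3-10p_2p_3+2p_2+2p_3+2 & \text{if } G\cong\Gamma \text{ or } G\cong\widehat\Gamma,\\ 4p_1p_2p_3-12p_2p_3+4p_2+4p_3 & \text{otherwise.}\end{cases}$$ -/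

import Mathlib

open scoped TensorProduct

universe u v w

/-! ### Hopf-Galois structures -/

/-- A Hopf-Galois structure on `L/K`: a cocommutative `K`-Hopf algebra `H` together with a
`K`-linear action of `H` on `L` (an `H`-module structure on `L`, given as a `K`-algebra map
`H → End_K(L)`, written `h ↦ (x ↦ h · x)`) making `L/K` an `H`-Galois extension.
Condition `galois` forces `H` to be finite-dimensional over `K` when `L` is, so placing `H` in the
universe of `L` is no restriction. -/
structure HopfGaloisStructure (K : Type u) (L : Type v) [Field K] [Field L] [Algebra K L] where
  /-- the Hopf algebra -/
  H : Type v
  [ring : Ring H]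
  [hopf : HopfAlgebra K H]
  [cocomm : Coalgebra.IsCocomm K H]
  /-- the action -/
  act : H →ₐ[K] Module.End K L
  /-- `h · (x y) = ∑ (h₍₁₎ · x) (h₍₂₎ · y)` -/
  act_mul : ∀ (h : H) (x y : L),
    act h (x * y) =
      LinearMap.mul' K L
        (TensorProduct.map (act.toLinearMap.flip x) (act.toLinearMap.flip y)
          (Coalgebra.comul (R := K) h))
  /-- `h · 1 = ε(h) 1` -/
  act_one : ∀ h : H, act h 1 = algebraMap K L (Coalgebra.counit (R := K) h)
  /-- the `K`-linear map `L ⊗ L → Hom_K(H, L)`, `x ⊗ y ↦ (h ↦ x (h · y))`, is bijective -/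
  galois : Function.Bijective
    (TensorProduct.lift
      ((LinearMap.llcomp K H L L).compl₁₂ (LinearMap.mul K L) act.toLinearMap.flip) :
        L ⊗[K] L →ₗ[K] (H →ₗ[K] L))

attribute [instance] HopfGaloisStructure.ring HopfGaloisStructure.hopf HopfGaloisStructure.cocomm

namespace HopfGaloisStructure

/-- Two Hopf-Galois structures are identified when there is an isomorphism of Hopf algebras
between them that respects the actions on `L`. -/
instance setoid (K : Type u) (L : Type v) [Field K] [Field L] [Algebra K L] :
    Setoid (HopfGaloisStructure K L) where
  r S T := ∃ f : S.H ≃ₐc[K] T.H, ∀ h : S.H, T.act (f h) = S.act h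
  iseqv :=
    { refl := fun S => ⟨BialgEquiv.refl K S.H, fun _ => rfl⟩
      symm := fun {S T} ⟨f, hf⟩ => ⟨f.symm, fun h => by
        rw [← hf (f.symm h), BialgEquiv.apply_symm_apply]⟩
      trans := fun {S T U} ⟨f, hf⟩ ⟨f', hf'⟩ => ⟨f.trans f', fun h => by
        rw [← hf h, ← hf' (f h)]; rfl⟩ }

/-- The structure has type `G` if `Kᶜ ⊗ H ≅ Kᶜ[G]` as Hopf algebras over the algebraic closure
`Kᶜ` of `K` (a bialgebra isomorphism between Hopf algebras respects antipodes). -/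
def HasType {K : Type u} {L : Type v} [Field K] [Field L] [Algebra K L]
    (S : HopfGaloisStructure K L) (G : Type w) [Group G] : Prop :=
  Nonempty ((AlgebraicClosure K ⊗[K] S.H) ≃ₐc[AlgebraicClosure K]
    MonoidAlgebra (AlgebraicClosure K) G)

end HopfGaloisStructure

/-- The Hopf-Galois structures of type `G` on `L/K`, up to isomorphism. -/
def HopfGaloisOfType (K : Type u) (L : Type v) [Field K] [Field L] [Algebra K L]
    (G : Type w) [Group G] : Type (max u (v + 1)) :=
  Quotient ((HopfGaloisStructure.setoid K L).comap
    (Subtype.val : {S : HopfGaloisStructure K L // S.HasType G} → HopfGaloisStructure K L))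

/-! ### Groups of squarefree order -/

/-- The group `G(d, e, k) = ⟨σ, τ : σ^e = τ^d = 1, τ σ τ⁻¹ = σ^k⟩`; here `σ`, `τ` are the
generators with index `0`, `1`. -/
abbrev MetacyclicGroup (d e : ℕ) (k : ℤ) : Type :=
  PresentedGroup
    ({(FreeGroup.of 0) ^ e, (FreeGroup.of 1) ^ d,
      FreeGroup.of 1 * FreeGroup.of 0 * (FreeGroup.of 1)⁻¹ * ((FreeGroup.of 0) ^ k)⁻¹} :
      Set (FreeGroup (Fin 2)))

/-- `k` is an admissible parameter for the factorisation `n = d g z`: with `e = g z`, we have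
`gcd(d, e) = 1`, `ord_e(k) = d` and `z = gcd(k - 1, e)`. -/
def IsParameter (d g z : ℕ) (k : ℤ) : Prop :=
  Nat.Coprime d (g * z) ∧ orderOf (k : ZMod (g * z)) = d ∧ Int.gcd (k - 1) ((g * z : ℕ) : ℤ) = z

/-- The group `G` comes from the factorisation `n = d g z`: it is isomorphic to some `G(d, e, k)`
with `e = g z` and `z = gcd(k - 1, e)`. -/
def ComesFrom (G : Type u) [Group G] (d g z : ℕ) : Prop :=
  ∃ k : ℤ, IsParameter d g z k ∧ Nonempty (G ≃* MetacyclicGroup d (g * z) k)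

/-- The six factorisations `n = d g z` of `n = p₁ p₂ p₃`, listed as triples `(d, g, z)`;
the index `i : Fin 6` stands for Factorisation `i + 1`. -/
def factorisation (p₁ p₂ p₃ : ℕ) : Fin 6 → ℕ × ℕ × ℕ :=
  ![(1, 1, p₁ * p₂ * p₃),
    (p₁, p₂, p₃),
    (p₁, p₃, p₂),
    (p₁, p₂ * p₃, 1),
    (p₂, p₃, p₁),
    (p₁ * p₂, p₃, 1)]

/-- `G` comes from Factorisation `i + 1`. -/
def HasFactorisation (p₁ p₂ p₃ : ℕ) (G : Type u) [Group G] (i : Fin 6) : Prop :=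
  ComesFrom G (factorisation p₁ p₂ p₃ i).1 (factorisation p₁ p₂ p₃ i).2.1
    (factorisation p₁ p₂ p₃ i).2.2

/-- `G ≅ Γ̂`, for `Γ = G(p₁, p₂ p₃, κ)` from Factorisation 4, where `Γ̂ = G(p₁, p₂ p₃, κ')` with
`κ' ≡ κ` modulo `p₂` and `κ' ≡ κ⁻¹` modulo `p₃`. -/
def IsHat (p₁ p₂ p₃ : ℕ) (Γ : Type u) [Group Γ] (G : Type v) [Group G] : Prop :=
  ∃ κ κ' : ℤ, IsParameter p₁ (p₂ * p₃) 1 κ ∧ κ' ≡ κ [ZMOD p₂] ∧ κ * κ' ≡ 1 [ZMOD p₃] ∧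
    Nonempty (Γ ≃* MetacyclicGroup p₁ (p₂ * p₃) κ) ∧
    Nonempty (G ≃* MetacyclicGroup p₁ (p₂ * p₃) κ')

/-! ### The tables (rows: factorisation of `Γ`; columns: factorisation of `G`) -/

/-- The table for `p₁ = 2`. -/
def tableTwo (p₂ p₃ : ℤ) : Matrix (Fin 6) (Fin 6) ℤ :=
  !![1,       2,      2,      4,      2 * (p₂ - 1),            2 * (p₂ - 1);
     p₂,      2,      2 * p₂, 4,      0,                       0;
     p₃,      2 * p₃, 2,      4,      2 * (p₂ - 1) * p₃,       2 * (p₂ - 1) * p₃;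
     p₂ * p₃, 2 * p₃, 2 * p₂, 4,      0,                       0;
     p₃,      2 * p₃, 2 * p₃, 4 * p₃, 2 + 2 * (p₂ - 2) * p₃,   2 * (p₂ - 1) * p₃;
     p₃,      2 * p₃, 2 * p₃, 4 * p₃, 2 * (p₂ - 1) * p₃,       2 + 2 * (p₂ - 2) * p₃]

/-- The table for `p₁ > 2`. The entry `c` in row 4, column 4 depends on the two groups and not
only on their factorisations. -/
def tableOdd (p₁ p₂ p₃ c : ℤ) : Matrix (Fin 6) (Fin 6) ℤ :=
  !![1, 2 * (p₁ - 1), 2 * (p₁ - 1), 4 * (p₁ - 1), 2 * (p₂ - 1), 2 * (p₁ - 1) * (p₂ - 1);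
     p₂, 2 + 2 * (p₁ - 2) * p₂, 2 * (p₁ - 1) * p₂, 4 + 4 * (p₁ - 2) * p₂, 0, 0;
     p₃, 2 * (p₁ - 1) * p₃, 2 + 2 * (p₁ - 2) * p₃, 4 + 4 * (p₁ - 2) * p₃,
       2 * (p₂ - 1) * p₃, 2 * (p₁ - 1) * (p₂ - 1) * p₃;
     p₂ * p₃, 2 * p₃ + 2 * (p₁ - 2) * p₂ * p₃, 2 * p₂ + 2 * (p₁ - 2) * p₂ * p₃, c, 0, 0;
     p₃, 2 * (p₁ - 1) * p₃, 2 * (p₁ - 1) * p₃, 4 * (p₁ - 1) * p₃,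
       2 + 2 * (p₂ - 2) * p₃, 2 * (p₁ - 1) * (p₂ - 1) * p₃;
     p₃, 2 * (p₁ - 1) * p₃, 2 * (p₁ - 1) * p₃, 4 * (p₁ - 1) * p₃,
       2 * (p₂ - 1) * p₃, 2 + 2 * (p₁ * p₂ - p₁ - p₂) * p₃]

open Classical in
/-- The entry in row 4, column 4 of the table for `p₁ > 2`. -/
noncomputable def entryFourFour (p₁ p₂ p₃ : ℕ) (Γ : Type u) [Group Γ] (G : Type v) [Group G] : ℤ :=
  if Nonempty (G ≃* Γ) ∨ IsHat p₁ p₂ p₃ Γ G then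
    4 * p₁ * p₂ * p₃ - 10 * p₂ * p₃ + 2 * p₂ + 2 * p₃ + 2
  else
    4 * p₁ * p₂ * p₃ - 12 * p₂ * p₃ + 4 * p₂ + 4 * p₃

/-! ### Linear independence and tensor products -/

section Separating

variable {k F V W X Y : Type*} [Field k] [Field F] [Algebra k F]
  [AddCommGroup V] [Module k V] [AddCommGroup W] [Module k W]

/-! Write Γ for the Galois group and p < q < r for the three primes. The problem is turned into
counting skew braces with multiplicative group Γ, and these are counted along a normal series of Γ.

Hopf–Galois structures are skew braces. The Galois condition makes L ⊗ H → End_K(L) bijective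
(`operator_bijective`). Since the comultiplication of H encodes the product rule, an element of L ⊗
H is group-like exactly when it acts as a field automorphism (`isGroupLikeElem_iff`). The product of
group-like elements is therefore a second group law, written +, on the set Γ. The action of Γ on the
factor L becomes λ_σ(τ) = σ(σ⁻¹ + τ), an automorphism of (Γ, +), and this is the skew brace identity
(`isSkewBrace`). Conversely H is recovered by Galois descent as the algebra of operators Σ c(γ)γ
with c(λ_σ γ) = σ(c(γ)) (`Descent`). The type of H is the additive group (`hasType_iff`), whence
`hopfGaloisOfTypeEquiv`.

Lifting skew braces. Every group of order pqr is C_r ⋊ (C_q ⋊ C_p), given by characters α of C_p and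
θ of C_q ⋊ C_p (`exists_model`). In a skew brace on an extension of Q by a normal subgroup C of
prime order ℓ with action θ, the additive Sylow ℓ-subgroup is unique, hence λ-stable, hence equal to
C (`exists_kernel`). So the skew brace induces one on Q, together with the character T by which
additive conjugation acts on C; T is multiplicative for both laws. Given these data, λ acts on C
through θ or through θT⁻¹ (`lam_character_dichotomy`). The two cases are exchanged by passing to the
opposite addition. In the second one, averaging over Q gives an explicit formula for the addition
with one parameter u modulo ℓ (`exists_add_fst`), which has an effect unless θ is 1 or T
(`natCard_leftFiber`). The number of lifts is thus `fiberCard θ T`.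

Counting. A skew brace of prime order is trivial, so two applications express the number of skew
braces of type G as a sum over pairs of characters weighted by `fiberCard`
(`natCard_skewBraceOfType`). Characters of the middle skew brace that do not come from C_p exist
only when the middle group is a direct product and its skew brace is trivial. The type is constant
on orbits of Aut(C_p) for pairs of characters of C_p; for the other characters it depends only on
triviality on C_p. For nontrivial θ and T, `fiberCard θ T` is 2ℓ − (ℓ−1)([T = θ] + [T = θ⁻¹]), so
every table entry is an elementary sum. In the exceptional entry a product of two such expressions
is summed over Aut(C_p), and the cross term detects whether G is Γ or its hat (`natCard_type_four`).

Explicit generators match the six patterns of characters with the six factorisations, and the orders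
of the centre and of the commutator subgroup tell the factorisations apart
(`hasFactorisation_unique`). -/

theorem LinearIndependent.mul_prod {I J : Type*} {f : I → X → F} {g : J → Y → F}
    (hf : LinearIndependent F f) (hg : LinearIndependent F g) :
    LinearIndependent F (fun (p : I × J) (q : X × Y) => f p.1 q.1 * g p.2 q.2) := by
  classical
  rw [linearIndependent_iff'] at *
  intro s c hc p hp
  set A := s.image Prod.fst
  set B := s.image Prod.snd
  -- Extending the coefficients by zero to a rectangle allows the relation to be read one variable
  -- at a time: for fixed x it is a relation among the `g j`, whose coefficients are relations among
  -- the `f i`.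
  let c' : I × J → F := fun p => if p ∈ s then c p else 0
  have hsub : s ⊆ A ×ˢ B := fun p hp =>
    Finset.mem_product.2 ⟨Finset.mem_image_of_mem _ hp, Finset.mem_image_of_mem _ hp⟩
  have key : ∀ x y, ∑ j ∈ B, (∑ i ∈ A, c' (i, j) * f i x) * g j y = 0 := by
    intro x y
    have h1 := congrFun hc (x, y)
    simp only [Finset.sum_apply, Pi.smul_apply, smul_eq_mul, Pi.zero_apply] at h1
    rw [← h1]
    have : ∑ p ∈ s, c p * (f p.1 x * g p.2 y) =
        ∑ p ∈ A ×ˢ B, c' p * (f p.1 x * g p.2 y) := by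
      rw [← Finset.sum_subset hsub (fun p _ hp => by simp [c', hp])]
      exact Finset.sum_congr rfl fun p hp => by simp [c', hp]
    rw [this, Finset.sum_product_right]
    refine Finset.sum_congr rfl fun j _ => ?_
    rw [Finset.sum_mul]
    exact Finset.sum_congr rfl fun i _ => by ring
  have key2 : ∀ j ∈ B, ∀ x, ∑ i ∈ A, c' (i, j) * f i x = 0 := by
    intro j hj x
    refine hg B (fun j => ∑ i ∈ A, c' (i, j) * f i x) ?_ j hj
    ext y
    simpa using key x y
  have := hf A (fun i => c' (i, p.2)) (by ext x; simpa using key2 p.2 (Finset.mem_image_of_mem _ hp) x)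
    p.1 (Finset.mem_image_of_mem _ hp)
  simpa [c', hp] using this

/-- A linear map to functions is separating if it stays injective after extension of scalars. -/
def IsSeparating (f : V →ₗ[k] (X → F)) : Prop :=
  Function.Injective (f.liftBaseChange F)

/-- Trades injectivity on F ⊗ V for independence of a single basis, the form in which products and
descent are handled. -/
theorem isSeparating_iff_linearIndependent {I : Type*} (b : Module.Basis I k V)
    (f : V →ₗ[k] (X → F)) : IsSeparating f ↔ LinearIndependent F (f ∘ b) := by
  have h : f ∘ b = (f.liftBaseChange F) ∘ (Algebra.TensorProduct.basis F b) := by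
    ext i; simp
  rw [h, IsSeparating]
  constructor
  · intro hi
    exact (Algebra.TensorProduct.basis F b).linearIndependent.map' _ (LinearMap.ker_eq_bot.2 hi)
  · intro hi
    rw [← LinearMap.ker_eq_bot]
    refine LinearMap.ker_eq_bot'.2 fun m hm => ?_
    have h2 := (Algebra.TensorProduct.basis F b).linearCombination_repr m
    rw [← h2, Finsupp.apply_linearCombination] at hm
    rw [← h2, (linearIndependent_iff.1 hi) _ hm, map_zero]

/-- The product `v ⊗ w ↦ ((x, y) ↦ f v x * g w y)` of two linear maps to functions. -/
noncomputable def tensorEval (f : V →ₗ[k] (X → F)) (g : W →ₗ[k] (Y → F)) :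
    V ⊗[k] W →ₗ[k] (X × Y → F) :=
  TensorProduct.lift (LinearMap.mk₂ k (fun v w q => f v q.1 * g w q.2)
    (fun _ _ _ => by ext; simp [add_mul]) (fun _ _ _ => by ext; simp)
    (fun _ _ _ => by ext; simp [mul_add]) (fun _ _ _ => by ext; simp))

@[simp] theorem tensorEval_tmul (f : V →ₗ[k] (X → F)) (g : W →ₗ[k] (Y → F)) (v : V) (w : W)
    (q : X × Y) : tensorEval f g (v ⊗ₜ w) q = f v q.1 * g w q.2 := rfl

/-- Consequently elements of a tensor product are equal once their values at all tuples of points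
agree. All coalgebra identities below are checked in this way. -/
theorem IsSeparating.tensor {f : V →ₗ[k] (X → F)} {g : W →ₗ[k] (Y → F)} (hf : IsSeparating f)
    (hg : IsSeparating g) : IsSeparating (tensorEval f g) := by
  let b := Module.Basis.ofVectorSpace k V
  let c := Module.Basis.ofVectorSpace k W
  rw [isSeparating_iff_linearIndependent (b.tensorProduct c)]
  rw [isSeparating_iff_linearIndependent b] at hf
  rw [isSeparating_iff_linearIndependent c] at hg
  convert! hf.mul_prod hg using 1
  ext p q
  simp [Module.Basis.tensorProduct_apply']

theorem IsSeparating.injective {f : V →ₗ[k] (X → F)} (hf : IsSeparating f) :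
    Function.Injective f := by
  let b := Module.Basis.ofVectorSpace k V
  rw [isSeparating_iff_linearIndependent b] at hf
  have h := hf.restrict_scalars' k
  rw [← LinearMap.ker_eq_bot]
  refine LinearMap.ker_eq_bot'.2 fun m hm => ?_
  have h2 := b.linearCombination_repr m
  rw [← h2, Finsupp.apply_linearCombination] at hm
  rw [← h2, (linearIndependent_iff.1 h) _ hm, map_zero]

theorem isSeparating_self (f : W →ₗ[k] (X → k)) (hf : Function.Injective f) : IsSeparating f := by
  let b := Module.Basis.ofVectorSpace k W
  rw [isSeparating_iff_linearIndependent b]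
  exact b.linearIndependent.map' f (LinearMap.ker_eq_bot.2 hf)

end Separating

/-! ### Operators on L defined by E ⊗ H, and group-like elements as embeddings -/

namespace HopfGaloisStructure

variable {K : Type u} {L : Type v} [Field K] [Field L] [Algebra K L] (S : HopfGaloisStructure K L)
  {E : Type w} [Field E] [Algebra K E] (i : L →ₐ[K] E)

/-- The operator on `L` given by an element of `E ⊗ H`, with values in an extension `E` of `L`. -/
noncomputable def operator : E ⊗[K] S.H →ₗ[E] (L →ₗ[K] E) :=
  LinearMap.liftBaseChange E ((LinearMap.compRight K i.toLinearMap).comp S.act.toLinearMap)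

@[simp] theorem operator_tmul (a : E) (h : S.H) (y : L) :
    S.operator i (a ⊗ₜ h) y = a * i (S.act h y) := by
  simp [operator]

/-- Surjectivity in the Galois condition provides, for each basis vector of H, a tensor in L ⊗ L
representing its coordinate functional. Pairing that tensor with the operator of m recovers the
coordinate of m, so a zero operator comes from zero. -/
theorem operator_injective : Function.Injective (S.operator i) := by
  classical
  let b := Module.Basis.ofVectorSpace K S.H
  rw [← LinearMap.ker_eq_bot]
  refine LinearMap.ker_eq_bot'.2 fun m hm => ?_
  refine (Algebra.TensorProduct.basis E b).ext_elem fun k => ?_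
  rw [map_zero, Finsupp.zero_apply]
  obtain ⟨t, ht⟩ := S.galois.2 ((Algebra.linearMap K L).comp (b.coord k))
  -- pairing of `L ⊗ L` with `E ⊗ H`
  have key : ∀ (t : L ⊗[K] L) (m : E ⊗[K] S.H),
      TensorProduct.lift (LinearMap.mk₂ K (fun x y => i x * S.operator i m y)
        (fun _ _ _ => by simp [add_mul]) (fun _ _ _ => by simp)
        (fun _ _ _ => by simp [mul_add]) (fun _ _ _ => by simp)) t =
      LinearMap.liftBaseChange E (i.toLinearMap.comp ((TensorProduct.lift
      ((LinearMap.llcomp K S.H L L).compl₁₂ (LinearMap.mul K L) S.act.toLinearMap.flip) :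
        L ⊗[K] L →ₗ[K] (S.H →ₗ[K] L)) t)) m := by
    intro t m
    induction t with
    | zero => simp
    | add t t' h h' => rw [map_add, h, h', map_add, LinearMap.comp_add]
                       simp [LinearMap.liftBaseChange]
    | tmul x y =>
      induction m with
      | zero => simp
      | add m m' h h' =>
        simp only [TensorProduct.lift.tmul, LinearMap.mk₂_apply] at h h' ⊢
        rw [map_add, map_add, ← h, ← h']; simp [mul_add]
      | tmul a h => simp; ring
  have h1 := key t m
  rw [ht, hm] at h1
  have h2 : (LinearMap.liftBaseChange E (i.toLinearMap.comp
      ((Algebra.linearMap K L).comp (b.coord k)))) m =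
      (Algebra.TensorProduct.basis E b).repr m k := by
    clear hm h1
    induction m with
    | zero => simp
    | add m m' h h' => simp [h, h']
    | tmul a h => simp
  rw [← h2, ← h1]
  clear h1 h2 ht
  induction t with
  | zero => simp
  | add t t' h h' => rw [map_add, h, h', add_zero]
  | tmul x y => simp

section FiniteDimensional

variable [FiniteDimensional K L]

theorem finite_carrier : FiniteDimensional K S.H := by
  have h1 : FiniteDimensional K (S.H →ₗ[K] L) :=
    Module.Finite.equiv (LinearEquiv.ofBijective _ S.galois)
  have h2 : FiniteDimensional K (Module.Dual K S.H) :=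
    Module.Finite.of_injective (LinearMap.compRight K (Algebra.linearMap K L)) (by
      intro f g hfg
      ext h
      exact (algebraMap K L).injective (LinearMap.congr_fun hfg h))
  exact Module.finite_dual_iff K |>.1 h2

theorem finrank_carrier : Module.finrank K S.H = Module.finrank K L := by
  have := S.finite_carrier
  have h := (LinearEquiv.ofBijective _ S.galois).finrank_eq
  rw [Module.finrank_tensorProduct, Module.finrank_linearMap] at h
  exact (Nat.eq_of_mul_eq_mul_right Module.finrank_pos h).symm

theorem operator_bijective : Function.Bijective (S.operator i) := by
  have := S.finite_carrier
  refine ⟨S.operator_injective i,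
    (LinearMap.injective_iff_surjective_of_finrank_eq_finrank ?_).1 (S.operator_injective i)⟩
  rw [Module.finrank_baseChange, S.finrank_carrier, Module.finrank_linearMap_self]

end FiniteDimensional

theorem operator_one (ξ : E ⊗[K] S.H) :
    S.operator i ξ 1 = Coalgebra.counit (R := E) ξ := by
  induction ξ with
  | zero => simp
  | add m m' h h' => simp [h, h']
  | tmul a h => simp [S.act_one, Algebra.smul_def, mul_comm]

/-- `operator` as a map to functions. -/
noncomputable def operatorFun : E ⊗[K] S.H →ₗ[E] (L → E) :=
  LinearMap.ltoFun K L E E ∘ₗ S.operator i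

@[simp] theorem operatorFun_apply (ξ : E ⊗[K] S.H) (y : L) :
    S.operatorFun i ξ y = S.operator i ξ y := rfl

theorem isSeparating_operatorFun : IsSeparating (S.operatorFun i) :=
  isSeparating_self _ fun _ _ h => S.operator_injective i (DFunLike.coe_injective h)

theorem tensorEval_comul (ξ : E ⊗[K] S.H) (x y : L) :
    tensorEval (S.operatorFun i) (S.operatorFun i) (Coalgebra.comul ξ) (x, y) =
      S.operator i ξ (x * y) := by
  induction ξ with
  | zero => simp
  | add m m' h h' => rw [map_add, map_add, Pi.add_apply, h, h', map_add]; rfl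
  | tmul a h =>
    rw [operator_tmul, S.act_mul, TensorProduct.comul_tmul]
    generalize (Coalgebra.comul (R := K) h) = t
    rw [CommSemiring.comul_apply]
    induction t with
    | zero => simp
    | add t t' h h' => 
      rw [TensorProduct.tmul_add, map_add, map_add, Pi.add_apply, h, h', map_add, map_add, map_add,
        mul_add]
    | tmul g h => simp; ring

/-- The comultiplication of ξ takes the value ξ(xy) at (x, y), whereas ξ ⊗ ξ takes the value
ξ(x)ξ(y), and evaluation on the tensor square is injective. The counit is evaluation at 1. -/
theorem isGroupLikeElem_iff (ξ : E ⊗[K] S.H) :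
    IsGroupLikeElem E ξ ↔ S.operator i ξ 1 = 1 ∧
      ∀ x y, S.operator i ξ (x * y) = S.operator i ξ x * S.operator i ξ y := by
  rw [_root_.isGroupLikeElem_iff, operator_one]
  refine and_congr_right fun _ => ?_
  rw [← ((S.isSeparating_operatorFun i).tensor (S.isSeparating_operatorFun i)).injective.eq_iff,
    funext_iff]
  simp only [Prod.forall, tensorEval_comul, tensorEval_tmul, operatorFun_apply]

section Galois

variable [FiniteDimensional K L]

/-- Group-like elements of `E ⊗ H` are the embeddings of `L` into `E`. -/
noncomputable def groupLikeEquiv : GroupLike E (E ⊗[K] S.H) ≃ (L →ₐ[K] E) where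
  toFun ξ := AlgHom.ofLinearMap (S.operator i ξ.1) ((S.isGroupLikeElem_iff i _).1 ξ.2).1
    ((S.isGroupLikeElem_iff i _).1 ξ.2).2
  invFun f := ⟨(LinearEquiv.ofBijective _ (S.operator_bijective i)).symm f.toLinearMap, by
    have h := (LinearEquiv.ofBijective _ (S.operator_bijective i)).apply_symm_apply f.toLinearMap
    rw [LinearEquiv.ofBijective_apply] at h
    rw [S.isGroupLikeElem_iff i, h]
    simp⟩
  left_inv ξ := by
    ext
    apply S.operator_injective i
    exact (LinearEquiv.ofBijective _ (S.operator_bijective i)).apply_symm_apply _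
  right_inv f := by
    ext x
    exact LinearMap.congr_fun
      ((LinearEquiv.ofBijective _ (S.operator_bijective i)).apply_symm_apply f.toLinearMap) x

@[simp] theorem groupLikeEquiv_apply (ξ : GroupLike E (E ⊗[K] S.H)) (x : L) :
    S.groupLikeEquiv i ξ x = S.operator i ξ.1 x := rfl

theorem operator_groupLikeEquiv_symm (f : L →ₐ[K] E) :
    S.operator i ((S.groupLikeEquiv i).symm f).1 = f.toLinearMap :=
  (LinearEquiv.ofBijective _ (S.operator_bijective i)).apply_symm_apply _

/-- Group-like elements of `L ⊗ H` are the elements of the Galois group. -/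
noncomputable def groupLikeEquivGal : GroupLike L (L ⊗[K] S.H) ≃ Gal(L/K) :=
  (S.groupLikeEquiv (AlgHom.id K L)).trans (Algebra.IsAlgebraic.algEquivEquivAlgHom K L).symm.toEquiv

end Galois

end HopfGaloisStructure
-- Skew brace structures; Hopf algebras spanned by group-like elements
/-- A skew brace: an additive and a multiplicative group structure on the same set such that
`a (b + c) = a b - a + a c`. -/
class IsSkewBrace (A : Type*) [Group A] [AddGroup A] : Prop where
  mul_add_eq : ∀ a b c : A, a * (b + c) = a * b - a + a * c

/-- The additive structures of type `G` making the group `A` into a skew brace. -/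
def SkewBraceOfType (A : Type*) [Group A] (G : Type*) [Group G] : Type _ :=
  {_S : AddGroup A // IsSkewBrace A ∧ Nonempty (Multiplicative A ≃* G)}

theorem SkewBraceOfType.ext {A : Type*} [Group A] {G : Type*} [Group G]
    {S T : SkewBraceOfType A G} (h : ∀ a b, S.1.add a b = T.1.add a b) : S = T :=
  Subtype.ext (AddGroup.ext (by ext a b; exact h a b))

instance {A : Type*} [Finite A] : Finite (AddGroup A) :=
  Finite.of_injective (fun S : AddGroup A => S.add) fun S T h =>
    AddGroup.ext (by ext a b; exact congrFun (congrFun h a) b)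

instance {A : Type*} [Group A] [Finite A] {G : Type*} [Group G] : Finite (SkewBraceOfType A G) :=
  Subtype.finite

theorem finite_groupLike {k A : Type*} [Field k] [Ring A] [HopfAlgebra k A]
    [FiniteDimensional k A] : Finite (GroupLike k A) :=
  linearIndep_groupLikeVal.finite

/-- A Hopf algebra with as many group-like elements as its dimension is a group algebra. -/
theorem liftGroupLikeBialgHom_bijective {k A : Type*} [Field k] [Ring A] [HopfAlgebra k A]
    [FiniteDimensional k A] (h : Nat.card (GroupLike k A) = Module.finrank k A) :
    Function.Bijective (MonoidAlgebra.liftGroupLikeBialgHom (R := k) (A := A)) := by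
  have := finite_groupLike (k := k) (A := A)
  have := Fintype.ofFinite (GroupLike k A)
  let b : Module.Basis (GroupLike k A) k A :=
    basisOfLinearIndependentOfCardEqFinrank linearIndep_groupLikeVal (by
      rw [← h, Nat.card_eq_fintype_card])
  have hb : ∀ x : MonoidAlgebra k (GroupLike k A), MonoidAlgebra.liftGroupLikeBialgHom x =
      ((MonoidAlgebra.coeffLinearEquiv k).trans b.repr.symm) x := by
    intro x
    induction x using MonoidAlgebra.induction_linear with
    | zero => simp
    | add f g hf hg => rw [map_add, map_add, hf, hg]
    | single a r => simp [b, MonoidAlgebra.lift_single]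
  rw [funext hb]
  exact LinearEquiv.bijective _

/-- The group-like elements of a group algebra. -/
noncomputable def groupLikeMonoidAlgebraEquiv (k G : Type*) [Field k] [Group G] :
    GroupLike k (MonoidAlgebra k G) ≃* G :=
  (MulEquiv.ofBijective
    (MonoidHom.mk' (fun g : G => (⟨MonoidAlgebra.of k G g, MonoidAlgebra.isGroupLikeElem_of g⟩ :
      GroupLike k (MonoidAlgebra k G))) (fun a b => by ext; simp))
    ⟨fun a b h => MonoidAlgebra.of_injective (congrArg GroupLike.val h), fun x => by
      obtain ⟨g, hg⟩ := MonoidAlgebra.isGroupLikeElem_iff_mem_range_of.1 x.2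
      exact ⟨g, by ext1; exact hg⟩⟩).symm

/-- Isomorphic bialgebras have isomorphic groups of group-like elements. -/
def GroupLike.congr {k A B : Type*} [Field k] [Ring A] [HopfAlgebra k A] [Ring B] [HopfAlgebra k B]
    (e : A ≃ₐc[k] B) : GroupLike k A ≃* GroupLike k B where
  toFun x := ⟨e x.1, x.2.map e⟩
  invFun x := ⟨e.symm x.1, x.2.map e.symm⟩
  left_inv x := by ext; simp
  right_inv x := by ext; simp
  map_mul' x y := by ext; simp

theorem nonempty_bialgEquiv_monoidAlgebra_iff {k A G : Type*} [Field k] [Ring A] [HopfAlgebra k A]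
    [FiniteDimensional k A] [Group G] (h : Nat.card (GroupLike k A) = Module.finrank k A) :
    Nonempty (A ≃ₐc[k] MonoidAlgebra k G) ↔ Nonempty (GroupLike k A ≃* G) := by
  constructor
  · rintro ⟨e⟩
    exact ⟨(GroupLike.congr e).trans (groupLikeMonoidAlgebraEquiv k G)⟩
  · rintro ⟨e⟩
    exact ⟨(BialgEquiv.ofBijective _ (liftGroupLikeBialgHom_bijective h)).symm.trans
      (MonoidAlgebra.domCongrBialgEquiv k k e)⟩

/-! ### From a Hopf–Galois structure to a skew brace on the Galois group -/

namespace HopfGaloisStructure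

variable {K : Type u} {L : Type v} [Field K] [Field L] [Algebra K L]
  [FiniteDimensional K L] (S : HopfGaloisStructure K L)

/-- The group-like element of `L ⊗ H` acting on `L` as a given element of the Galois group. -/
noncomputable def grp (σ : Gal(L/K)) : L ⊗[K] S.H := (S.groupLikeEquivGal.symm σ).1

@[simp] theorem operator_grp (σ : Gal(L/K)) (y : L) :
    S.operator (AlgHom.id K L) (S.grp σ) y = σ y := by
  rw [grp, groupLikeEquivGal, Equiv.symm_trans_apply, operator_groupLikeEquiv_symm]
  rfl

theorem grp_injective : Function.Injective S.grp := fun σ τ h => by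
  ext y
  rw [← S.operator_grp, h, S.operator_grp]

/-- The additive group structure on the Galois group given by a Hopf-Galois structure. -/
@[reducible]
noncomputable def addGroup : AddGroup Gal(L/K) :=
  (S.groupLikeEquivGal.symm.trans Additive.ofMul).addGroup

theorem grp_add (σ τ : Gal(L/K)) : S.grp (S.addGroup.add σ τ) = S.grp σ * S.grp τ := by
  change (S.groupLikeEquivGal.symm (S.groupLikeEquivGal
    (S.groupLikeEquivGal.symm σ * S.groupLikeEquivGal.symm τ))).1 = _
  rw [Equiv.symm_apply_apply]
  rfl

/-- The Galois group acts on `L ⊗ H` through the left factor. -/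
noncomputable def twist (σ : Gal(L/K)) : L ⊗[K] S.H →ₐ[K] L ⊗[K] S.H :=
  Algebra.TensorProduct.map (σ : L →ₐ[K] L) (AlgHom.id K S.H)

omit [FiniteDimensional K L] in
theorem operator_mul_tmul (ξ : L ⊗[K] S.H) (b : L) (h : S.H) (y : L) :
    S.operator (AlgHom.id K L) (ξ * b ⊗ₜ h) y =
      b * S.operator (AlgHom.id K L) ξ (S.act h y) := by
  induction ξ with
  | zero => simp
  | add m m' h h' => simp [add_mul, mul_add, h, h']
  | tmul a g => simp; ring

/-- The product in L ⊗ H is not composition of operators, because under composition σ acts on the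
coefficient as well; twisting by σ⁻¹ beforehand compensates for this. -/
theorem operator_grp_mul (σ : Gal(L/K)) (ξ : L ⊗[K] S.H) (y : L) :
    S.operator (AlgHom.id K L) (S.grp σ * ξ) y =
      σ (S.operator (AlgHom.id K L) (S.twist σ⁻¹ ξ) y) := by
  induction ξ with
  | zero => simp
  | add m m' h h' => simp [mul_add, h, h']
  | tmul a g => 
    rw [operator_mul_tmul, operator_grp, twist, Algebra.TensorProduct.map_tmul, operator_tmul,
      map_mul]
    congr 1
    exact (σ.apply_symm_apply a).symm

/-- Apply `operator_grp_mul` to σ⁻¹ and τ: the product of their group-like elements acts as σ⁻¹ + τ,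
and also as σ⁻¹ composed with the twist by σ. This identifies the twist with the map λ_σ of the
future skew brace. -/
theorem twist_grp (σ τ : Gal(L/K)) :
    S.twist σ (S.grp τ) = S.grp (σ * S.addGroup.add σ⁻¹ τ) := by
  apply S.operator_injective (AlgHom.id K L)
  ext y
  rw [operator_grp, AlgEquiv.mul_apply, ← S.operator_grp (S.addGroup.add _ _), grp_add,
    operator_grp_mul, inv_inv]
  exact (σ.apply_symm_apply _).symm

theorem isSkewBrace : @IsSkewBrace Gal(L/K) _ S.addGroup := by
  let := S.addGroup
  -- Twisting is an algebra homomorphism, which makes λ_σ additive.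
  have h1 : ∀ σ τ ρ : Gal(L/K),
      σ * (σ⁻¹ + (τ + ρ)) = σ * (σ⁻¹ + τ) + σ * (σ⁻¹ + ρ) := by
    intro σ τ ρ
    apply S.grp_injective
    have e : ∀ a b : Gal(L/K), S.grp (a + b) = S.grp a * S.grp b := S.grp_add
    have e' : ∀ a b : Gal(L/K), S.twist a (S.grp b) = S.grp (a * (a⁻¹ + b)) := S.twist_grp
    rw [← e', e, map_mul, e', e', e]
  have h2 : ∀ a c : Gal(L/K), a * (a⁻¹ + c) = -a + a * c := by
    intro a c
    -- This argument is chosen so that adding it to a⁻¹ gives 0, which is also the identity 1.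
    have := h1 a (-a⁻¹ + 0) (c)
    have h0 : (0 : Gal(L/K)) = 1 := by
      have := h1 1 0 0
      have h : (1 : Gal(L/K)) = 0 := by simpa using this
      exact h.symm
    rw [add_zero, add_neg_cancel, h0, mul_one, ← add_assoc, add_neg_cancel, zero_add] at this
    rw [this, neg_add_cancel_left]
  refine ⟨fun a b c => ?_⟩
  have := h1 a (-a⁻¹ + b) c
  rw [ ← add_assoc, ← add_assoc, add_neg_cancel, zero_add, h2] at this
  rw [this, sub_eq_add_neg, add_assoc]

/-- The additive group of the Galois group consists of the group-like elements of `L ⊗ H`. -/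
noncomputable def multiplicativeEquivGroupLike :
    letI := S.addGroup
    Multiplicative Gal(L/K) ≃* GroupLike L (L ⊗[K] S.H) :=
  letI := S.addGroup
  { toFun := fun σ => S.groupLikeEquivGal.symm σ.toAdd
    invFun := fun ξ => Multiplicative.ofAdd (S.groupLikeEquivGal ξ)
    left_inv := fun σ => by simp
    right_inv := fun σ => by simp
    map_mul' := fun σ τ => by
      ext1
      exact S.grp_add _ _ }

section BaseChange

variable {E : Type w} [Field E] [Algebra K E] (i : L →ₐ[K] E)

/-- Extension of scalars from `L ⊗ H` to `E ⊗ H`. -/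
noncomputable def extend : L ⊗[K] S.H →ₐ[K] E ⊗[K] S.H :=
  Algebra.TensorProduct.map i (AlgHom.id K S.H)

omit [FiniteDimensional K L] in
theorem operator_extend (ξ : L ⊗[K] S.H) (y : L) :
    S.operator i (S.extend i ξ) y = i (S.operator (AlgHom.id K L) ξ y) := by
  induction ξ with
  | zero => simp
  | add m m' h h' => simp [h, h']
  | tmul a g => simp [extend]

omit [FiniteDimensional K L] in
theorem isGroupLikeElem_extend {ξ : L ⊗[K] S.H} (hξ : IsGroupLikeElem L ξ) :
    IsGroupLikeElem E (S.extend i ξ) := by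
  rw [S.isGroupLikeElem_iff (AlgHom.id K L)] at hξ
  rw [S.isGroupLikeElem_iff i]
  simp [operator_extend, hξ]

/-- Extension of scalars on group-like elements. -/
noncomputable def extendGroupLike : GroupLike L (L ⊗[K] S.H) →* GroupLike E (E ⊗[K] S.H) where
  toFun ξ := ⟨S.extend i ξ.1, S.isGroupLikeElem_extend i ξ.2⟩
  map_one' := by ext1; exact map_one (S.extend i)
  map_mul' ξ ξ' := by ext1; exact map_mul (S.extend i) _ _

omit [FiniteDimensional K L] in
theorem extendGroupLike_injective : Function.Injective (S.extendGroupLike i) := by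
  intro ξ ξ' h
  ext1
  apply S.operator_injective (AlgHom.id K L)
  ext y
  refine i.injective ?_
  change i _ = i _
  rw [← operator_extend, ← operator_extend]
  exact congrArg (fun ζ => S.operator i ζ y) (congrArg GroupLike.val h)

variable [IsGalois K L]

/-- Over L there are already as many group-like elements as the dimension. Group-like elements are
linearly independent, so none can be added over E. -/
theorem extendGroupLike_bijective :
    Function.Bijective (S.extendGroupLike i) ∧
      Nat.card (GroupLike E (E ⊗[K] S.H)) = Module.finrank E (E ⊗[K] S.H) := by
  have := S.finite_carrier
  have h1 : Finite (GroupLike E (E ⊗[K] S.H)) := finite_groupLike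
  have h2 : Nat.card (GroupLike L (L ⊗[K] S.H)) = Module.finrank K L :=
    (Nat.card_congr S.groupLikeEquivGal).trans (IsGalois.card_aut_eq_finrank K L)
  have h3 : Module.finrank E (E ⊗[K] S.H) = Module.finrank K L := by
    rw [Module.finrank_baseChange, S.finrank_carrier]
  have h4 : Nat.card (GroupLike E (E ⊗[K] S.H)) ≤ Module.finrank E (E ⊗[K] S.H) := by
    have := Fintype.ofFinite (GroupLike E (E ⊗[K] S.H))
    rw [Nat.card_eq_fintype_card]
    exact linearIndep_groupLikeVal.fintype_card_le_finrank
  have h5 := Nat.card_le_card_of_injective _ (S.extendGroupLike_injective i)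
  have h6 : Nat.card (GroupLike L (L ⊗[K] S.H)) = Nat.card (GroupLike E (E ⊗[K] S.H)) := by lia
  exact ⟨(Nat.bijective_iff_injective_and_card _).2 ⟨S.extendGroupLike_injective i, h6⟩, by lia⟩

end BaseChange

variable [IsGalois K L]

theorem hasType_iff {G : Type w} [Group G] :
    S.HasType G ↔ letI := S.addGroup; Nonempty (Multiplicative Gal(L/K) ≃* G) := by
  have := S.finite_carrier
  let i : L →ₐ[K] AlgebraicClosure K := IsAlgClosed.lift
  obtain ⟨h1, h2⟩ := S.extendGroupLike_bijective i
  rw [HasType, nonempty_bialgEquiv_monoidAlgebra_iff h2]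
  let := S.addGroup
  let e : Multiplicative Gal(L/K) ≃* _ := S.multiplicativeEquivGroupLike.trans (MulEquiv.ofBijective _ h1)
  exact ⟨fun ⟨f⟩ => ⟨e.trans f⟩, fun ⟨f⟩ => ⟨e.symm.trans f⟩⟩

omit [IsGalois K L] in
theorem addGroup_eq_of_equiv {S T : HopfGaloisStructure K L} (h : S ≈ T) :
    S.addGroup = T.addGroup := by
  obtain ⟨f, hf⟩ := h
  let F : L ⊗[K] S.H →ₐ[K] L ⊗[K] T.H :=
    Algebra.TensorProduct.map (AlgHom.id K L) (f : S.H →ₐ[K] T.H)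
  have hF : ∀ ξ y, T.operator (AlgHom.id K L) (F ξ) y = S.operator (AlgHom.id K L) ξ y := by
    intro ξ y
    induction ξ with
    | zero => simp
    | add m m' h h' => simp [h, h']
    | tmul a g => simp [F, hf]
  have hF' : ∀ σ, F (S.grp σ) = T.grp σ := fun σ => by
    apply T.operator_injective (AlgHom.id K L)
    ext y
    simp [hF]
  refine AddGroup.ext ?_
  ext1 σ
  ext1 τ
  apply T.grp_injective
  change T.grp (S.addGroup.add σ τ) = T.grp (T.addGroup.add σ τ)
  rw [grp_add, ← hF', grp_add, map_mul, hF', hF']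

end HopfGaloisStructure
-- A Hopf–Galois structure is determined by its skew brace
namespace HopfGaloisStructure

variable {K : Type u} {L : Type v} [Field K] [Field L] [Algebra K L]
  (S T : HopfGaloisStructure K L)

/-- The action of `H` as a linear map to functions. -/
noncomputable def actFun : S.H →ₗ[K] (L → L) :=
  LinearMap.ltoFun K L L K ∘ₗ S.act.toLinearMap

@[simp] theorem actFun_apply (h : S.H) (y : L) : S.actFun h y = S.act h y := rfl

theorem isSeparating_actFun : IsSeparating S.actFun := by
  intro ξ ξ' h
  apply S.operator_injective (AlgHom.id K L)
  have key : ∀ ξ : L ⊗[K] S.H, S.actFun.liftBaseChange L ξ =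
      fun y => S.operator (AlgHom.id K L) ξ y := by
    intro ξ
    induction ξ with
    | zero => ext; simp
    | add m m' h h' => rw [map_add, h, h', map_add]; rfl
    | tmul a g => ext; simp
  rw [key, key] at h
  ext y
  exact congrFun h y

theorem act_injective : Function.Injective S.act := fun h h' e =>
  S.isSeparating_actFun.injective (by ext y; simp [e])

theorem tensorEval_actFun_comul (h : S.H) (x y : L) :
    tensorEval S.actFun S.actFun (Coalgebra.comul (R := K) h) (x, y) = S.act h (x * y) := by
  rw [S.act_mul]
  generalize (Coalgebra.comul (R := K) h) = t
  induction t with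
  | zero => simp
  | add t t' h h' => rw [map_add, map_add, Pi.add_apply, h, h', map_add]
  | tmul g h => simp

-- The action is faithful, so H is its image in End_K(L) as an algebra. The counit and the
-- comultiplication are forced by the values at 1 and on products.
variable {S T} in
theorem equiv_of_range_eq (hST : S.act.range = T.act.range) : S ≈ T := by
  let f : S.H ≃ₐ[K] T.H := (AlgEquiv.ofInjective S.act S.act_injective).trans
    ((Subalgebra.equivOfEq _ _ hST).trans (AlgEquiv.ofInjective T.act T.act_injective).symm)
  have hf : ∀ h, T.act (f h) = S.act h := fun h =>
    congrArg Subtype.val ((AlgEquiv.ofInjective T.act T.act_injective).apply_symm_apply _)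
  have hf2 : ∀ t q, tensorEval T.actFun T.actFun (Algebra.TensorProduct.map f.toAlgHom f.toAlgHom t) q =
      tensorEval S.actFun S.actFun t q := by
    intro t q
    induction t with
    | zero => simp
    | add t t' h h' => rw [map_add, map_add, Pi.add_apply, h, h', map_add]; rfl
    | tmul g h => simp [hf]
  refine ⟨BialgEquiv.ofAlgEquiv f ?_ ?_, hf⟩
  · ext h
    refine (algebraMap K L).injective ?_
    have h1 := T.act_one (f h)
    rw [hf, S.act_one] at h1
    exact h1.symm
  · ext h
    refine (T.isSeparating_actFun.tensor T.isSeparating_actFun).injective ?_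
    ext ⟨x, y⟩
    refine (hf2 _ _).trans ?_
    refine (S.tensorEval_actFun_comul h x y).trans ?_
    refine Eq.trans ?_ (T.tensorEval_actFun_comul (f h) x y).symm
    rw [hf]

variable [FiniteDimensional K L]

theorem linearIndependent_grp : LinearIndependent L S.grp :=
  (linearIndep_groupLikeVal (R := L) (A := L ⊗[K] S.H)).comp _ S.groupLikeEquivGal.symm.injective

variable [IsGalois K L]

theorem span_range_grp : Submodule.span L (Set.range S.grp) = ⊤ := by
  have := S.finite_carrier
  have := Fintype.ofFinite Gal(L/K)
  apply S.linearIndependent_grp.span_eq_top_of_card_eq_finrank'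
  rw [← Nat.card_eq_fintype_card, IsGalois.card_aut_eq_finrank, Module.finrank_baseChange,
    S.finrank_carrier]

omit [FiniteDimensional K L] [IsGalois K L] in
theorem twist_smul (σ : Gal(L/K)) (a : L) (ξ : L ⊗[K] S.H) :
    S.twist σ (a • ξ) = σ a • S.twist σ ξ := by
  induction ξ with
  | zero => simp
  | add m m' h h' => simp [h, h']
  | tmul b g => simp [twist, TensorProduct.smul_tmul']

/-- Galois descent: in a K-basis of H the coordinates of an invariant element are fixed by the
Galois group, hence lie in K. -/
theorem exists_eq_tmul_of_twist_eq {ξ : L ⊗[K] S.H} (hξ : ∀ σ, S.twist σ ξ = ξ) :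
    ∃ h : S.H, ξ = 1 ⊗ₜ h := by
  have := S.finite_carrier
  let b := Module.finBasis K S.H
  let B := Algebra.TensorProduct.basis L b
  have hB : ∀ (σ : Gal(L/K)) ξ j, B.repr (S.twist σ ξ) j = σ (B.repr ξ j) := by
    intro σ ξ j
    induction ξ with
    | zero => simp
    | add m m' h h' => simp [h, h']
    | tmul a g => simp [twist, B]
  have h1 : ∀ j, ∃ c : K, algebraMap K L c = B.repr ξ j := by
    intro j
    have : ∀ σ : Gal(L/K), σ (B.repr ξ j) = B.repr ξ j := fun σ => by rw [← hB, hξ]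
    exact (IsGalois.mem_range_algebraMap_iff_fixed _).2 this
  choose c hc using h1
  refine ⟨∑ j, c j • b j, ?_⟩
  rw [← B.sum_repr ξ, TensorProduct.tmul_sum]
  refine Finset.sum_congr rfl fun j _ => ?_
  rw [← hc]
  simp [B, TensorProduct.tmul_smul]

variable {S T}

/-- Identifying both L ⊗ H with End_K(L) matches the two bases of group-like elements. As the
additions agree, `twist_grp` shows that the identification commutes with the twists, so it carries
the invariants 1 ⊗ h to invariants. -/
theorem range_act_le (hST : S.addGroup = T.addGroup) : S.act.range ≤ T.act.range := by
  let Φ : L ⊗[K] S.H →ₗ[L] L ⊗[K] T.H :=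
    (LinearEquiv.ofBijective _ (T.operator_bijective (AlgHom.id K L))).symm.toLinearMap ∘ₗ
      S.operator (AlgHom.id K L)
  have hΦ : ∀ ξ, T.operator (AlgHom.id K L) (Φ ξ) = S.operator (AlgHom.id K L) ξ := fun ξ =>
    (LinearEquiv.ofBijective _ (T.operator_bijective (AlgHom.id K L))).apply_symm_apply _
  have hgrp : ∀ σ, Φ (S.grp σ) = T.grp σ := fun σ => by
    apply T.operator_injective (AlgHom.id K L)
    ext y
    simp [hΦ]
  have htw : ∀ σ ξ, T.twist σ (Φ ξ) = Φ (S.twist σ ξ) := by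
    intro σ ξ
    have hξ : ξ ∈ Submodule.span L (Set.range S.grp) := by rw [span_range_grp]; trivial
    induction hξ using Submodule.span_induction with
    | mem x h =>
      obtain ⟨τ, rfl⟩ := h
      rw [hgrp, twist_grp, twist_grp, hgrp, hST]
    | zero => simp
    | add x y _ _ h h' => simp [h, h']
    | smul a x _ h => rw [map_smul, twist_smul, twist_smul, map_smul, h]
  rintro _ ⟨h, rfl⟩
  obtain ⟨h', hh'⟩ := T.exists_eq_tmul_of_twist_eq (ξ := Φ (1 ⊗ₜ h)) fun σ => by
    rw [htw]; simp [twist]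
  refine ⟨h', ?_⟩
  ext y
  have := LinearMap.congr_fun (hΦ (1 ⊗ₜ h)) y
  rw [hh'] at this
  simpa using this

theorem equiv_of_addGroup_eq (hST : S.addGroup = T.addGroup) : S ≈ T :=
  equiv_of_range_eq (le_antisymm (range_act_le hST) (range_act_le hST.symm))

end HopfGaloisStructure
/-! ### Skew braces -/

namespace IsSkewBrace

variable {A : Type*} [Group A] [AddGroup A] [IsSkewBrace A]

variable (A) in
theorem zero_eq_one : (0 : A) = 1 := by
  have h := mul_add_eq (1 : A) 0 0
  simp only [add_zero, one_mul, zero_sub] at h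
  exact (neg_eq_zero.1 h.symm).symm

/-- The automorphism `b ↦ -a + a b` of the additive group. -/
def lam (a : A) : A ≃+ A where
  toFun := fun b => -a + a * b
  invFun := fun b => a⁻¹ * (a + b)
  left_inv := fun b => by simp
  right_inv := fun b => by simp
  map_add' := fun b c => by rw [mul_add_eq, sub_eq_add_neg]; simp only [add_assoc]

theorem lam_apply (a b : A) : lam a b = -a + a * b := rfl

theorem add_lam (a b : A) : a + lam a b = a * b := by simp [lam_apply]

@[simp] theorem lam_one (b : A) : lam 1 b = b := by simp [lam_apply, ← zero_eq_one A]

theorem lam_mul (a b c : A) : lam (a * b) c = lam a (lam b c) := by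
  change -(a * b) + a * b * c = -a + a * (-b + b * c)
  have h := mul_add_eq a b (-b + b * c)
  rw [add_neg_cancel_left, ← mul_assoc] at h
  rw [h, sub_eq_add_neg, ← add_assoc, ← add_assoc, neg_add_cancel, zero_add]

@[simp] theorem lam_lam_inv (a b : A) : lam a (lam a⁻¹ b) = b := by
  rw [← lam_mul, mul_inv_cancel, lam_one]

@[simp] theorem lam_inv_lam (a b : A) : lam a⁻¹ (lam a b) = b := by
  rw [← lam_mul, inv_mul_cancel, lam_one]

theorem mul_lam_inv (a b : A) : a * lam a⁻¹ b = a + b := by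
  rw [← add_lam, lam_lam_inv]

end IsSkewBrace

/-! ### Operators as combinations of automorphisms -/

section GaloisOperator

variable (K : Type u) (L : Type v) [Field K] [Field L] [Algebra K L]

theorem linearIndependent_galois : LinearIndependent L (fun (σ : Gal(L/K)) (y : L) => σ y) := by
  have := (linearIndependent_monoidHom L L).comp (fun σ : Gal(L/K) => (σ : L →* L))
    (fun σ τ h => by ext y; exact DFunLike.congr_fun h y)
  exact this

variable [FiniteDimensional K L]

/-- The operator `∑ c(σ) σ` on `L`. -/
noncomputable def galoisOperator : (Gal(L/K) → L) →ₗ[L] (L →ₗ[K] L) :=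
  Fintype.linearCombination L (fun σ : Gal(L/K) => (σ : L →ₐ[K] L).toLinearMap)

variable {K L}

theorem galoisOperator_apply (c : Gal(L/K) → L) (y : L) :
    galoisOperator K L c y = ∑ σ, c σ * σ y := by
  simp [galoisOperator, Fintype.linearCombination_apply]

theorem galoisOperator_injective : Function.Injective (galoisOperator K L) := by
  rw [← LinearMap.ker_eq_bot]
  refine LinearMap.ker_eq_bot'.2 fun c hc => ?_
  have h := Fintype.linearIndependent_iff.1 (linearIndependent_galois K L) c (by
    ext y
    have := LinearMap.congr_fun hc y
    rw [galoisOperator_apply] at this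
    simpa using this)
  exact funext h

variable [IsGalois K L]

theorem galoisOperator_bijective : Function.Bijective (galoisOperator K L) := by
  refine ⟨galoisOperator_injective,
    (LinearMap.injective_iff_surjective_of_finrank_eq_finrank ?_).1 galoisOperator_injective⟩
  rw [Module.finrank_linearMap_self, Module.finrank_fintype_fun_eq_card, ← Nat.card_eq_fintype_card,
    IsGalois.card_aut_eq_finrank]

/-- The coefficients of an operator. -/
noncomputable def galoisCoeff : (L →ₗ[K] L) ≃ₗ[L] (Gal(L/K) → L) :=
  (LinearEquiv.ofBijective _ galoisOperator_bijective).symm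

theorem galoisCoeff_galoisOperator (c : Gal(L/K) → L) : galoisCoeff (galoisOperator K L c) = c :=
  (LinearEquiv.ofBijective _ galoisOperator_bijective).symm_apply_apply c

theorem galoisOperator_galoisCoeff (f : L →ₗ[K] L) : galoisOperator K L (galoisCoeff f) = f :=
  (LinearEquiv.ofBijective _ galoisOperator_bijective).apply_symm_apply f

theorem apply_eq_sum_galoisCoeff (f : L →ₗ[K] L) (y : L) : f y = ∑ σ, galoisCoeff f σ * σ y := by
  rw [← galoisOperator_apply, galoisOperator_galoisCoeff]

variable (K L) in
open Classical in
/-- Dual families for the embeddings of `L`. -/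
theorem exists_dual_families : ∃ (n : ℕ) (a b : Fin n → L), ∀ σ τ : Gal(L/K),
    ∑ i, τ (b i) * σ (a i) = if τ = σ then 1 else 0 := by
  let B := Module.finBasis K L
  let e : Fin (Module.finrank K L) → (L →ₗ[K] L) := fun i => (Algebra.linearMap K L).comp (B.coord i)
  have h1 : ∀ σ : Gal(L/K), ∑ i, galoisCoeff (e i) 1 * σ (B i) = if σ = 1 then 1 else 0 := by
    intro σ
    -- The automorphism σ expanded in coordinate functionals; the coefficient of the identity
    -- automorphism on both sides gives the orthogonality relation for τ = 1, and applying τ gives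
    -- it in general.
    have h2 : galoisOperator K L (Pi.single σ 1) = ∑ i, σ (B i) • e i := by
      refine B.ext fun j => ?_
      rw [galoisOperator_apply, LinearMap.sum_apply]
      simp [e, Pi.single_apply, Finsupp.single_apply]
    have h3 := congrFun (congrArg galoisCoeff h2) 1
    rw [galoisCoeff_galoisOperator, map_sum, Finset.sum_apply, Pi.single_apply] at h3
    simp_rw [map_smul, Pi.smul_apply, smul_eq_mul] at h3
    simp_rw [mul_comm, ← h3, eq_comm]
  refine ⟨_, B, fun i => galoisCoeff (e i) 1, fun σ τ => ?_⟩
  have h2 := congrArg τ (h1 (τ⁻¹ * σ))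
  rw [map_sum] at h2
  simp_rw [map_mul] at h2
  convert h2 using 2
  · simp [AlgEquiv.mul_apply, AlgEquiv.aut_inv]
  · by_cases h : τ = σ
    · simp [h]
    · have : ¬ (τ⁻¹ * σ = 1) := fun h' => h (inv_mul_eq_one.1 h')
      simp [h, this]

variable (K L) in
theorem exists_trace_eq_one : ∃ u : L, Algebra.trace K L u = 1 :=
  Algebra.trace_surjective K L 1

end GaloisOperator
-- Galois descent: the algebra of operators with equivariant coefficients
open IsSkewBrace

section Descent

variable (K : Type u) (L : Type v) [Field K] [Field L] [Algebra K L] [FiniteDimensional K L]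
  [IsGalois K L] [AddGroup Gal(L/K)] [IsSkewBrace Gal(L/K)]

-- Composition produces c(γ)·γ(d(δ)) at γδ. Equivariance gives γ(d(δ)) = d(λ_γ δ), and γδ = γ + λ_γ
-- δ, so composition is convolution for the addition.
omit [IsGalois K L] in
theorem galoisOperator_mul (c d : Gal(L/K) → L) (hd : ∀ σ γ, d (lam σ γ) = σ (d γ)) :
    galoisOperator K L c ∘ₗ galoisOperator K L d =
      galoisOperator K L (fun ζ => ∑ γ, c γ * d (-γ + ζ)) := by
  ext y
  simp only [LinearMap.comp_apply, galoisOperator_apply, map_sum, map_mul,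
    Finset.sum_mul]
  conv_rhs => rw [Finset.sum_comm]
  rw [Finset.sum_comm]
  refine Finset.sum_congr rfl fun γ _ => ?_
  refine Fintype.sum_equiv ((lam γ).toEquiv.trans (Equiv.addLeft γ)) _ _ fun δ => ?_
  simp only [Equiv.trans_apply, Equiv.coe_addLeft, AddEquiv.toEquiv_eq_coe, EquivLike.coe_coe,
    add_lam, AlgEquiv.mul_apply]
  rw [← lam_apply, hd]
  ring

/-- The operators with equivariant coefficients. -/
noncomputable def descentSubalgebra : Subalgebra K (Module.End K L) where
  carrier := {T | ∀ σ γ : Gal(L/K), galoisCoeff T (lam σ γ) = σ (galoisCoeff T γ)}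
  mul_mem' := by
    intro S T hS hT σ ζ
    have h : S * T = galoisOperator K L (fun ζ => ∑ γ, galoisCoeff S γ * galoisCoeff T (-γ + ζ)) := by
      rw [← galoisOperator_mul K L _ _ hT, galoisOperator_galoisCoeff, galoisOperator_galoisCoeff]
      rfl
    rw [h, galoisCoeff_galoisOperator, map_sum]
    refine (Fintype.sum_equiv (lam σ).toEquiv _ _ fun γ => ?_).symm
    rw [map_mul, ← hS, ← hT, map_add, map_neg]
    rfl
  add_mem' := by
    intro S T hS hT σ γ
    simp [hS σ γ, hT σ γ]
  algebraMap_mem' := by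
    classical
    intro r σ γ
    have h : algebraMap K (Module.End K L) r = galoisOperator K L (Pi.single 0 (algebraMap K L r)) := by
      ext y
      rw [galoisOperator_apply, Finset.sum_eq_single 0 (fun σ _ h => by simp [h]) (by simp),
        zero_eq_one]
      simp [Algebra.smul_def]
    rw [h, galoisCoeff_galoisOperator, Pi.single_apply, Pi.single_apply]
    simp [apply_ite σ]

/-- The type of operators with equivariant coefficients. -/
def Descent : Type v := descentSubalgebra K L

noncomputable instance : Ring (Descent K L) := inferInstanceAs (Ring (descentSubalgebra K L))

noncomputable instance : Algebra K (Descent K L) :=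
  inferInstanceAs (Algebra K (descentSubalgebra K L))

/-- The action of the descended algebra on `L`. -/
noncomputable def Descent.op : Descent K L →ₐ[K] Module.End K L := (descentSubalgebra K L).val

variable {K L}

theorem Descent.op_injective : Function.Injective (Descent.op K L) := Subtype.val_injective

theorem Descent.coeff_lam (h : Descent K L) (σ γ : Gal(L/K)) :
    galoisCoeff (Descent.op K L h) (lam σ γ) = σ (galoisCoeff (Descent.op K L h) γ) := Subtype.property h σ γ

theorem Descent.coeff_mul (h h' : Descent K L) (ζ : Gal(L/K)) :
    galoisCoeff (Descent.op K L (h * h')) ζ = ∑ γ, galoisCoeff (Descent.op K L h) γ * galoisCoeff (Descent.op K L h') (-γ + ζ) := by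
  have e : (Descent.op K L (h * h')) = galoisOperator K L
      (fun ζ => ∑ γ, galoisCoeff (Descent.op K L h) γ * galoisCoeff (Descent.op K L h') (-γ + ζ)) := by
    rw [← galoisOperator_mul K L _ _ h'.coeff_lam, galoisOperator_galoisCoeff, galoisOperator_galoisCoeff]
    rfl
  rw [e, galoisCoeff_galoisOperator]

theorem coeff_algebraMap [DecidableEq Gal(L/K)] (r : K) (ζ : Gal(L/K)) :
    galoisCoeff (algebraMap K (Module.End K L) r) ζ = if ζ = 0 then algebraMap K L r else 0 := by
  have h : algebraMap K (Module.End K L) r = galoisOperator K L (Pi.single 0 (algebraMap K L r)) := by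
    ext y
    rw [galoisOperator_apply, Finset.sum_eq_single 0 (fun σ _ h => by simp [h]) (by simp),
      zero_eq_one]
    simp [Algebra.smul_def]
  rw [h, galoisCoeff_galoisOperator, Pi.single_apply]

/-- The sum over the orbit of `a γ`. -/
noncomputable def orbitSum (γ : Gal(L/K)) (a : L) : Descent K L :=
  ⟨∑ σ : Gal(L/K), σ a • ((lam σ γ : Gal(L/K)) : L →ₐ[K] L).toLinearMap, by
    classical
    have h : ∑ σ : Gal(L/K), σ a • ((lam σ γ : Gal(L/K)) : L →ₐ[K] L).toLinearMap =
        galoisOperator K L (fun ε => ∑ σ, if lam σ γ = ε then σ a else 0) := by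
      ext y
      rw [galoisOperator_apply]
      simp only [Finset.sum_mul]
      rw [Finset.sum_comm]
      simp
    intro τ ε
    rw [h, galoisCoeff_galoisOperator, map_sum]
    refine (Fintype.sum_equiv (Equiv.mulLeft τ) _ _ fun σ => ?_).symm
    simp [lam_mul, apply_ite τ]⟩

theorem orbitSum_apply (γ : Gal(L/K)) (a : L) (y : L) :
    (Descent.op K L (orbitSum γ a)) y = ∑ σ : Gal(L/K), σ a * (lam σ γ : Gal(L/K)) y := by
  have h : Descent.op K L (orbitSum γ a) =
      ∑ σ : Gal(L/K), σ a • ((lam σ γ : Gal(L/K)) : L →ₐ[K] L).toLinearMap := rfl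
  simp [h]

variable (K L) in
/-- Elements of the descended algebra as functions. -/
noncomputable def Descent.toFun : Descent K L →ₗ[K] (L → L) :=
  LinearMap.ltoFun K L L K ∘ₗ (Descent.op K L).toLinearMap

@[simp] theorem Descent.toFun_apply (h : Descent K L) (y : L) : Descent.toFun K L h y = (Descent.op K L h) y := rfl

variable (K L) in
/-- The coefficients of elements of the descended algebra. -/
noncomputable def Descent.coeff : Descent K L →ₗ[K] (Gal(L/K) → L) :=
  (galoisCoeff.restrictScalars K).toLinearMap ∘ₗ (Descent.op K L).toLinearMap

@[simp] theorem Descent.coeff_apply (h : Descent K L) :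
    Descent.coeff K L h = galoisCoeff (Descent.op K L h) := rfl

-- Equivariance turns a relation with coefficients a_j into one with coefficients τ(a_j), for every
-- τ. Weighting by τ(e) and summing gives a K-linear relation with coefficients Tr(e a_j), which
-- vanish for all e; nondegeneracy of the trace form gives a_j = 0.
variable (K L) in
theorem Descent.isSeparating_toFun : IsSeparating (Descent.toFun K L) := by
  let B := Module.Basis.ofVectorSpace K (Descent K L)
  rw [isSeparating_iff_linearIndependent B, linearIndependent_iff']
  intro s a ha
  have h1 : ∑ j ∈ s, a j • (Descent.op K L (B j)) = 0 := by
    ext y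
    have := congrFun ha y
    simpa using this
  have h2 : ∀ γ : Gal(L/K), ∑ j ∈ s, a j * galoisCoeff (Descent.op K L (B j)) γ = 0 := by
    intro γ
    have := congrFun (congrArg galoisCoeff h1) γ
    simpa [map_sum] using this
  have h3 : ∀ τ γ : Gal(L/K), ∑ j ∈ s, τ (a j) * galoisCoeff (Descent.op K L (B j)) γ = 0 := by
    intro τ γ
    have := congrArg τ (h2 (lam τ⁻¹ γ))
    simp only [map_sum, map_mul, ← Descent.coeff_lam, lam_lam_inv, map_zero] at this
    exact this
  have h4 : ∀ e : L, ∑ j ∈ s, Algebra.trace K L (e * a j) • B j = 0 := by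
    intro e
    apply Descent.op_injective
    apply galoisCoeff.injective
    ext γ
    have : ∑ τ : Gal(L/K), τ e * ∑ j ∈ s, τ (a j) * galoisCoeff (Descent.op K L (B j)) γ = 0 := by simp [h3]
    simp only [Finset.mul_sum] at this
    rw [Finset.sum_comm] at this
    have e2 : ∀ (c : K) (x : L →ₗ[K] L), galoisCoeff (c • x) = algebraMap K L c • galoisCoeff x := by
      intro c x
      rw [← map_smul, algebraMap_smul]
    simp only [map_sum, Finset.sum_apply, map_zero, Pi.zero_apply, map_smul, e2, Pi.smul_apply, smul_eq_mul,
      trace_eq_sum_automorphisms, Finset.sum_mul, map_mul]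
    rw [← this]
    exact Finset.sum_congr rfl fun j _ => Finset.sum_congr rfl fun τ _ => by ring
  have h5 : ∀ e, ∀ j ∈ s, Algebra.trace K L (e * a j) = 0 := fun e =>
    (linearIndependent_iff'.1 B.linearIndependent) s _ (h4 e)
  intro j hj
  refine (traceForm_nondegenerate K L).2 (a j) fun e => ?_
  simpa [Algebra.traceForm_apply] using h5 e j hj

variable (K L) in
/-- Evaluation of elements of the tensor square. -/
noncomputable abbrev Descent.eval₂ : Descent K L ⊗[K] Descent K L →ₗ[K] (L × L → L) :=
  tensorEval (Descent.toFun K L) (Descent.toFun K L)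

theorem Descent.eval₂_injective : Function.Injective (Descent.eval₂ K L) :=
  ((Descent.isSeparating_toFun K L).tensor (Descent.isSeparating_toFun K L)).injective

/-- The comultiplication ought to be Σ c(γ) γ ⊗ γ, which lives over L. Dual families and an element
u of trace 1 rewrite it through orbit sums, with traces as coefficients, so that it lives over K. -/
theorem Descent.exists_comul (h : Descent K L) :
    ∃ t : Descent K L ⊗[K] Descent K L, ∀ x y, Descent.eval₂ K L t (x, y) = (Descent.op K L h) (x * y) := by
  classical
  obtain ⟨n, a, b, hab⟩ := exists_dual_families K L
  obtain ⟨u, hu⟩ := exists_trace_eq_one K L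
  refine ⟨∑ γ : Gal(L/K), ∑ i, ∑ j, Algebra.trace K L (u * galoisCoeff (Descent.op K L h) γ * b i * b j) •
    (orbitSum γ (a i) ⊗ₜ orbitSum γ (a j)), fun x y => ?_⟩
  have e0 : ∀ (c : K) (f : L × L → L) (q : L × L), (c • f) q = algebraMap K L c * f q := fun c f q => by
    rw [Pi.smul_apply, Algebra.smul_def]
  have key : ∀ (γ τ : Gal(L/K)) (x : L), ∑ i, τ (b i) * (Descent.op K L (orbitSum γ (a i))) x =
      (lam τ γ : Gal(L/K)) x := by
    intro γ τ x
    simp only [orbitSum_apply, Finset.mul_sum]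
    rw [Finset.sum_comm]
    simp only [← mul_assoc, ← Finset.sum_mul, hab]
    simp
  have e1 : ∀ γ : Gal(L/K), ∑ i, ∑ j, algebraMap K L
      (Algebra.trace K L (u * galoisCoeff (Descent.op K L h) γ * b i * b j)) *
        ((Descent.op K L (orbitSum γ (a i))) x * (Descent.op K L (orbitSum γ (a j))) y) =
      ∑ τ : Gal(L/K), τ u * (galoisCoeff (Descent.op K L h) (lam τ γ) * (lam τ γ : Gal(L/K)) (x * y)) := by
    intro γ
    simp only [trace_eq_sum_automorphisms, Finset.sum_mul, map_mul]
    rw [Finset.sum_congr rfl fun i _ => Finset.sum_comm, Finset.sum_comm]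
    refine Finset.sum_congr rfl fun τ _ => ?_
    rw [← key γ τ x, ← key γ τ y, Descent.coeff_lam, Finset.sum_mul_sum, Finset.mul_sum, Finset.mul_sum]
    refine Finset.sum_congr rfl fun i _ => ?_
    rw [Finset.mul_sum, Finset.mul_sum]
    refine Finset.sum_congr rfl fun j _ => ?_
    ring
  simp only [map_sum, map_smul, Finset.sum_apply, e0, tensorEval_tmul, Descent.toFun_apply]
  rw [Finset.sum_congr rfl fun γ _ => e1 γ, Finset.sum_comm]
  simp only [← Finset.mul_sum]
  -- As λ_τ permutes the Galois group, the inner sum is independent of τ; what remains is the trace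
  -- of u.
  have e2 : ∀ τ : Gal(L/K), ∑ γ, galoisCoeff (Descent.op K L h) (lam τ γ) * (lam τ γ : Gal(L/K)) (x * y) =
      (Descent.op K L h) (x * y) := by
    intro τ
    rw [apply_eq_sum_galoisCoeff (Descent.op K L h)]
    exact Equiv.sum_comp (lam τ).toEquiv (fun γ => galoisCoeff (Descent.op K L h) γ * γ (x * y))
  simp only [e2, ← Finset.sum_mul]
  rw [← trace_eq_sum_automorphisms, hu, map_one, one_mul]

end Descent
-- Hopf algebra structure on the descended algebra
open IsSkewBrace

section Descent

variable (K : Type u) (L : Type v) [Field K] [Field L] [Algebra K L] [FiniteDimensional K L]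
  [IsGalois K L] [AddGroup Gal(L/K)] [IsSkewBrace Gal(L/K)]

namespace Descent

/-- The value at 1 is the sum of the coefficients, which σ merely permutes through λ_σ. -/
theorem exists_op_one (h : Descent K L) : ∃ c : K, algebraMap K L c = op K L h 1 := by
  have : ∀ σ : Gal(L/K), σ (op K L h 1) = op K L h 1 := by
    intro σ
    rw [apply_eq_sum_galoisCoeff (op K L h)]
    simp only [map_one, mul_one, map_sum, ← coeff_lam]
    exact Equiv.sum_comp (lam σ).toEquiv (fun γ => galoisCoeff (op K L h) γ)
  exact (IsGalois.mem_range_algebraMap_iff_fixed _).2 this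

/-- The counit of the descended algebra. -/
noncomputable def counitMap : Descent K L →ₗ[K] K :=
  let ε : Descent K L → K := fun h => (exists_op_one K L h).choose
  have hε : ∀ h, algebraMap K L (ε h) = op K L h 1 := fun h => (exists_op_one K L h).choose_spec
  { toFun := ε
    map_add' := fun h h' => (algebraMap K L).injective (by simp [hε])
    map_smul' := fun c h => (algebraMap K L).injective (by simp [hε, Algebra.smul_def]) }

variable {K L} in
theorem algebraMap_counitMap (h : Descent K L) : algebraMap K L (counitMap K L h) = op K L h 1 :=
  (exists_op_one K L h).choose_spec

/-- The comultiplication of the descended algebra. -/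
noncomputable def comulMap : Descent K L →ₗ[K] Descent K L ⊗[K] Descent K L :=
  let Δ : Descent K L → Descent K L ⊗[K] Descent K L := fun h => (exists_comul h).choose
  have hΔ : ∀ h x y, eval₂ K L (Δ h) (x, y) = op K L h (x * y) := fun h =>
    (exists_comul h).choose_spec
  { toFun := Δ
    map_add' := fun h h' => eval₂_injective (by
      ext ⟨x, y⟩
      rw [hΔ, map_add, map_add, Pi.add_apply, hΔ, hΔ]
      rfl)
    map_smul' := fun c h => eval₂_injective (by
      ext ⟨x, y⟩
      rw [hΔ, map_smul, map_smul, Pi.smul_apply, hΔ]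
      rfl) }

variable {K L} in
theorem eval₂_comulMap (h : Descent K L) (x y : L) :
    eval₂ K L (comulMap K L h) (x, y) = op K L h (x * y) :=
  (exists_comul h).choose_spec x y

noncomputable instance : CoalgebraStruct K (Descent K L) where
  comul := comulMap K L
  counit := counitMap K L

variable {K L}

theorem eval₂_comul (h : Descent K L) (x y : L) :
    eval₂ K L (Coalgebra.comul (R := K) h) (x, y) = op K L h (x * y) :=
  eval₂_comulMap h x y

theorem algebraMap_counit (h : Descent K L) :
    algebraMap K L (Coalgebra.counit (R := K) h) = op K L h 1 :=
  algebraMap_counitMap h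

theorem toFun_injective : Function.Injective (Descent.toFun K L) :=
  (isSeparating_toFun K L).injective

/-- Both sides of coassociativity evaluate at (x, y, z) to h(xyz), and the counit laws come from
h(1·y) and h(y·1). -/
noncomputable instance : Coalgebra K (Descent K L) where
  coassoc := by
    ext h
    refine ((isSeparating_toFun K L).tensor
      ((isSeparating_toFun K L).tensor (isSeparating_toFun K L))).injective ?_
    ext ⟨x, y, z⟩
    have h1 : ∀ t : Descent K L ⊗[K] Descent K L,
        tensorEval (Descent.toFun K L) (eval₂ K L)
        (TensorProduct.assoc K _ _ _ (Coalgebra.comul.rTensor (Descent K L) t)) (x, y, z) =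
        eval₂ K L t (x * y, z) := by
      intro t
      induction t with
      | zero => simp
      | add t t' h h' => simp only [map_add, Pi.add_apply, h, h']
      | tmul a b =>
        rw [LinearMap.rTensor_tmul, tensorEval_tmul, toFun_apply, ← eval₂_comul]
        generalize (Coalgebra.comul (R := K) a) = s
        induction s with
        | zero => simp
        | add t t' h h' => simp only [map_add, TensorProduct.add_tmul, Pi.add_apply, h, h', add_mul]
        | tmul c d => simp [mul_assoc]
    have h2 : ∀ t : Descent K L ⊗[K] Descent K L,
        tensorEval (Descent.toFun K L) (eval₂ K L)
        (Coalgebra.comul.lTensor (Descent K L) t) (x, y, z) = eval₂ K L t (x, y * z) := by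
      intro t
      induction t with
      | zero => simp
      | add t t' h h' => simp only [map_add, Pi.add_apply, h, h']
      | tmul a b =>
        rw [LinearMap.lTensor_tmul, tensorEval_tmul, tensorEval_tmul]
        simp only [toFun_apply, eval₂_comul]
    refine (h1 _).trans (Eq.trans ?_ (h2 _).symm)
    rw [eval₂_comul, eval₂_comul, mul_assoc]
  rTensor_counit_comp_comul := by
    ext h
    apply (TensorProduct.lid K (Descent K L)).injective
    apply toFun_injective
    ext y
    have h1 : ∀ t : Descent K L ⊗[K] Descent K L, Descent.toFun K L (TensorProduct.lid K (Descent K L)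
        (Coalgebra.counit.rTensor (Descent K L) t)) y = eval₂ K L t (1, y) := by
      intro t
      induction t with
      | zero => simp
      | add t t' h h' => simp only [map_add, Pi.add_apply, h, h']
      | tmul a b => simp [Algebra.smul_def, ← algebraMap_counit]
    refine (h1 _).trans ?_
    rw [eval₂_comul]
    simp
  lTensor_counit_comp_comul := by
    ext h
    apply (TensorProduct.rid K (Descent K L)).injective
    apply toFun_injective
    ext y
    have h1 : ∀ t : Descent K L ⊗[K] Descent K L, Descent.toFun K L (TensorProduct.rid K (Descent K L)
        (Coalgebra.counit.lTensor (Descent K L) t)) y = eval₂ K L t (y, 1) := by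
      intro t
      induction t with
      | zero => simp
      | add t t' h h' => simp only [map_add, Pi.add_apply, h, h']
      | tmul a b => simp [Algebra.smul_def, ← algebraMap_counit, mul_comm]
    refine (h1 _).trans ?_
    rw [eval₂_comul]
    simp

theorem eval₂_mul_tmul (t : Descent K L ⊗[K] Descent K L) (c d : Descent K L) (x y : L) :
    eval₂ K L (t * c ⊗ₜ d) (x, y) = eval₂ K L t (op K L c x, op K L d y) := by
  induction t with
  | zero => simp
  | add t t' h h' => rw [add_mul, map_add, map_add, Pi.add_apply, Pi.add_apply, h, h']
  | tmul a b => simp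

noncomputable instance : Bialgebra K (Descent K L) :=
  Bialgebra.mk' K (Descent K L)
    ((algebraMap K L).injective (by rw [algebraMap_counit]; simp))
    (by
      intro a b
      apply (algebraMap K L).injective
      rw [(algebraMap K L).map_mul, algebraMap_counit, algebraMap_counit, map_mul (op K L),
        Module.End.mul_apply, ← algebraMap_counit b, mul_comm, ← Algebra.smul_def, ← map_smul,
        Algebra.smul_def, mul_one])
    (eval₂_injective (by
      ext ⟨x, y⟩
      rw [eval₂_comul, Algebra.TensorProduct.one_def]
      simp))
    (by
      intro a b
      apply eval₂_injective
      ext ⟨x, y⟩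
      rw [eval₂_comul, map_mul (op K L), Module.End.mul_apply, ← eval₂_comul b]
      generalize (Coalgebra.comul (R := K) b) = t
      induction t with
      | zero => simp
      | add t t' h h' => rw [map_add, Pi.add_apply, map_add, h, h', mul_add, map_add, Pi.add_apply]
      | tmul c d =>
        rw [eval₂_mul_tmul, eval₂_comul]
        rfl)

/-- The antipode of the descended algebra. -/
noncomputable def antipodeMap : Descent K L →ₗ[K] Descent K L where
  toFun h := ⟨galoisOperator K L (fun γ => galoisCoeff (op K L h) (-γ)), by
    intro σ γ
    rw [galoisCoeff_galoisOperator, ← map_neg, coeff_lam]⟩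
  map_add' h h' := op_injective (by
    change galoisOperator K L _ = galoisOperator K L _ + galoisOperator K L _
    rw [← map_add, map_add, map_add]
    rfl)
  map_smul' c h := op_injective (by
    change galoisOperator K L _ = c • galoisOperator K L _
    rw [← algebraMap_smul L c (galoisOperator K L _), ← map_smul, map_smul,
      ← algebraMap_smul L c (op K L h), map_smul]
    rfl)

theorem galoisCoeff_antipodeMap (h : Descent K L) (γ : Gal(L/K)) :
    galoisCoeff (op K L (antipodeMap h)) γ = galoisCoeff (op K L h) (-γ) := by
  change galoisCoeff (galoisOperator K L (fun γ => galoisCoeff (op K L h) (-γ))) γ = _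
  rw [galoisCoeff_galoisOperator]

theorem eval₂_eq_sum (t : Descent K L ⊗[K] Descent K L) (x y : L) :
    eval₂ K L t (x, y) = ∑ p : Gal(L/K) × Gal(L/K),
      tensorEval (Descent.coeff K L) (Descent.coeff K L) t p * (p.1 x * p.2 y) := by
  induction t with
  | zero => simp
  | add t t' h h' =>
    simp only [map_add, Pi.add_apply, h, h', add_mul, Finset.sum_add_distrib]
  | tmul a b =>
    rw [tensorEval_tmul, toFun_apply, toFun_apply, apply_eq_sum_galoisCoeff,
      apply_eq_sum_galoisCoeff, Finset.sum_mul_sum, Fintype.sum_prod_type]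
    refine Finset.sum_congr rfl fun i _ => Finset.sum_congr rfl fun j _ => ?_
    simp only [tensorEval_tmul, coeff_apply]
    ring

-- The products σ(x)τ(y) are linearly independent, so coefficients may be compared: the
-- comultiplication is diagonal, i.e. every γ is group-like. This reduces the antipode laws to
-- cancellation in the additive group.
open Classical in
theorem tensorEval_coeff_comul (h : Descent K L) (γ δ : Gal(L/K)) :
    tensorEval (Descent.coeff K L) (Descent.coeff K L) (Coalgebra.comul (R := K) h) (γ, δ) =
      if γ = δ then galoisCoeff (op K L h) γ else 0 := by
  have hli := (linearIndependent_galois K L).mul_prod (linearIndependent_galois K L)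
  have h1 := Fintype.linearIndependent_iff.1 hli (fun p =>
    tensorEval (Descent.coeff K L) (Descent.coeff K L) (Coalgebra.comul (R := K) h) p -
      if p.1 = p.2 then galoisCoeff (op K L h) p.1 else 0) (by
    ext ⟨x, y⟩
    rw [Finset.sum_apply]
    simp only [Pi.smul_apply, smul_eq_mul, sub_mul, Finset.sum_sub_distrib]
    rw [← eval₂_eq_sum, eval₂_comul, Fintype.sum_prod_type, apply_eq_sum_galoisCoeff]
    simp) (γ, δ)
  exact sub_eq_zero.1 h1

noncomputable instance : HopfAlgebra K (Descent K L) where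
  antipode := antipodeMap
  mul_antipode_rTensor_comul := by
    classical
    ext h
    apply op_injective
    apply galoisCoeff.injective
    ext ζ
    have h1 : ∀ t : Descent K L ⊗[K] Descent K L,
        galoisCoeff (op K L (LinearMap.mul' K _ (antipodeMap.rTensor (Descent K L) t))) ζ =
        ∑ γ, tensorEval (Descent.coeff K L) (Descent.coeff K L) t (γ, γ + ζ) := by
      intro t
      induction t with
      | zero => simp
      | add t t' h h' => simp only [map_add, Pi.add_apply, h, h', Finset.sum_add_distrib]
      | tmul a b =>
        rw [LinearMap.rTensor_tmul, LinearMap.mul'_apply, coeff_mul]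
        refine Fintype.sum_equiv (Equiv.neg _) _ _ fun γ => ?_
        simp [galoisCoeff_antipodeMap]
    refine (h1 _).trans ?_
    simp only [tensorEval_coeff_comul, LinearMap.comp_apply, Algebra.linearMap_apply,
      AlgHom.commutes, coeff_algebraMap, algebraMap_counit]
    simp only [left_eq_add]
    split_ifs
    · rw [apply_eq_sum_galoisCoeff (op K L h)]
      simp
    · simp
  mul_antipode_lTensor_comul := by
    classical
    ext h
    apply op_injective
    apply galoisCoeff.injective
    ext ζ
    have h1 : ∀ t : Descent K L ⊗[K] Descent K L,
        galoisCoeff (op K L (LinearMap.mul' K _ (antipodeMap.lTensor (Descent K L) t))) ζ =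
        ∑ γ, tensorEval (Descent.coeff K L) (Descent.coeff K L) t (γ, -ζ + γ) := by
      intro t
      induction t with
      | zero => simp
      | add t t' h h' => simp only [map_add, Pi.add_apply, h, h', Finset.sum_add_distrib]
      | tmul a b =>
        rw [LinearMap.lTensor_tmul, LinearMap.mul'_apply, coeff_mul]
        simp [galoisCoeff_antipodeMap]
    refine (h1 _).trans ?_
    simp only [tensorEval_coeff_comul, LinearMap.comp_apply, Algebra.linearMap_apply,
      AlgHom.commutes, coeff_algebraMap, algebraMap_counit]
    simp only [right_eq_add, neg_eq_zero]
    split_ifs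
    · rw [apply_eq_sum_galoisCoeff (op K L h)]
      simp
    · simp

instance : Coalgebra.IsCocomm K (Descent K L) where
  comm_comp_comul := by
    ext h
    apply eval₂_injective
    ext ⟨x, y⟩
    have h1 : ∀ t : Descent K L ⊗[K] Descent K L,
        eval₂ K L (TensorProduct.comm K _ _ t) (x, y) = eval₂ K L t (y, x) := by
      intro t
      induction t with
      | zero => simp
      | add t t' h h' => simp only [map_add, Pi.add_apply, h, h']
      | tmul a b => simp [mul_comm]
    refine (h1 _).trans ?_
    rw [eval₂_comul, eval₂_comul, mul_comm]

end Descent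

end Descent
-- The Hopf–Galois structure of a skew brace, and the correspondence
open IsSkewBrace

section Descent

variable (K : Type u) (L : Type v) [Field K] [Field L] [Algebra K L] [FiniteDimensional K L]
  [IsGalois K L] [AddGroup Gal(L/K)] [IsSkewBrace Gal(L/K)]

namespace Descent

open Classical in
theorem sum_mul_orbitSum {n : ℕ} {a b : Fin n → L}
    (hab : ∀ σ τ : Gal(L/K), ∑ i, τ (b i) * σ (a i) = if τ = σ then 1 else 0)
    (γ τ : Gal(L/K)) (x : L) :
    ∑ i, τ (b i) * op K L (orbitSum γ (a i)) x = (lam τ γ : Gal(L/K)) x := by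
  simp only [orbitSum_apply, Finset.mul_sum]
  rw [Finset.sum_comm]
  simp only [← mul_assoc, ← Finset.sum_mul, hab]
  simp

instance : FiniteDimensional K (Descent K L) :=
  Module.Finite.of_injective (op K L).toLinearMap op_injective

/-- A K-basis remains independent over L inside End_K(L), whose L-dimension is the degree of the
extension. -/
theorem finrank_le : Module.finrank K (Descent K L) ≤ Module.finrank K L := by
  have h := isSeparating_toFun K L
  let B := Module.finBasis K (Descent K L)
  rw [isSeparating_iff_linearIndependent B] at h
  have h2 : LinearIndependent L (fun i => op K L (B i)) :=
    LinearIndependent.of_comp (LinearMap.ltoFun K L L L) h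
  have := h2.fintype_card_le_finrank
  rwa [Fintype.card_fin, Module.finrank_linearMap_self] at this

/-- A tensor z annihilated by all h is annihilated by their L-combinations. By the dual families
these include every Galois automorphism, hence all of End_K(L), and in particular the coordinate
functionals. -/
theorem galois_injective : Function.Injective
    (TensorProduct.lift
      ((LinearMap.llcomp K (Descent K L) L L).compl₁₂ (LinearMap.mul K L)
        (op K L).toLinearMap.flip) : L ⊗[K] L →ₗ[K] (Descent K L →ₗ[K] L)) := by
  classical
  set Ψ := (TensorProduct.lift
      ((LinearMap.llcomp K (Descent K L) L L).compl₁₂ (LinearMap.mul K L)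
        (op K L).toLinearMap.flip) : L ⊗[K] L →ₗ[K] (Descent K L →ₗ[K] L)) with hΨ
  rw [← LinearMap.ker_eq_bot]
  refine LinearMap.ker_eq_bot'.2 fun z hz => ?_
  obtain ⟨n, a, b, hab⟩ := exists_dual_families K L
  -- evaluation of an operator at an element of `L ⊗ L`
  let Θ : (L →ₗ[K] L) →ₗ[L] (L ⊗[K] L →ₗ[L] L) :=
    { toFun := fun T => T.liftBaseChange L
      map_add' := fun T T' => by ext; simp
      map_smul' := fun c T => by ext; simp }
  have h1 : ∀ h : Descent K L, Θ (op K L h) z = Ψ z h := by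
    intro h
    clear hz
    induction z with
    | zero => simp
    | add z z' h h' => rw [map_add, h, h', map_add]; rfl
    | tmul x y => simp [Θ, hΨ]
  have h2 : ∀ γ : Gal(L/K), Θ (γ : L →ₐ[K] L).toLinearMap z = 0 := by
    intro γ
    have : (γ : L →ₐ[K] L).toLinearMap = ∑ i, b i • op K L (orbitSum γ (a i)) := by
      ext x
      have := sum_mul_orbitSum K L hab γ 1 x
      simp only [AlgEquiv.one_apply, lam_one] at this
      simpa using this.symm
    rw [this, map_sum, LinearMap.sum_apply]
    refine Finset.sum_eq_zero fun i _ => ?_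
    rw [map_smul, LinearMap.smul_apply, h1, hz]
    simp
  have h3 : ∀ T : L →ₗ[K] L, Θ T z = 0 := by
    intro T
    rw [← galoisOperator_galoisCoeff T, galoisOperator, Fintype.linearCombination_apply, map_sum,
      LinearMap.sum_apply]
    refine Finset.sum_eq_zero fun γ _ => ?_
    rw [map_smul, LinearMap.smul_apply, h2, smul_zero]
  let B := Module.finBasis K L
  refine (Algebra.TensorProduct.basis L B).ext_elem fun j => ?_
  rw [map_zero, Finsupp.zero_apply, ← h3 ((Algebra.linearMap K L).comp (B.coord j))]
  clear hz h1 h2 h3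
  induction z with
  | zero => simp
  | add z z' h h' => simp only [map_add, Finsupp.add_apply, h, h']
  | tmul x y => simp [Θ]

/-- The Hopf-Galois structure attached to a skew brace structure on the Galois group. -/
noncomputable def hopfGaloisStructure : HopfGaloisStructure K L where
  H := Descent K L
  act := op K L
  act_mul h x y := by
    rw [← eval₂_comul]
    generalize (Coalgebra.comul (R := K) h) = t
    induction t with
    | zero => simp
    | add t t' h h' => simp only [map_add, Pi.add_apply, h, h']
    | tmul c d => simp
  act_one h := (algebraMap_counit h).symm
  galois := by
    refine ⟨galois_injective K L,
      (LinearMap.injective_iff_surjective_of_finrank_eq_finrank ?_).1 (galois_injective K L)⟩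
    have h1 := LinearMap.finrank_le_finrank_of_injective (galois_injective K L)
    rw [Module.finrank_tensorProduct, Module.finrank_linearMap] at h1 ⊢
    exact le_antisymm h1 (Nat.mul_le_mul_right _ (finrank_le K L))

-- The group-like element of τ is Σ b_i ⊗ o(τ, a_i), and its twist by σ acts as λ_σ τ. The product
-- for σ and τ therefore acts as σ·λ_{σ⁻¹}(τ) = σ + τ.
variable {K L} in
theorem addGroup_add_of_act_eq (S : HopfGaloisStructure K L) (o : Gal(L/K) → L → S.H)
    (ho : ∀ γ a, S.act (o γ a) = op K L (orbitSum γ a)) (σ τ : Gal(L/K)) :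
    S.addGroup.add σ τ = σ + τ := by
  classical
  obtain ⟨n, a, b, hab⟩ := exists_dual_families K L
  have h1 : ∀ τ : Gal(L/K), S.grp τ = ∑ i, b i ⊗ₜ[K] (o τ (a i)) := by
    intro τ
    apply S.operator_injective (AlgHom.id K L)
    ext x
    rw [S.operator_grp, map_sum, LinearMap.sum_apply]
    have := sum_mul_orbitSum K L hab τ 1 x
    rw [lam_one] at this
    rw [← this]
    simp [ho]
  have h2 : ∀ σ τ x, S.operator (AlgHom.id K L) (S.twist σ (S.grp τ)) x =
      (lam σ τ : Gal(L/K)) x := by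
    intro σ τ x
    rw [h1, map_sum, map_sum, LinearMap.sum_apply, ← sum_mul_orbitSum K L hab τ σ x]
    simp [ho, HopfGaloisStructure.twist]
  ext x
  rw [← S.operator_grp, S.grp_add, S.operator_grp_mul, h2, ← AlgEquiv.mul_apply, mul_lam_inv]

theorem addGroup_hopfGaloisStructure (σ τ : Gal(L/K)) :
    (hopfGaloisStructure K L).addGroup.add σ τ = σ + τ :=
  addGroup_add_of_act_eq (hopfGaloisStructure K L) orbitSum (fun _ _ => rfl) σ τ

end Descent

end Descent

/-- Hopf-Galois structures of type `G` correspond to skew brace structures of type `G` on the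
Galois group. -/
noncomputable def hopfGaloisOfTypeEquiv (K : Type u) (L : Type v) [Field K] [Field L] [Algebra K L]
    [FiniteDimensional K L] [IsGalois K L] (G : Type w) [Group G] :
    HopfGaloisOfType K L G ≃ SkewBraceOfType Gal(L/K) G :=
  Equiv.ofBijective
    (Quotient.lift (fun S : {S : HopfGaloisStructure K L // S.HasType G} =>
      (⟨S.1.addGroup, S.1.isSkewBrace, S.1.hasType_iff.1 S.2⟩ : SkewBraceOfType Gal(L/K) G))
      (fun S T h => Subtype.ext (HopfGaloisStructure.addGroup_eq_of_equiv h))) (by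
    constructor
    · intro x y
      induction x using Quotient.inductionOn
      induction y using Quotient.inductionOn
      intro h
      exact Quotient.sound (HopfGaloisStructure.equiv_of_addGroup_eq (congrArg Subtype.val h))
    · rintro ⟨A, hA, e⟩
      have h : (Descent.hopfGaloisStructure K L).addGroup = A := by
        refine AddGroup.ext ?_
        ext σ τ : 2
        exact Descent.addGroup_hopfGaloisStructure K L σ τ
      refine ⟨Quotient.mk _ ⟨Descent.hopfGaloisStructure K L, ?_⟩, Subtype.ext h⟩
      rw [HopfGaloisStructure.hasType_iff, h]
      exact e)
open IsSkewBrace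

/-! ### Normal Sylow subgroups -/

/-- `m` has no divisor other than `1` that is congruent to `1` modulo `p`, and is prime to `p`. -/
structure SylowCondition (p m : ℕ) : Prop where
  coprime : p.Coprime m
  eq_one : ∀ d, d ∣ m → d ≡ 1 [MOD p] → d = 1

/-- The number of Sylow p-subgroups divides m and is 1 modulo p. The description of N by the
equation x ^ p = 1 is recorded because it makes N stable under every automorphism, in particular
under λ. -/
theorem exists_normal_sylow {p m : ℕ} [Fact p.Prime] {X : Type*} [Group X]
    (hX : Nat.card X = p * m) (hm : m ≠ 0) (h : SylowCondition p m) :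
    ∃ N : Subgroup X, N.Normal ∧ Nat.card N = p ∧ ∀ x, x ^ p = 1 ↔ x ∈ N := by
  have hp : p.Prime := Fact.out
  have : Finite X := Nat.finite_of_card_ne_zero (by rw [hX]; exact mul_ne_zero hp.ne_zero hm)
  let P : Sylow p X := default
  have hP : Nat.card P = p := by
    rw [P.card_eq_multiplicity, hX, Nat.factorization_mul hp.ne_zero hm, Finsupp.add_apply,
      hp.factorization_self, Nat.factorization_eq_zero_of_not_dvd
        ((Nat.Prime.coprime_iff_not_dvd hp).1 h.coprime), pow_one]
  have hi : (P : Subgroup X).index = m := by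
    have := (P : Subgroup X).card_mul_index
    rw [hX] at this
    exact Nat.eq_of_mul_eq_mul_left hp.pos (by rw [← this]; congr 1; exact hP.symm)
  have h1 : Nat.card (Sylow p X) = 1 :=
    h.eq_one _ (hi ▸ P.card_dvd_index) (card_sylow_modEq_one p X)
  have h2 : Subsingleton (Sylow p X) := (Nat.card_eq_one_iff_unique.1 h1).1
  refine ⟨P, inferInstance, hP, fun x => ⟨fun hx => ?_, fun hx => ?_⟩⟩
  · have hpg : IsPGroup p (Subgroup.zpowers x) := by
      apply IsPGroup.of_card (n := (Nat.card (Subgroup.zpowers x)).factorization p)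
      have : Nat.card (Subgroup.zpowers x) ∣ p := by
        rw [Nat.card_zpowers]; exact orderOf_dvd_of_pow_eq_one hx
      rcases (Nat.dvd_prime hp).1 this with e | e
      · rw [e]; simp
      · rw [e, hp.factorization_self, pow_one]
    obtain ⟨R, hR⟩ := hpg.exists_le_sylow
    rw [Subsingleton.elim P R]
    exact hR (Subgroup.mem_zpowers x)
  · have : orderOf (⟨x, hx⟩ : (P : Subgroup X)) ∣ p := (orderOf_dvd_natCard _).trans hP.dvd
    have h3 := orderOf_dvd_iff_pow_eq_one.1 this
    exact congrArg Subtype.val h3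

namespace IsSkewBrace

variable {A : Type*} [Group A] [AddGroup A] [IsSkewBrace A]

/-- The map λ_x permutes N with order dividing p, so the number of its fixed points is divisible by
p. It is positive because 0 is fixed, so all of N is fixed. -/
theorem lam_eq_self_of_card_prime {p : ℕ} [Fact p.Prime] (N : AddSubgroup A)
    (hN : Nat.card N = p) (hlam : ∀ a, ∀ y ∈ N, lam a y ∈ N) {x : A} (hx : x ^ p = 1) :
    ∀ y ∈ N, lam x y = y := by
  classical
  have hp : p.Prime := Fact.out
  have : Finite N := Nat.finite_of_card_ne_zero (by rw [hN]; exact hp.ne_zero)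
  have := Fintype.ofFinite N
  let f : Function.End N := fun y => ⟨lam x y.1, hlam x _ y.2⟩
  have hf : f ^ p ^ 1 = 1 := by
    funext y
    apply Subtype.ext
    have h1 : ∀ n : ℕ, ((f ^ n) y).1 = lam (x ^ n) y.1 := by
      intro n
      induction n with
      | zero => rw [pow_zero, pow_zero, lam_one]; rfl
      | succ n ih => rw [pow_succ', pow_succ', lam_mul, ← ih]; rfl
    rw [h1, pow_one, hx, lam_one]
    rfl
  have h1 := Equiv.Perm.card_fixedPoints_modEq hf
  rw [← Nat.card_eq_fintype_card, ← Nat.card_eq_fintype_card, hN] at h1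
  have h2 : p ∣ Nat.card (Function.fixedPoints f) :=
    (Nat.modEq_zero_iff_dvd.1 (h1.symm.trans ((Nat.modEq_zero_iff_dvd).2 dvd_rfl)))
  have : Nonempty (Function.fixedPoints f) := ⟨⟨0, Subtype.ext (map_zero (lam x))⟩⟩
  have h4 : Nat.card (Function.fixedPoints f) = Nat.card N := by
    refine le_antisymm (Nat.card_le_card_of_injective _ Subtype.val_injective) ?_
    rw [hN]
    exact Nat.le_of_dvd Nat.card_pos h2
  intro y hy
  have h5 : Function.Surjective (Subtype.val : Function.fixedPoints f → N) :=
    ((Nat.bijective_iff_injective_and_card _).2 ⟨Subtype.val_injective, h4⟩).2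
  obtain ⟨⟨z, hz⟩, e⟩ := h5 ⟨y, hy⟩
  have e' : z = ⟨y, hy⟩ := e
  subst e'
  exact congrArg Subtype.val hz

/-- A skew brace of prime order is trivial. -/
theorem mul_eq_add_of_card_prime {p : ℕ} (hp : p.Prime) (hA : Nat.card A = p) (a b : A) :
    a * b = a + b := by
  have := Fact.mk hp
  rw [← add_lam, lam_eq_self_of_card_prime (p := p) ⊤ (by rw [← hA]; exact AddSubgroup.card_top)
    (by simp) (by rw [← hA]; exact pow_card_eq_one') b (by simp)]

end IsSkewBrace

/-- The extension of `Q` by `ZMod p` on which `Q` acts by a character. -/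
@[ext] structure CharExt (p : ℕ) {Q : Type*} [Group Q] (θ : Q →* (ZMod p)ˣ) where
  fst : ZMod p
  snd : Q

namespace CharExt

variable {p : ℕ} {Q : Type*} [Group Q] {θ : Q →* (ZMod p)ˣ}

instance : Mul (CharExt p θ) := ⟨fun a b => ⟨a.fst + θ a.snd * b.fst, a.snd * b.snd⟩⟩
instance : One (CharExt p θ) := ⟨⟨0, 1⟩⟩
instance : Inv (CharExt p θ) := ⟨fun a => ⟨-(((θ a.snd)⁻¹ : (ZMod p)ˣ) * a.fst), a.snd⁻¹⟩⟩

@[simp] theorem mul_fst (a b : CharExt p θ) : (a * b).fst = a.fst + θ a.snd * b.fst := rfl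
@[simp] theorem mul_snd (a b : CharExt p θ) : (a * b).snd = a.snd * b.snd := rfl
@[simp] theorem one_fst : (1 : CharExt p θ).fst = 0 := rfl
@[simp] theorem one_snd : (1 : CharExt p θ).snd = 1 := rfl
@[simp] theorem inv_fst (a : CharExt p θ) :
    a⁻¹.fst = -(((θ a.snd)⁻¹ : (ZMod p)ˣ) * a.fst) := rfl
@[simp] theorem inv_snd (a : CharExt p θ) : a⁻¹.snd = a.snd⁻¹ := rfl

instance : Group (CharExt p θ) :=
  Group.ofLeftAxioms (fun a b c => by ext <;> simp [mul_add, mul_assoc, add_assoc])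
    (fun a => by ext <;> simp) (fun a => by ext <;> simp)

variable (p θ) in
/-- The underlying product. -/
@[simps] def equivProd : CharExt p θ ≃ ZMod p × Q where
  toFun a := (a.fst, a.snd)
  invFun a := ⟨a.1, a.2⟩
  left_inv _ := rfl
  right_inv _ := rfl

instance [NeZero p] [Finite Q] : Finite (CharExt p θ) := Finite.of_equiv _ (equivProd p θ).symm

theorem natCard : Nat.card (CharExt p θ) = p * Nat.card Q := by
  rw [Nat.card_congr (equivProd p θ), Nat.card_prod, Nat.card_zmod]

variable (θ) in
/-- The projection to the quotient. -/
def sndHom : CharExt p θ →* Q where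
  toFun := snd
  map_one' := rfl
  map_mul' _ _ := rfl

@[simp] theorem sndHom_apply (a : CharExt p θ) : sndHom θ a = a.snd := rfl

variable (θ) in
/-- The inclusion of the kernel. -/
def inl (z : ZMod p) : CharExt p θ := ⟨z, 1⟩

@[simp] theorem inl_fst (z : ZMod p) : (inl θ z).fst = z := rfl
@[simp] theorem inl_snd (z : ZMod p) : (inl θ z).snd = 1 := rfl

theorem inl_mul (z w : ZMod p) : inl θ z * inl θ w = inl θ (z + w) := by ext <;> simp

theorem inl_zero : inl θ 0 = 1 := rfl

theorem inl_pow (z : ZMod p) (n : ℕ) : inl θ z ^ n = inl θ (n * z) := by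
  induction n with
  | zero => simp [inl_zero]
  | succ n ih => rw [pow_succ, ih, inl_mul]; push_cast; ring_nf

theorem inl_mul' (z : ZMod p) (a : CharExt p θ) : inl θ z * a = ⟨z + a.fst, a.snd⟩ := by
  ext <;> simp

theorem mul_inl (a : CharExt p θ) (z : ZMod p) :
    a * inl θ z = ⟨a.fst + θ a.snd * z, a.snd⟩ := by ext <;> simp

theorem eq_inl_of_snd {a : CharExt p θ} (h : a.snd = 1) : a = inl θ a.fst := by
  ext <;> simp [h]

theorem snd_eq_one_iff_pow [Finite Q] (h : p.Coprime (Nat.card Q)) (a : CharExt p θ) :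
    a.snd = 1 ↔ a ^ p = 1 := by
  constructor
  · intro ha
    rw [eq_inl_of_snd ha, inl_pow, CharP.cast_eq_zero, zero_mul, inl_zero]
  · intro ha
    have h1 : a.snd ^ p = 1 := by rw [← sndHom_apply, ← map_pow, ha, map_one]
    have h2 : orderOf a.snd ∣ 1 := by
      rw [← h]
      exact Nat.dvd_gcd (orderOf_dvd_of_pow_eq_one h1) (orderOf_dvd_natCard _)
    exact orderOf_eq_one_iff.1 (Nat.dvd_one.1 h2)

section Analysis

variable [Fact p.Prime] [Finite Q] [AddGroup (CharExt p θ)] [IsSkewBrace (CharExt p θ)]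

-- The additive Sylow p-subgroup is λ-stable because λ acts by additive automorphisms. From ab = a +
-- λ_a(b) it is closed under multiplication, so it is a multiplicative subgroup of order p, and only
-- the kernel of the projection qualifies.
variable (θ) in
theorem exists_kernel (h : SylowCondition p (Nat.card Q)) :
    ∃ N : AddSubgroup (CharExt p θ), N.Normal ∧ Nat.card N = p ∧
      (∀ a, ∀ x ∈ N, lam a x ∈ N) ∧ ∀ x, x ∈ N ↔ x.snd = 1 := by
  have hp : p.Prime := Fact.out
  obtain ⟨M, hM1, hM2, hM3⟩ := exists_normal_sylow (X := Multiplicative (CharExt p θ)) (p := p)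
    (m := Nat.card Q) (natCard (θ := θ)) Nat.card_pos.ne' h
  let N : AddSubgroup (CharExt p θ) := Subgroup.toAddSubgroup' M
  have hN : ∀ x, x ∈ N ↔ p • x = 0 := fun x => (hM3 (Multiplicative.ofAdd x)).symm
  have hlam : ∀ a, ∀ x ∈ N, lam a x ∈ N := by
    intro a x hx
    rw [hN] at hx ⊢
    rw [← map_nsmul, hx, map_zero]
  have hcard : Nat.card N = p := hM2
  have hmul : ∀ a ∈ N, ∀ b ∈ N, a * b ∈ N := by
    intro a ha b hb
    rw [← add_lam]
    exact N.add_mem ha (hlam a b hb)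
  have h1N : (1 : CharExt p θ) ∈ N := by rw [← zero_eq_one]; exact N.zero_mem
  let S : Submonoid (CharExt p θ) :=
    { carrier := N, mul_mem' := fun {a b} ha hb => hmul a ha b hb, one_mem' := h1N }
  have hinv : ∀ a ∈ N, a⁻¹ ∈ N := by
    intro a ha
    rw [inv_eq_of_mul_eq_one_left (a := a ^ (orderOf a - 1))
      (by rw [← pow_succ, Nat.sub_add_cancel (orderOf_pos a), pow_orderOf_eq_one])]
    exact S.pow_mem ha _
  let H : Subgroup (CharExt p θ) := { S with inv_mem' := fun {a} ha => hinv a ha }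
  have hH : Nat.card H = p := hcard
  have hsub : ∀ x ∈ N, x.snd = 1 := by
    intro x hx
    rw [snd_eq_one_iff_pow h.coprime]
    have : orderOf (⟨x, hx⟩ : H) ∣ p := (orderOf_dvd_natCard _).trans hH.dvd
    exact congrArg Subtype.val (orderOf_dvd_iff_pow_eq_one.1 this)
  refine ⟨N, ⟨fun n hn g => hM1.conj_mem n hn g⟩, hcard, hlam, fun x => ⟨hsub x, fun hx => ?_⟩⟩
  have hinj : Function.Injective (fun x : N => x.1.fst) := by
    intro x y hxy
    apply Subtype.ext
    ext
    · exact hxy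
    · rw [hsub _ x.2, hsub _ y.2]
  have : Finite N := inferInstance
  have hbij := (Nat.bijective_iff_injective_and_card _).2 ⟨hinj, by rw [hcard, Nat.card_zmod]⟩
  obtain ⟨y, hy⟩ := hbij.2 x.fst
  have : x = y.1 := by
    ext
    · exact hy.symm
    · rw [hx, hsub _ y.2]
  rw [this]
  exact y.2

end Analysis

end CharExt
-- The quotient skew brace and the characters on the kernel
open IsSkewBrace

namespace CharExt

variable {p : ℕ} {Q : Type*} [Group Q] {θ : Q →* (ZMod p)ˣ}

variable (θ) in
/-- The complement of the kernel. -/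
def inr : Q →* CharExt p θ where
  toFun q := ⟨0, q⟩
  map_one' := rfl
  map_mul' q q' := by ext <;> simp

@[simp] theorem inr_fst (q : Q) : (inr θ q).fst = 0 := rfl
@[simp] theorem inr_snd (q : Q) : (inr θ q).snd = q := rfl

theorem eq_inl_mul_inr (a : CharExt p θ) : a = inl θ a.fst * inr θ a.snd := by ext <;> simp

theorem inl_injective : Function.Injective (inl θ) := fun _ _ h => congrArg fst h

/-- A character satisfying a cocycle identity with respect to a second character is trivial or
equal to it. -/
theorem eq_one_or_eq_of_cocycle [Fact p.Prime] [Finite Q] (hQ : p.Coprime (Nat.card Q))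
    (R t : Q →* (ZMod p)ˣ) (m : Q → Q → Q) (hm : ∀ q', Function.Bijective (fun q => m q q'))
    (h : ∀ q q', (R (m q q') : ZMod p) = t q' * R q + R q' - t q') : R = 1 ∨ R = t := by
  have := Fintype.ofFinite Q
  have hp : p.Prime := Fact.out
  have hn : (Fintype.card Q : ZMod p) ≠ 0 := by
    rw [← Nat.card_eq_fintype_card, Ne, ZMod.natCast_eq_zero_iff]
    exact (Nat.Prime.coprime_iff_not_dvd hp).1 hQ
  -- The mean value of R. Averaging the hypothesis over q expresses R as c + (1 − c)t.
  set c : ZMod p := (∑ q, (R q : ZMod p)) / Fintype.card Q with hc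
  have h1 : ∀ q', (R q' : ZMod p) = c + (1 - c) * t q' := by
    intro q'
    have h2 : ∑ q, (R (m q q') : ZMod p) = ∑ q, (R q : ZMod p) :=
      Function.Bijective.sum_comp (hm q') (fun q => (R q : ZMod p))
    simp only [h, Finset.sum_sub_distrib, Finset.sum_add_distrib, ← Finset.mul_sum,
      Finset.sum_const, Finset.card_univ, nsmul_eq_mul] at h2
    rw [hc]
    field_simp
    linear_combination h2
  -- Multiplicativity of both R and t leaves only c = 0, c = 1 or t = 1.
  have h2 : ∀ q q', c * (1 - c) * ((1 - t q) * (1 - t q')) = (0 : ZMod p) := by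
    intro q q'
    have h3 := h1 (q * q')
    rw [map_mul, map_mul, Units.val_mul, Units.val_mul, h1 q, h1 q'] at h3
    linear_combination -h3
  by_cases ht : ∀ q, t q = 1
  · left
    ext q
    rw [h1, ht q]
    simp
  · push Not at ht
    obtain ⟨q, hq⟩ := ht
    have hq' : (1 - t q : ZMod p) ≠ 0 := by
      intro e
      exact hq (Units.ext (sub_eq_zero.1 e).symm)
    have h3 := h2 q q
    simp only [mul_eq_zero, hq', or_self, or_false] at h3
    rcases h3 with h3 | h3
    · right
      ext q
      rw [h1, h3]
      simp
    · left
      have : c = 1 := (sub_eq_zero.1 h3).symm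
      ext q
      rw [h1, this]
      simp

section Quotient

variable [Fact p.Prime] [Finite Q] [AddGroup (CharExt p θ)] [IsSkewBrace (CharExt p θ)]

theorem lam_snd_eq_one (h : SylowCondition p (Nat.card Q)) {a x : CharExt p θ} (hx : x.snd = 1) :
    (lam a x).snd = 1 := by
  obtain ⟨N, hN, h1, h2, h3⟩ := exists_kernel θ h
  rw [← h3] at hx ⊢
  exact h2 a x hx

theorem add_snd_eq_one (h : SylowCondition p (Nat.card Q)) {a b : CharExt p θ} (ha : a.snd = 1)
    (hb : b.snd = 1) : (a + b).snd = 1 := by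
  obtain ⟨N, hN, h1, h2, h3⟩ := exists_kernel θ h
  rw [← h3] at ha hb ⊢
  exact N.add_mem ha hb

theorem conj_snd_eq_one (h : SylowCondition p (Nat.card Q)) (a : CharExt p θ) {b : CharExt p θ}
    (hb : b.snd = 1) : (a + b - a).snd = 1 := by
  obtain ⟨N, hN, h1, h2, h3⟩ := exists_kernel θ h
  rw [← h3] at hb ⊢
  rw [sub_eq_add_neg]
  exact hN.conj_mem b hb a

/-- Since −a + b = λ_a(a⁻¹b) and λ preserves the kernel, additive and multiplicative cosets of the
kernel coincide. -/
theorem neg_add_snd (h : SylowCondition p (Nat.card Q)) (a b : CharExt p θ) :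
    (-a + b).snd = 1 ↔ a.snd = b.snd := by
  have h1 : -a + b = lam a (a⁻¹ * b) := by simp [lam_apply]
  constructor
  · intro e
    rw [h1] at e
    have h2 := lam_snd_eq_one h (a := a⁻¹) e
    rw [lam_inv_lam, mul_snd, inv_snd] at h2
    exact inv_mul_eq_one.1 h2
  · intro e
    rw [h1]
    apply lam_snd_eq_one h
    simp [e]

theorem add_snd_congr (h : SylowCondition p (Nat.card Q)) {a a' b b' : CharExt p θ}
    (ha : a.snd = a'.snd) (hb : b.snd = b'.snd) : (a + b).snd = (a' + b').snd := by
  rw [← neg_add_snd h] at ha hb ⊢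
  have h2 := add_snd_eq_one h (conj_snd_eq_one h (-b) ha) hb
  convert h2 using 2
  simp [sub_eq_add_neg, add_assoc]

theorem neg_snd_congr (h : SylowCondition p (Nat.card Q)) {a a' : CharExt p θ}
    (ha : a.snd = a'.snd) : (-a).snd = (-a').snd := by
  have h2 := conj_snd_eq_one h a ((neg_add_snd h a a').2 ha)
  rw [eq_comm, ← neg_add_snd h]
  rw [← neg_add_snd h] at ha
  have h3 := conj_snd_eq_one h a' ha
  convert conj_snd_eq_one h a ha using 2
  simp [sub_eq_add_neg]

variable (θ) in
/-- The additive group structure induced on the quotient. -/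
@[reducible] def quotAddGroup (h : SylowCondition p (Nat.card Q)) : AddGroup Q :=
  letI : Add Q := ⟨fun q q' => (inr θ q + inr θ q').snd⟩
  letI : Zero Q := ⟨1⟩
  letI : Neg Q := ⟨fun q => (-inr θ q).snd⟩
  have hadd : ∀ a b : CharExt p θ, (a + b).snd = a.snd + b.snd := fun a b =>
    add_snd_congr h rfl rfl
  have hneg : ∀ a : CharExt p θ, (-a).snd = -a.snd := fun a => neg_snd_congr h rfl
  have hzero : (0 : CharExt p θ).snd = (0 : Q) := by rw [zero_eq_one]; rfl
  AddGroup.ofLeftAxioms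
    (fun a b c => by
      have := congrArg snd (add_assoc (inr θ a) (inr θ b) (inr θ c))
      simpa only [hadd, inr_snd] using this)
    (fun a => by
      have := congrArg snd (zero_add (inr θ a))
      simpa only [hadd, hzero, inr_snd] using this)
    (fun a => by
      have := congrArg snd (neg_add_cancel (inr θ a))
      simpa only [hadd, hneg, hzero, inr_snd] using this)

theorem add_snd_quot (h : SylowCondition p (Nat.card Q)) (a b : CharExt p θ) :
    (a + b).snd = (quotAddGroup θ h).add a.snd b.snd :=
  add_snd_congr h rfl rfl

end Quotient

section Characters

variable [Fact p.Prime] [Finite Q] [AddGroup (CharExt p θ)] [IsSkewBrace (CharExt p θ)]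
  (h : SylowCondition p (Nat.card Q))

-- Elements of the kernel act trivially on it under λ, so the two laws agree there.
include h in
theorem inl_add_inl (z w : ZMod p) : inl θ z + inl θ w = inl θ (z + w) := by
  obtain ⟨N, hN, h1, h2, h3⟩ := exists_kernel θ h
  rw [← inl_mul, ← add_lam, lam_eq_self_of_card_prime N h1 h2
    ((snd_eq_one_iff_pow h.coprime (inl θ z)).1 rfl) _ ((h3 _).2 rfl)]

/-- The kernel as an additive homomorphism. -/
def inlAddHom : ZMod p →+ CharExt p θ where
  toFun := inl θ
  map_zero' := (zero_eq_one (CharExt p θ)).symm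
  map_add' z w := (inl_add_inl h z w).symm

include h in
theorem inl_neg (z : ZMod p) : inl θ (-z) = -inl θ z := map_neg (inlAddHom h) z

include h in
/-- An additive endomorphism preserving the kernel acts on it by a scalar. -/
theorem endo_inl (f : CharExt p θ →+ CharExt p θ) (hf : ∀ x, x.snd = 1 → (f x).snd = 1)
    (z : ZMod p) : f (inl θ z) = inl θ ((f (inl θ 1)).fst * z) := by
  let g : ZMod p →+ ZMod p :=
    { toFun := fun z => (f (inl θ z)).fst
      map_zero' := by
        have : inl θ 0 = (0 : CharExt p θ) := map_zero (inlAddHom h)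
        rw [this, map_zero, ← this]; rfl
      map_add' := fun z w => by
        rw [← inl_add_inl h, map_add, eq_inl_of_snd (hf (inl θ z) rfl),
          eq_inl_of_snd (hf (inl θ w) rfl), inl_add_inl h]; rfl }
  rw [eq_inl_of_snd (hf (inl θ z) rfl)]
  congr 1
  have := ZMod.map_smul g z 1
  rw [smul_eq_mul, mul_one, smul_eq_mul, mul_comm] at this
  exact this

include h in
/-- The character by which the `lam`-action operates on the kernel. -/
theorem exists_lam_character :
    ∃ V : Q →* (ZMod p)ˣ, ∀ (a : CharExt p θ) z, lam a (inl θ z) = inl θ (V a.snd * z) := by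
  have h1 : ∀ (a : CharExt p θ) z, lam a (inl θ z) = inl θ ((lam a (inl θ 1)).fst * z) := fun a z =>
    endo_inl h (lam a).toAddMonoidHom (fun x hx => lam_snd_eq_one h hx) z
  let v : CharExt p θ →* ZMod p :=
    { toFun := fun a => (lam a (inl θ 1)).fst
      map_one' := by rw [lam_one]; rfl
      map_mul' := fun a b => by rw [lam_mul, h1 b 1, mul_one, h1 a]; rfl }
  obtain ⟨N, hN, h2, h3, h4⟩ := exists_kernel θ h
  have hv : ∀ z, v (inl θ z) = 1 := fun z => by
    change (lam (inl θ z) (inl θ 1)).fst = 1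
    rw [lam_eq_self_of_card_prime N h2 h3
      ((snd_eq_one_iff_pow h.coprime (inl θ z)).1 rfl) _ ((h4 _).2 rfl)]
    rfl
  refine ⟨v.toHomUnits.comp (inr θ), fun a z => ?_⟩
  rw [h1]
  congr 2
  change v a = v (inr θ a.snd)
  conv_lhs => rw [eq_inl_mul_inr a]
  rw [map_mul, hv, one_mul]

include h in
/-- The character by which additive conjugation operates on the kernel. -/
theorem exists_conj_character :
    ∃ T : Q →* (ZMod p)ˣ, (∀ (a : CharExt p θ) z, a + inl θ z = inl θ (T a.snd * z) + a) ∧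
      ∀ a b : CharExt p θ, T (a + b).snd = T a.snd * T b.snd := by
  let c : CharExt p θ → CharExt p θ →+ CharExt p θ := fun a =>
    { toFun := fun x => a + x - a
      map_zero' := by simp
      map_add' := fun x y => by simp [sub_eq_add_neg, add_assoc] }
  have h1 : ∀ (a : CharExt p θ) z, a + inl θ z - a = inl θ ((a + inl θ 1 - a).fst * z) := fun a z =>
    endo_inl h (c a) (fun x hx => conj_snd_eq_one h a hx) z
  obtain ⟨V, hV⟩ := exists_lam_character (θ := θ) h
  let t : CharExt p θ → ZMod p := fun a => (a + inl θ 1 - a).fst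
  have ht : ∀ a z, a + inl θ z - a = inl θ (t a * z) := h1
  have hadd : ∀ a b, t (a + b) = t a * t b := by
    intro a b
    apply inl_injective (θ := θ)
    have e : a + b + inl θ 1 - (a + b) = a + (b + inl θ 1 - b) - a := by
      simp [sub_eq_add_neg, add_assoc]
    have := ht (a + b) 1
    rw [mul_one] at this
    rw [← this, e, ht b, ht a, mul_one]
  -- An automorphism λ_g acts on the kernel by a scalar, which commutes with the scalar t(a). As ab
  -- = a + λ_a(b), t becomes multiplicative for multiplication too.
  have hlam : ∀ g a, t (lam g a) = t a := by
    intro g a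
    have e : lam g (a + inl θ 1 - a) = lam g a + lam g (inl θ 1) - lam g a := by simp
    rw [ht, hV, hV, ht, mul_one, mul_one] at e
    have := inl_injective e
    rw [mul_comm] at this
    exact (mul_right_cancel₀ (Units.ne_zero _) this).symm
  have hmul : ∀ a b, t (a * b) = t a * t b := fun a b => by rw [← add_lam, hadd, hlam]
  have hone : t 1 = 1 := by
    change (1 + inl θ 1 - 1 : CharExt p θ).fst = 1
    rw [← zero_eq_one]
    simp
  have hinl : ∀ z, t (inl θ z) = 1 := fun z => by
    change (inl θ z + inl θ 1 - inl θ z : CharExt p θ).fst = 1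
    rw [inl_add_inl h, sub_eq_add_neg, ← inl_neg h, inl_add_inl h]
    simp
  let t' : CharExt p θ →* ZMod p := { toFun := t, map_one' := hone, map_mul' := hmul }
  have hT : ∀ a, ((t'.toHomUnits.comp (inr θ)) a.snd : ZMod p) = t a := fun a => by
    change t (inr θ a.snd) = t a
    conv_rhs => rw [eq_inl_mul_inr a]
    rw [hmul, hinl, one_mul]
  refine ⟨t'.toHomUnits.comp (inr θ), fun a z => ?_, fun a b => ?_⟩
  · rw [hT, ← ht, sub_add_cancel]
  · ext
    rw [hT, Units.val_mul, hT, hT, hadd]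

variable {V T : Q →* (ZMod p)ˣ}

omit [Finite Q] in
theorem add_inl_eq (hV : ∀ (a : CharExt p θ) z, lam a (inl θ z) = inl θ (V a.snd * z))
    (a : CharExt p θ) (z : ZMod p) :
    a + inl θ z = ⟨a.fst + θ a.snd * (V a.snd : ZMod p)⁻¹ * z, a.snd⟩ := by
  rw [← mul_lam_inv, hV, mul_inl, inv_snd, map_inv, mul_assoc, Units.val_inv_eq_inv_val]

omit [Finite Q] in
theorem inl_add_eq (hV : ∀ (a : CharExt p θ) z, lam a (inl θ z) = inl θ (V a.snd * z))
    (hT : ∀ (a : CharExt p θ) z, a + inl θ z = inl θ (T a.snd * z) + a)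
    (a : CharExt p θ) (z : ZMod p) :
    inl θ z + a = ⟨a.fst + θ a.snd * (V a.snd : ZMod p)⁻¹ * (T a.snd : ZMod p)⁻¹ * z,
      a.snd⟩ := by
  have := hT a ((T a.snd : ZMod p)⁻¹ * z)
  rw [mul_inv_cancel_left₀ (Units.ne_zero _)] at this
  rw [← this, add_inl_eq hV]
  simp only [mul_assoc]

-- For z in the kernel, λ at the inverse of z moves a by the kernel element k(a)z with k = T⁻¹ −
-- Vθ⁻¹. Additivity of λ makes k a cocycle on the additive group of Q, and
-- `eq_one_or_eq_of_cocycle`, applied to Vθ⁻¹ and T⁻¹, leaves Vθ⁻¹ = 1 or Vθ⁻¹ = T⁻¹.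
include h in
theorem lam_character_dichotomy
    (hV : ∀ (a : CharExt p θ) z, lam a (inl θ z) = inl θ (V a.snd * z))
    (hT : ∀ (a : CharExt p θ) z, a + inl θ z = inl θ (T a.snd * z) + a)
    (hTadd : ∀ a b : CharExt p θ, T (a + b).snd = T a.snd * T b.snd) :
    V = θ ∨ V * T = θ := by
  have hV0 : ∀ q, (V q : ZMod p) ≠ 0 := fun q => Units.ne_zero _
  have hT0 : ∀ q, (T q : ZMod p) ≠ 0 := fun q => Units.ne_zero _
  have hθ0 : ∀ q, (θ q : ZMod p) ≠ 0 := fun q => Units.ne_zero _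
  obtain ⟨k, hk'⟩ : ∃ k : Q → ZMod p, ∀ q, k q = (T q : ZMod p)⁻¹ - V q * (θ q : ZMod p)⁻¹ :=
    ⟨_, fun _ => rfl⟩
  have hk : ∀ z (a : CharExt p θ), lam (inl θ z)⁻¹ a = a + inl θ (k a.snd * z) := by
    intro z a
    have e : lam (inl θ z)⁻¹ a = (inl θ z)⁻¹ * (inl θ z + a) := by
      rw [← mul_lam_inv, inv_mul_cancel_left]
    rw [e, inl_add_eq hV hT, add_inl_eq hV, hk']
    have h1 := hV0 a.snd
    have h2 := hT0 a.snd
    have h3 := hθ0 a.snd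
    ext
    · simp only [mul_fst, inv_fst, inv_snd, inl_snd, inl_fst, map_one, inv_one, Units.val_one,
        one_mul]
      field_simp
      ring
    · simp only [mul_snd, inv_snd, inl_snd, inv_one, one_mul]
  have key : ∀ a b : CharExt p θ, k (a + b).snd = (T b.snd : ZMod p)⁻¹ * k a.snd + k b.snd := by
    intro a b
    have e := map_add (lam (inl θ 1)⁻¹) a b
    have e2 : inl θ (k a.snd * 1) + b = b + inl θ ((T b.snd : ZMod p)⁻¹ * (k a.snd * 1)) := by
      rw [hT, mul_inv_cancel_left₀ (hT0 _)]
    rw [hk, hk, hk, add_assoc, add_assoc, ← add_assoc (inl θ _) b, e2, add_assoc b,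
      inl_add_inl h] at e
    have := inl_injective (add_left_cancel (add_left_cancel e))
    rwa [mul_one, mul_one, mul_one] at this
  have hmb : ∀ q', Function.Bijective (fun q => (inr θ q + inr θ q').snd) := by
    intro q'
    apply Function.Injective.bijective_of_finite
    intro q q'' e
    have e1 : (inr θ q + inr θ q').snd = (inr θ q'' + inr θ q').snd := e
    rw [← neg_add_snd h] at e1
    have e2 := conj_snd_eq_one h (inr θ q') e1
    have e3 : inr θ q' + (-(inr θ q + inr θ q') + (inr θ q'' + inr θ q')) - inr θ q' =
        -inr θ q + inr θ q'' := by
      simp [sub_eq_add_neg, add_assoc]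
    rw [e3, neg_add_snd h] at e2
    exact e2
  have := eq_one_or_eq_of_cocycle h.coprime (V * θ⁻¹) T⁻¹ (fun q q' => (inr θ q + inr θ q').snd) hmb
    (by
      intro q q'
      have h1 := key (inr θ q) (inr θ q')
      have h2 := hTadd (inr θ q) (inr θ q')
      simp only [inr_snd] at h1 h2
      rw [hk', hk', hk', h2] at h1
      simp only [MonoidHom.mul_apply, MonoidHom.inv_apply, Units.val_mul,
        Units.val_inv_eq_inv_val, mul_inv] at h1 ⊢
      linear_combination -h1)
  rcases this with e | e
  · left
    ext q
    have := DFunLike.congr_fun e q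
    rw [MonoidHom.mul_apply, MonoidHom.inv_apply, MonoidHom.one_apply, mul_inv_eq_one] at this
    rw [this]
  · right
    ext q
    have := DFunLike.congr_fun e q
    rw [MonoidHom.mul_apply, MonoidHom.inv_apply, MonoidHom.inv_apply, mul_inv_eq_iff_eq_mul,
      eq_inv_mul_iff_mul_eq, mul_comm] at this
    rw [MonoidHom.mul_apply, this]

end Characters

end CharExt
-- Classification of the lifts of left type
open IsSkewBrace

namespace CharExt

variable {p : ℕ} {Q : Type*} [Group Q] {θ : Q →* (ZMod p)ˣ}

section Left

variable [AddGroup Q] [AddGroup (CharExt p θ)]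

variable (θ) in
/-- The addition is compatible with the addition of the quotient, its conjugation action on the
kernel is `T`, and adding an element of the kernel on the left amounts to multiplying by it. -/
structure IsLeftType (T : Q →* (ZMod p)ˣ) : Prop where
  add_snd : ∀ a b : CharExt p θ, (a + b).snd = a.snd + b.snd
  add_inl : ∀ (a : CharExt p θ) z, a + inl θ z = inl θ (T a.snd * z) + a
  inl_add : ∀ (a : CharExt p θ) z, inl θ z + a = inl θ z * a

variable [Fact p.Prime] [Finite Q] [IsSkewBrace Q] [IsSkewBrace (CharExt p θ)]

/-- The addition is determined by the cocycle c(q, q′), the first coordinate of the sum of the lifts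
of q and q′. As |Q| is invertible modulo p, averaging over the multiplicative and the additive law
of Q determines c up to one scalar. -/
theorem IsLeftType.exists_add_fst (hQ : p.Coprime (Nat.card Q)) {T : Q →* (ZMod p)ˣ}
    (hT : ∀ q q' : Q, T (q + q') = T q * T q') (h : IsLeftType θ T) :
    ∃ u : ZMod p, ∀ a b : CharExt p θ, (a + b).fst = a.fst + T a.snd * b.fst +
      u * (θ a.snd + T a.snd * θ b.snd - T a.snd - θ (a.snd + b.snd)) := by
  have := Fintype.ofFinite Q
  have hp : p.Prime := Fact.out
  have hn : (Fintype.card Q : ZMod p) ≠ 0 := by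
    rw [← Nat.card_eq_fintype_card, Ne, ZMod.natCast_eq_zero_iff]
    exact (Nat.Prime.coprime_iff_not_dvd hp).1 hQ
  obtain ⟨hπ, hconj, hl⟩ := h
  have hz : ∀ a : CharExt p θ, a = inl θ a.fst + inr θ a.snd := fun a => by
    rw [hl]; exact eq_inl_mul_inr a
  have hll : ∀ (a : CharExt p θ) z, (inl θ z + a).fst = z + a.fst := fun a z => by
    rw [hl, inl_mul']
  set c : Q → Q → ZMod p := fun q q' => (inr θ q + inr θ q').fst with hc
  have hadd : ∀ a b : CharExt p θ,
      (a + b).fst = a.fst + T a.snd * b.fst + c a.snd b.snd := by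
    intro a b
    have e : a + b = inl θ a.fst + (inl θ (T a.snd * b.fst) + (inr θ a.snd + inr θ b.snd)) := by
      conv_lhs => rw [hz a, hz b]
      have := hconj (inr θ a.snd) b.fst
      rw [inr_snd] at this
      rw [add_assoc, ← add_assoc (inr θ a.snd), this]
      simp only [add_assoc]
    rw [e, hll, hll, add_assoc]
  have hlamsnd : ∀ a b : CharExt p θ, (lam a b).snd = lam a.snd b.snd := by
    intro a b
    have e := congrArg snd (add_lam a b)
    rw [hπ, mul_snd, ← add_lam] at e
    exact add_left_cancel e
  have hlamfst : ∀ a b : CharExt p θ, (a * b).fst =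
      a.fst + T a.snd * (lam a b).fst + c a.snd (lam a.snd b.snd) := by
    intro a b
    rw [← add_lam, hadd, hlamsnd]
  set E : Q → Q → ZMod p := fun g x => (lam (inr θ g) (inr θ x)).fst with hE
  have h1 : ∀ g x, c g (lam g x) = -(T g * E g x) := by
    intro g x
    have := hlamfst (inr θ g) (inr θ x)
    rw [← map_mul] at this
    simp only [inr_fst, inr_snd, zero_add] at this
    linear_combination -this
  have hT0 : ∀ g, (T g : ZMod p) ≠ 0 := fun g => Units.ne_zero _
  have h2 : ∀ g (b : CharExt p θ), (lam (inr θ g) b).fst =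
      θ g * (T g : ZMod p)⁻¹ * b.fst + E g b.snd := by
    intro g b
    have e1 := hlamfst (inr θ g) b
    rw [inr_snd, h1] at e1
    simp only [mul_fst, inr_fst, inr_snd, zero_add] at e1
    have := hT0 g
    field_simp
    linear_combination -e1
  have h3 : ∀ g g' x, E (g * g') x = θ g * (T g : ZMod p)⁻¹ * E g' x + E g (lam g' x) := by
    intro g g' x
    have := h2 g (lam (inr θ g') (inr θ x))
    rw [← lam_mul, ← map_mul, hlamsnd, inr_snd, inr_snd] at this
    exact this
  -- Summing over x, which λ permutes, turns E into a multiplicative 1-cocycle for the character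
  -- θT⁻¹. Averaging shows it to be a multiple of 1 − θT⁻¹.
  set F : Q → ZMod p := fun g => ∑ x, E g x with hF
  have h4 : ∀ g g', F (g * g') = θ g * (T g : ZMod p)⁻¹ * F g' + F g := by
    intro g g'
    simp only [hF, h3, Finset.sum_add_distrib, ← Finset.mul_sum]
    congr 1
    exact (lam g').toEquiv.sum_comp (fun x => E g x)
  have h5 : ∀ g, (Fintype.card Q : ZMod p) * F g =
      (1 - θ g * (T g : ZMod p)⁻¹) * ∑ x, F x := by
    intro g
    have := Equiv.sum_comp (Equiv.mulLeft g) F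
    simp only [Equiv.coe_mulLeft, h4, Finset.sum_add_distrib, ← Finset.mul_sum, Finset.sum_const,
      Finset.card_univ, nsmul_eq_mul] at this
    linear_combination this
  set C : Q → ZMod p := fun g => ∑ x, c g x with hC
  have h6 : ∀ g, C g = -(T g * F g) := by
    intro g
    simp only [hC, hF, Finset.mul_sum, ← Finset.sum_neg_distrib, ← h1]
    exact ((lam g).toEquiv.sum_comp (fun x => c g x)).symm
  -- The additive 2-cocycle identity, summed over its last variable, exhibits |Q|·c as the
  -- coboundary of C.
  have h7 : ∀ q q', (Fintype.card Q : ZMod p) * c q q' = T q * C q' + C q - C (q + q') := by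
    intro q q'
    have e : ∀ x, c q q' + c (q + q') x = T q * c q' x + c q (q' + x) := by
      intro x
      have := congrArg fst (add_assoc (inr θ q) (inr θ q') (inr θ x))
      rw [hadd, hadd _ (inr θ q' + inr θ x), hπ, hπ] at this
      simp only [inr_fst, inr_snd, mul_zero, add_zero, zero_add] at this
      exact this
    have := Finset.sum_congr (s₁ := Finset.univ) rfl (fun x _ => e x)
    simp only [Finset.sum_add_distrib, ← Finset.mul_sum, Finset.sum_const, Finset.card_univ,
      nsmul_eq_mul] at this
    have e2 := Equiv.sum_comp (Equiv.addLeft q') (fun x => c q x)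
    simp only [Equiv.coe_addLeft] at e2
    rw [e2] at this
    simp only [hC]
    linear_combination this
  -- One factor |Q| comes from `h5` and one from `h7`.
  refine ⟨(∑ x, F x) / (Fintype.card Q) ^ 2, fun a b => ?_⟩
  rw [hadd]
  congr 1
  have e7 := h7 a.snd b.snd
  rw [h6, h6, h6, hT, Units.val_mul] at e7
  have e1 := h5 a.snd
  have e2 := h5 b.snd
  have e3 := h5 (a.snd + b.snd)
  rw [hT, Units.val_mul] at e3
  have t1 := hT0 a.snd
  have t2 := hT0 b.snd
  field_simp at e1 e2 e3 ⊢
  linear_combination (Fintype.card Q : ZMod p) * e7 - (T a.snd : ZMod p) * e2 - e1 + e3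

end Left

end CharExt
open IsSkewBrace

namespace CharExt

variable {p : ℕ} {Q : Type*} [Group Q] {θ : Q →* (ZMod p)ˣ}

section Left

variable [AddGroup Q] [IsSkewBrace Q]

theorem char_zero (T : Q →* (ZMod p)ˣ) : T 0 = 1 := by rw [zero_eq_one, map_one]

variable (θ) in
/-- The left type addition with conjugation character `T` and parameter `u`. -/
@[reducible] def leftAddGroup {T : Q →* (ZMod p)ˣ}
    (hT : ∀ q q' : Q, T (q + q') = T q * T q') (u : ZMod p) : AddGroup (CharExt p θ) :=
  letI : Add (CharExt p θ) := ⟨fun a b => ⟨a.fst + T a.snd * b.fst +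
    u * (θ a.snd + T a.snd * θ b.snd - T a.snd - θ (a.snd + b.snd)), a.snd + b.snd⟩⟩
  letI : Zero (CharExt p θ) := ⟨1⟩
  letI : Neg (CharExt p θ) := ⟨fun a => ⟨-(T (-a.snd) * (a.fst + u * (θ a.snd - 1))) +
    u * (1 - θ (-a.snd)), -a.snd⟩⟩
  have hf : ∀ a b : CharExt p θ, (a + b).fst = a.fst + T a.snd * b.fst +
    u * (θ a.snd + T a.snd * θ b.snd - T a.snd - θ (a.snd + b.snd)) := fun _ _ => rfl
  have hs : ∀ a b : CharExt p θ, (a + b).snd = a.snd + b.snd := fun _ _ => rfl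
  have h0 : (0 : CharExt p θ).fst = 0 := rfl
  have h0' : (0 : CharExt p θ).snd = 0 := (zero_eq_one Q).symm
  AddGroup.ofLeftAxioms
    (fun a b c => by
      ext
      · simp only [hf, hs, hT, Units.val_mul, add_assoc a.snd]
        ring
      · simp only [hs, add_assoc])
    (fun a => by
      ext
      · simp only [hf, h0, h0', char_zero, zero_add, Units.val_one]
        ring
      · simp only [hs, h0', zero_add])
    (fun a => by
      ext
      · have h1 : (-a : CharExt p θ).fst = -(T (-a.snd) * (a.fst + u * (θ a.snd - 1))) +
          u * (1 - θ (-a.snd)) := rfl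
        have h2 : (-a : CharExt p θ).snd = -a.snd := rfl
        simp only [hf, h1, h2, h0, neg_add_cancel, char_zero, Units.val_one]
        ring
      · exact (neg_add_cancel a.snd).trans (zero_eq_one Q))

variable {T : Q →* (ZMod p)ˣ} (hT : ∀ q q' : Q, T (q + q') = T q * T q')

theorem leftAddGroup_isSkewBrace (u : ZMod p) :
    letI := leftAddGroup θ hT u
    IsSkewBrace (CharExt p θ) := by
  let := leftAddGroup θ hT u
  have hf : ∀ a b : CharExt p θ, (a + b).fst = a.fst + T a.snd * b.fst +
    u * (θ a.snd + T a.snd * θ b.snd - T a.snd - θ (a.snd + b.snd)) := fun _ _ => rfl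
  have hs : ∀ a b : CharExt p θ, (a + b).snd = a.snd + b.snd := fun _ _ => rfl
  refine ⟨fun a b c => ?_⟩
  -- Working with the solution x of a + x = ac avoids the formula for negation.
  obtain ⟨x, hx⟩ : ∃ x, x = -a + a * c := ⟨_, rfl⟩
  have hx' : a + x = a * c := by rw [hx, add_neg_cancel_left]
  rw [sub_eq_add_neg, add_assoc, ← hx]
  have e1 := congrArg fst hx'
  have e2 : a.snd + x.snd = a.snd * c.snd := congrArg snd hx'
  have e3 : a.snd * b.snd + x.snd = a.snd * (b.snd + c.snd) := by
    rw [mul_add_eq, ← e2, sub_eq_add_neg, add_assoc, neg_add_cancel_left]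
  rw [hf, e2] at e1
  ext
  · rw [mul_fst, hf, hf, mul_snd, mul_fst, e3]
    simp only [map_mul, Units.val_mul, mul_fst] at e1 ⊢
    linear_combination -(T b.snd : ZMod p) * e1
  · rw [mul_snd, hs, hs, mul_snd, e3]

theorem leftAddGroup_isLeftType (u : ZMod p) :
    letI := leftAddGroup θ hT u
    IsLeftType θ T := by
  let := leftAddGroup θ hT u
  have hf : ∀ a b : CharExt p θ, (a + b).fst = a.fst + T a.snd * b.fst +
    u * (θ a.snd + T a.snd * θ b.snd - T a.snd - θ (a.snd + b.snd)) := fun _ _ => rfl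
  have hs : ∀ a b : CharExt p θ, (a + b).snd = a.snd + b.snd := fun _ _ => rfl
  have h1 : ∀ q : Q, 1 + q = q := fun q => by rw [← zero_eq_one, zero_add]
  have h2 : ∀ q : Q, q + 1 = q := fun q => by rw [← zero_eq_one, add_zero]
  refine ⟨hs, fun a z => ?_, fun a z => ?_⟩
  · ext
    · simp only [hf, inl_snd, inl_fst, map_one, Units.val_one, h1, h2]
      ring
    · simp only [hs, inl_snd, h1, h2]
  · ext
    · simp only [hf, inl_snd, inl_fst, map_one, Units.val_one, h1, mul_fst]
      ring
    · simp only [hs, inl_snd, h1, mul_snd, one_mul]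

/-- The left type skew braces over a given skew brace with given conjugation character. -/
def LeftFiber (θ T : Q →* (ZMod p)ˣ) : Type _ :=
  {_S : AddGroup (CharExt p θ) // IsSkewBrace (CharExt p θ) ∧ IsLeftType θ T}

omit [IsSkewBrace Q] in
theorem leftFiber_ext {S S' : LeftFiber θ T}
    (h : ∀ a b : CharExt p θ, (S.1.add a b).fst = (S'.1.add a b).fst) : S = S' := by
  apply Subtype.ext
  apply AddGroup.ext
  funext a b
  ext
  · exact h a b
  · exact (@IsLeftType.add_snd _ _ _ _ _ S.1 _ S.2.2 a b).trans
      (@IsLeftType.add_snd _ _ _ _ _ S'.1 _ S'.2.2 a b).symm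

-- The additions are parametrised by u. Its coefficient θ(q) + T(q)θ(q′) − T(q) − θ(q + q′) vanishes
-- identically exactly when θ is 1 or T, again by `eq_one_or_eq_of_cocycle`.
include hT in
open Classical in
theorem natCard_leftFiber [Fact p.Prime] [Finite Q] (hQ : p.Coprime (Nat.card Q)) :
    Nat.card (LeftFiber θ T) = if θ = 1 ∨ θ = T then 1 else p := by
  let F : ZMod p → LeftFiber θ T := fun u =>
    ⟨leftAddGroup θ hT u, leftAddGroup_isSkewBrace hT u, leftAddGroup_isLeftType hT u⟩
  have hF : ∀ u a b, ((F u).1.add a b).fst = a.fst + T a.snd * b.fst +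
      u * (θ a.snd + T a.snd * θ b.snd - T a.snd - θ (a.snd + b.snd)) := fun u a b => rfl
  have hsurj : Function.Surjective F := by
    rintro ⟨S, hS1, hS2⟩
    obtain ⟨u, hu⟩ := hS2.exists_add_fst hQ hT
    exact ⟨u, leftFiber_ext fun a b => (hu a b).symm⟩
  split_ifs with h
  · rw [Nat.card_eq_one_iff_unique]
    refine ⟨⟨fun S S' => ?_⟩, ⟨F 0⟩⟩
    obtain ⟨u, rfl⟩ := hsurj S
    obtain ⟨u', rfl⟩ := hsurj S'
    apply leftFiber_ext
    intro a b
    rw [hF, hF]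
    rcases h with rfl | rfl
    · simp only [MonoidHom.one_apply, Units.val_one]
      ring
    · rw [hT, Units.val_mul]
      ring
  · rw [← Nat.card_congr (Equiv.ofBijective F ⟨fun u u' e => ?_, hsurj⟩), Nat.card_zmod]
    by_contra hne
    apply h
    refine eq_one_or_eq_of_cocycle hQ θ T (fun q q' => q' + q) (fun q' => (Equiv.addLeft q').bijective)
      (fun q q' => ?_)
    have e1 := hF u ⟨0, q'⟩ ⟨0, q⟩
    rw [e, hF] at e1
    have : (u - u') * (θ q' + T q' * θ q - T q' - θ (q' + q)) = 0 := by
      linear_combination -e1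
    rcases mul_eq_zero.1 this with h0 | h0
    · exact absurd (sub_eq_zero.1 h0) hne
    · linear_combination -h0

end Left

section Opposite

/-- The opposite addition. -/
@[reducible] def oppAddGroup {A : Type*} (S : AddGroup A) : AddGroup A :=
  letI : Add A := ⟨fun a b => S.add b a⟩
  letI : Zero A := S.toZero
  letI : Neg A := S.toNeg
  AddGroup.ofLeftAxioms (fun a b c => (S.add_assoc c b a).symm) (fun a => S.add_zero a)
    (fun a => @add_neg_cancel A S a)

theorem oppAddGroup_oppAddGroup {A : Type*} (S : AddGroup A) : oppAddGroup (oppAddGroup S) = S :=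
  AddGroup.ext rfl

theorem isSkewBrace_opp {A : Type*} [Group A] {S : AddGroup A} (h : IsSkewBrace A) :
    @IsSkewBrace A _ (oppAddGroup S) := by
  refine @IsSkewBrace.mk A _ (oppAddGroup S) fun a b c => ?_
  change a * (c + b) = a * c + (-a + a * b)
  rw [mul_add_eq, sub_eq_add_neg, add_assoc]

end Opposite

end CharExt
-- The number of lifts with given quotient and conjugation character
open IsSkewBrace

namespace CharExt

variable {p : ℕ} {Q : Type*} [Group Q] {θ : Q →* (ZMod p)ˣ}

section Fiber

variable (θ) in
/-- The addition is compatible with the addition of the quotient and its conjugation action on the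
kernel is `T`. -/
structure IsOver [AddGroup Q] [AddGroup (CharExt p θ)] (T : Q →* (ZMod p)ˣ) : Prop where
  add_snd : ∀ a b : CharExt p θ, (a + b).snd = a.snd + b.snd
  add_inl : ∀ (a : CharExt p θ) z, a + inl θ z = inl θ (T a.snd * z) + a

theorem isOver_opp [SQ : AddGroup Q] [S : AddGroup (CharExt p θ)] {T : Q →* (ZMod p)ˣ}
    (h : IsOver θ T) : @IsOver p Q _ θ (oppAddGroup SQ) (oppAddGroup S) T⁻¹ := by
  refine @IsOver.mk p Q _ θ (oppAddGroup SQ) (oppAddGroup S) _ (fun a b => h.add_snd b a)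
    fun a z => ?_
  change inl θ z + a = a + inl θ _
  rw [h.add_inl, MonoidHom.inv_apply, Units.mul_inv_cancel_left]

theorem isLeftType_iff [AddGroup Q] [AddGroup (CharExt p θ)] {T : Q →* (ZMod p)ˣ} :
    IsLeftType θ T ↔ IsOver θ T ∧ ∀ (a : CharExt p θ) z, inl θ z + a = inl θ z * a :=
  ⟨fun h => ⟨⟨h.1, h.2⟩, h.3⟩, fun h => ⟨h.1.1, h.1.2, h.2⟩⟩

theorem IsOver.left_or_right [Fact p.Prime] [Finite Q] [AddGroup Q] [AddGroup (CharExt p θ)]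
    [IsSkewBrace (CharExt p θ)] (h : SylowCondition p (Nat.card Q)) {T : Q →* (ZMod p)ˣ}
    (hT : ∀ q q' : Q, T (q + q') = T q * T q') (ho : IsOver θ T) :
    (∀ (a : CharExt p θ) z, inl θ z + a = inl θ z * a) ∨
      ∀ (a : CharExt p θ) z, a + inl θ z = inl θ z * a := by
  obtain ⟨V, hV⟩ := exists_lam_character (θ := θ) h
  have hV0 : ∀ q, (V q : ZMod p) ≠ 0 := fun q => Units.ne_zero _
  have hT0 : ∀ q, (T q : ZMod p) ≠ 0 := fun q => Units.ne_zero _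
  rcases lam_character_dichotomy h hV ho.add_inl
    (fun a b => by rw [ho.add_snd, hT]) with rfl | rfl
  · right
    intro a z
    rw [add_inl_eq hV, inl_mul', mul_inv_cancel₀ (hV0 _), one_mul, add_comm]
  · left
    intro a z
    have h1 := hV0 a.snd
    have h2 := hT0 a.snd
    rw [inl_add_eq hV ho.add_inl, inl_mul', MonoidHom.mul_apply, Units.val_mul]
    congr 1
    field_simp
    ring

variable [SQ : AddGroup Q] [IsSkewBrace Q]

/-- The skew braces over a given skew brace with given conjugation character. -/
def Fiber (θ T : Q →* (ZMod p)ˣ) : Type _ :=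
  {_S : AddGroup (CharExt p θ) // IsSkewBrace (CharExt p θ) ∧ IsOver θ T}

-- Every lift is of left or of right type. Passing to opposite additions turns right type with T
-- into left type with T⁻¹. The types are disjoint for T ≠ 1, and for T = 1 the right type is
-- contained in the left.
open Classical in
theorem natCard_fiber [Fact p.Prime] [Finite Q] (h : SylowCondition p (Nat.card Q))
    {T : Q →* (ZMod p)ˣ} (hT : ∀ q q' : Q, T (q + q') = T q * T q') :
    Nat.card (Fiber θ T) = (if θ = 1 ∨ θ = T then 1 else p) +
      (if T = 1 then 0 else if θ = 1 ∨ θ = T⁻¹ then 1 else p) := by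
  let Lft : AddGroup (CharExt p θ) → Prop := fun _ => IsSkewBrace (CharExt p θ) ∧ IsLeftType θ T
  let Rgt : AddGroup (CharExt p θ) → Prop := fun _ => (IsSkewBrace (CharExt p θ) ∧ IsOver θ T) ∧
    ∀ (a : CharExt p θ) z, a + inl θ z = inl θ z * a
  have hL : Nat.card (Subtype Lft) = if θ = 1 ∨ θ = T then 1 else p :=
    natCard_leftFiber hT h.coprime
  have hLR : ∀ S : AddGroup (CharExt p θ),
      (IsSkewBrace (CharExt p θ) ∧ IsOver θ T) ↔ Lft S ∨ Rgt S := by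
    intro S
    constructor
    · rintro ⟨h1, h2⟩
      rcases h2.left_or_right h hT with h3 | h3
      · exact Or.inl ⟨h1, isLeftType_iff.2 ⟨h2, h3⟩⟩
      · exact Or.inr ⟨⟨h1, h2⟩, h3⟩
    · rintro (h1 | h1)
      · exact ⟨h1.1, (isLeftType_iff.1 h1.2).1⟩
      · exact h1.1
  have e0 : Fiber θ T ≃ {S // Lft S ∨ Rgt S} := Equiv.subtypeEquivRight hLR
  rw [Nat.card_congr e0]
  by_cases hT1 : T = 1
  · rw [if_pos hT1, add_zero, ← hL]
    refine Nat.card_congr (Equiv.subtypeEquivRight fun S => or_iff_left_of_imp ?_)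
    rintro ⟨⟨h1, h2⟩, h3⟩
    refine ⟨h1, isLeftType_iff.2 ⟨h2, fun a z => ?_⟩⟩
    have := h2.add_inl a z
    rw [hT1, MonoidHom.one_apply, Units.val_one, one_mul] at this
    rw [← this, h3]
  · have hdisj : Disjoint Lft Rgt := by
      rw [Pi.disjoint_iff]
      intro S
      rw [Prop.disjoint_iff]
      by_contra hc
      obtain ⟨⟨h1, h2⟩, ⟨_, h4⟩, h3⟩ := hc
      apply hT1
      ext q
      have := h2.add_inl (inr θ q) 1
      rw [h3, h2.inl_add] at this
      simpa [inl_mul'] using (congrArg fst this).symm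
    rw [Nat.card_congr (subtypeOrEquiv _ _ hdisj), Nat.card_sum, hL, if_neg hT1]
    congr 1
    let := oppAddGroup SQ
    have : IsSkewBrace Q := isSkewBrace_opp (S := SQ) inferInstance
    have hT' : ∀ q q' : Q, T⁻¹ (q + q') = T⁻¹ q * T⁻¹ q' := by
      intro q q'
      change T⁻¹ (SQ.add q' q) = _
      have := hT q' q
      simp only [MonoidHom.inv_apply]
      rw [← mul_inv, mul_comm (T q)]
      exact congrArg _ this
    rw [← natCard_leftFiber (θ := θ) hT' h.coprime]
    let e : AddGroup (CharExt p θ) ≃ AddGroup (CharExt p θ) :=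
      ⟨oppAddGroup, oppAddGroup, oppAddGroup_oppAddGroup, oppAddGroup_oppAddGroup⟩
    refine Nat.card_congr (Equiv.subtypeEquiv e fun S => ⟨?_, ?_⟩)
    · rintro ⟨⟨h1, h2⟩, h3⟩
      exact ⟨isSkewBrace_opp h1, @isLeftType_iff p Q _ θ (oppAddGroup SQ) (oppAddGroup S) _ |>.2
        ⟨@isOver_opp p Q _ θ SQ S _ h2, fun a z => h3 a z⟩⟩
    · rintro ⟨h1, h2⟩
      have h3 := (@isLeftType_iff p Q _ θ (oppAddGroup SQ) (oppAddGroup S) _).1 h2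
      have h4 := @isOver_opp p Q _ θ (oppAddGroup SQ) (oppAddGroup S) _ h3.1
      have h5 := @isSkewBrace_opp _ _ (oppAddGroup S) h1
      rw [oppAddGroup_oppAddGroup] at h5
      rw [oppAddGroup_oppAddGroup, oppAddGroup_oppAddGroup, show T⁻¹⁻¹ = T from MonoidHom.ext fun q => inv_inv (T q)] at h4
      exact ⟨⟨h5, h4⟩, fun a z => h3.2 a z⟩

end Fiber

end CharExt
-- Splitting of extensions and isomorphisms between them
open IsSkewBrace

namespace CharExt

variable {p : ℕ} {Q Q' : Type*} [Group Q] [Group Q'] {θ : Q →* (ZMod p)ˣ} {θ' : Q' →* (ZMod p)ˣ}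

/-- A group with a normal subgroup of prime order is split when the index is prime to the order. -/
theorem exists_mulEquiv [Fact p.Prime] [Finite Q] (hQ : p.Coprime (Nat.card Q)) {X : Type*}
    [Group X] (π : X →* Q) (hπ : Function.Surjective π) (ι : Multiplicative (ZMod p) →* X)
    (hι : Function.Injective ι) (hker : ι.range = π.ker)
    (hconj : ∀ x (z : ZMod p), x * ι (.ofAdd z) = ι (.ofAdd (θ (π x) * z)) * x) :
    ∃ ψ : X ≃* CharExt p θ, ∀ x, (ψ x).snd = π x := by
  have hp : p.Prime := Fact.out
  have hN : Nat.card π.ker = p := by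
    rw [← hker, ← Nat.card_congr (MonoidHom.ofInjective hι).toEquiv]
    exact Nat.card_zmod p
  have hidx : π.ker.index = Nat.card Q := by
    rw [Subgroup.index_ker, MonoidHom.range_eq_top.2 hπ, Subgroup.card_top]
  -- Schur–Zassenhaus: the complement yields the section s of π.
  obtain ⟨H, hH⟩ := Subgroup.exists_right_complement'_of_coprime (N := π.ker)
    (by rw [hN, hidx]; exact hQ)
  have hbij : Function.Bijective (π.comp H.subtype) := by
    constructor
    · rw [injective_iff_map_eq_one]
      intro x hx
      have : (x : X) ∈ π.ker ⊓ H := ⟨hx, x.2⟩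
      rw [disjoint_iff.1 hH.disjoint] at this
      exact Subtype.ext this
    · intro q
      obtain ⟨x, rfl⟩ := hπ q
      obtain ⟨⟨⟨n, hn⟩, k⟩, rfl⟩ := hH.2 x
      refine ⟨k, ?_⟩
      change π k = π (n * k)
      rw [map_mul, hn, one_mul]
  let e := MulEquiv.ofBijective _ hbij
  let s : Q →* X := H.subtype.comp e.symm.toMonoidHom
  have hs : ∀ q, π (s q) = q := fun q => e.apply_symm_apply q
  have hπι : ∀ z, π (ι z) = 1 := fun z => by
    have : ι z ∈ π.ker := hker ▸ ⟨z, rfl⟩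
    exact this
  let f : CharExt p θ →* X :=
    { toFun := fun a => ι (.ofAdd a.fst) * s a.snd
      map_one' := by rw [one_fst, one_snd, ofAdd_zero, map_one, map_one, one_mul]
      map_mul' := fun a b => by
        have := hconj (s a.snd) b.fst
        rw [hs] at this
        rw [mul_fst, mul_snd, ofAdd_add, map_mul ι, map_mul s, mul_assoc, ← mul_assoc _ (s a.snd),
          ← this]
        simp only [mul_assoc] }
  have hfs : ∀ a, π (f a) = a.snd := fun a => by
    change π (ι _ * s _) = _
    rw [map_mul, hπι, one_mul, hs]
  have hf : Function.Bijective f := by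
    constructor
    · intro a b e
      have h1 : a.snd = b.snd := by rw [← hfs, e, hfs]
      have h2 : ι (.ofAdd a.fst) * s a.snd = ι (.ofAdd b.fst) * s b.snd := e
      rw [h1] at h2
      exact CharExt.ext (hι (mul_right_cancel h2)) h1
    · intro x
      have : x * (s (π x))⁻¹ ∈ π.ker := by
        rw [MonoidHom.mem_ker, map_mul, map_inv, hs, mul_inv_cancel]
      rw [← hker] at this
      obtain ⟨z, hz⟩ := this
      refine ⟨⟨z.toAdd, π x⟩, ?_⟩
      change ι z * s (π x) = x
      rw [hz, inv_mul_cancel_right]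
  refine ⟨(MulEquiv.ofBijective f hf).symm, fun x => ?_⟩
  rw [← hfs]
  congr 1
  exact (MulEquiv.ofBijective f hf).apply_symm_apply x

/-- The isomorphism of extensions given by an isomorphism of the quotients. -/
def congrEquiv (ψ : Q ≃* Q') (h : θ'.comp ψ.toMonoidHom = θ) : CharExt p θ ≃* CharExt p θ' where
  toFun a := ⟨a.fst, ψ a.snd⟩
  invFun a := ⟨a.fst, ψ.symm a.snd⟩
  left_inv a := by simp
  right_inv a := by simp
  map_mul' a b := by
    subst h
    exact CharExt.ext rfl (map_mul ψ _ _)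

/-- Isomorphic extensions have quotients and characters related by an isomorphism. -/
theorem exists_of_mulEquiv [Fact p.Prime] [Finite Q] [Finite Q'] (hQ : p.Coprime (Nat.card Q))
    (φ : CharExt p θ ≃* CharExt p θ') :
    ∃ ψ : Q ≃* Q', θ'.comp ψ.toMonoidHom = θ ∧ ∀ a, ψ a.snd = (φ a).snd := by
  have hp : p.Prime := Fact.out
  have hQ' : p.Coprime (Nat.card Q') := by
    have h1 := Nat.card_congr φ.toEquiv
    rw [natCard, natCard] at h1
    rwa [← Nat.eq_of_mul_eq_mul_left hp.pos h1]
  -- The kernel is the solution set of x ^ p = 1, so any isomorphism preserves it.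
  have h1 : ∀ a, (φ a).snd = 1 ↔ a.snd = 1 := fun a => by
    rw [snd_eq_one_iff_pow hQ, snd_eq_one_iff_pow hQ', ← map_pow, EmbeddingLike.map_eq_one_iff]
  have h2 : ∀ a, (φ (inr θ a.snd)).snd = (φ a).snd := fun a => by
    conv_rhs => rw [eq_inl_mul_inr a]
    rw [map_mul, mul_snd, (h1 _).2 (inl_snd _), one_mul]
  let f : Q →* Q' := (sndHom θ').comp (φ.toMonoidHom.comp (inr θ))
  have hf : Function.Bijective f := by
    constructor
    · rw [injective_iff_map_eq_one]
      intro q hq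
      exact (h1 (inr θ q)).1 hq
    · intro q'
      refine ⟨(φ.symm (inr θ' q')).snd, ?_⟩
      change (φ (inr θ _)).snd = _
      rw [h2, φ.apply_symm_apply, inr_snd]
  refine ⟨MulEquiv.ofBijective f hf, ?_, h2⟩
  ext q
  change ((θ' (φ (inr θ q)).snd : (ZMod p)ˣ) : ZMod p) = θ q
  have h3 : ∀ z : ZMod p, φ (inl θ z) = inl θ' (z * (φ (inl θ 1)).fst) := by
    intro z
    have e : inl θ z = inl θ 1 ^ z.val := by
      rw [inl_pow, mul_one, ZMod.natCast_val, ZMod.cast_id]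
    rw [e, map_pow, eq_inl_of_snd ((h1 (inl θ 1)).2 rfl), inl_pow, ZMod.natCast_val, ZMod.cast_id,
      inl_fst]
  have h0 : (φ (inl θ 1)).fst ≠ 0 := by
    intro e
    have h4 := h3 1
    rw [one_mul, e, inl_zero, EmbeddingLike.map_eq_one_iff] at h4
    exact one_ne_zero (congrArg fst h4)
  have h4 : inr θ q * inl θ 1 = inl θ (θ q) * inr θ q := by ext <;> simp
  have h5 := congrArg fst (congrArg φ h4)
  rw [map_mul, map_mul, h3 1, h3 (θ q), mul_inl, inl_mul'] at h5
  have h6 : (θ' (φ (inr θ q)).snd : ZMod p) * (φ (inl θ 1)).fst = θ q * (φ (inl θ 1)).fst := by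
    linear_combination h5
  exact mul_right_cancel₀ h0 h6

end CharExt

/-- Two injective homomorphisms of a finite group to the units of a domain differ by an
automorphism. -/
theorem exists_mulAut_comp_eq {C R : Type*} [Group C] [Finite C] [CommRing R] [IsDomain R]
    {f g : C →* Rˣ} (hf : Function.Injective f) (hg : Function.Injective g) :
    ∃ ψ : C ≃* C, g.comp ψ.toMonoidHom = f := by
  have : NeZero (Nat.card C) := ⟨Nat.card_pos.ne'⟩
  -- The image consists of all roots of unity of order dividing |C|, so it does not depend on the
  -- embedding.
  have key : ∀ k : C →* Rˣ, Function.Injective k → k.range = rootsOfUnity (Nat.card C) R := by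
    intro k hk
    have hle : k.range ≤ rootsOfUnity (Nat.card C) R := by
      rintro _ ⟨c, rfl⟩
      rw [mem_rootsOfUnity, ← map_pow, pow_card_eq_one', map_one]
    refine Subgroup.eq_of_le_of_card_ge hle ?_
    rw [← Nat.card_congr (MonoidHom.ofInjective hk).toEquiv]
    exact card_rootsOfUnity R _
  have hr : f.range = g.range := (key f hf).trans (key g hg).symm
  refine ⟨((MonoidHom.ofInjective hf).trans (MulEquiv.subgroupCongr hr)).trans
    (MonoidHom.ofInjective hg).symm, ?_⟩
  ext c
  change ((g ((MonoidHom.ofInjective hg).symm _) : Rˣ) : R) = f c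
  rw [MonoidHom.apply_ofInjective_symm]
  rfl
-- Skew braces fibred over the quotient skew brace and its characters
open IsSkewBrace

/-- The skew braces with a given multiplicative group. -/
abbrev SkewBraceOn (A : Type*) [Group A] : Type _ := {_S : AddGroup A // IsSkewBrace A}

/-- The characters of a skew brace, with values in the units of `ZMod p`. -/
abbrev SkewBraceOn.Character {A : Type*} [Group A] (S : SkewBraceOn A) (p : ℕ) : Type _ :=
  {T : A →* (ZMod p)ˣ // ∀ a b, T (S.1.add a b) = T a * T b}

instance {A : Type*} [Group A] [Finite A] (p : ℕ) [NeZero p] : Finite (A →* (ZMod p)ˣ) :=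
  DFunLike.finite _

namespace CharExt

variable {p : ℕ} {Q : Type*} [Group Q] {θ : Q →* (ZMod p)ˣ}

/-- A character as a homomorphism from the additive group. -/
def addChar [AddGroup Q] [IsSkewBrace Q] {T : Q →* (ZMod p)ˣ}
    (hT : ∀ q q' : Q, T (q + q') = T q * T q') : Multiplicative Q →* (ZMod p)ˣ where
  toFun q := T q.toAdd
  map_one' := char_zero T
  map_mul' _ _ := hT _ _

/-- The additive group of a skew brace over a given one is an extension of the additive group. -/
theorem IsOver.exists_mulEquiv [Fact p.Prime] [Finite Q] [AddGroup Q] [IsSkewBrace Q]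
    [AddGroup (CharExt p θ)] [IsSkewBrace (CharExt p θ)] (h : SylowCondition p (Nat.card Q))
    {T : Q →* (ZMod p)ˣ} (hT : ∀ q q' : Q, T (q + q') = T q * T q') (ho : IsOver θ T) :
    ∃ ψ : Multiplicative (CharExt p θ) ≃* CharExt p (addChar hT),
      ∀ a, (ψ a).snd = .ofAdd a.toAdd.snd := by
  let πa : CharExt p θ →+ Q :=
    { toFun := snd
      map_zero' := by rw [zero_eq_one, zero_eq_one, one_snd]
      map_add' := ho.add_snd }
  refine CharExt.exists_mulEquiv (θ := addChar hT) h.coprime πa.toMultiplicative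
    (fun q => ⟨.ofAdd (inr θ q.toAdd), rfl⟩) (inlAddHom h).toMultiplicative
    (fun z w e => inl_injective e) ?_ (fun x z => ho.add_inl x.toAdd z)
  ext x
  constructor
  · rintro ⟨z, rfl⟩
    exact (zero_eq_one Q).symm
  · intro hx
    have hx' : x.toAdd.snd = 0 := hx
    rw [zero_eq_one] at hx'
    exact ⟨.ofAdd x.toAdd.fst, (eq_inl_of_snd hx').symm⟩

theorem isSkewBrace_of_isOver [AddGroup Q] [AddGroup (CharExt p θ)] [IsSkewBrace (CharExt p θ)]
    (hadd : ∀ a b : CharExt p θ, (a + b).snd = a.snd + b.snd) : IsSkewBrace Q := by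
  have h0 : (0 : CharExt p θ).snd = 0 := by
    have := hadd 0 0
    rwa [add_zero, left_eq_add] at this
  have hneg : ∀ a : CharExt p θ, (-a).snd = -a.snd := fun a => by
    rw [eq_neg_iff_add_eq_zero, ← hadd, neg_add_cancel, h0]
  refine ⟨fun a b c => ?_⟩
  have := congrArg snd (mul_add_eq (inr θ a) (inr θ b) (inr θ c))
  simpa only [sub_eq_add_neg, mul_snd, hadd, hneg, inr_snd] using this

/-- The skew brace `s` lies over `S`, with conjugation character `T`. -/
def Lies (s : SkewBraceOn (CharExt p θ)) (x : (S : SkewBraceOn Q) × S.Character p) : Prop :=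
  @IsOver p Q _ θ x.1.1 s.1 x.2.1

/-- Both the quotient addition and T are read off from s, so the skew braces on the extension are
partitioned by such pairs; `sum_skewBraceOn` sums along this partition. -/
theorem existsUnique_lies [Fact p.Prime] [Finite Q] (h : SylowCondition p (Nat.card Q))
    (s : SkewBraceOn (CharExt p θ)) : ∃! x, Lies s x := by
  let := s.1
  have := s.2
  obtain ⟨T, hT1, hT2⟩ := exists_conj_character (θ := θ) h
  let := quotAddGroup θ h
  have hadd : ∀ a b : CharExt p θ, (a + b).snd = a.snd + b.snd := add_snd_quot h
  refine ⟨⟨⟨quotAddGroup θ h, isSkewBrace_of_isOver hadd⟩, ⟨T, fun a b => ?_⟩⟩,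
    ⟨hadd, hT1⟩, ?_⟩
  · exact (congrArg T (hadd (inr θ a) (inr θ b))).symm.trans (hT2 (inr θ a) (inr θ b))
  · rintro ⟨⟨S', hS'⟩, ⟨T', hT'⟩⟩ hl
    have h1 := @IsOver.add_snd p Q _ θ S' s.1 T' hl
    have h2 := @IsOver.add_inl p Q _ θ S' s.1 T' hl
    obtain rfl : S' = quotAddGroup θ h := by
      apply AddGroup.ext
      funext a b
      exact (h1 (inr θ a) (inr θ b)).symm
    obtain rfl : T' = T := by
      ext q
      have e := (h2 (inr θ q) 1).symm.trans (hT1 (inr θ q) 1)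
      have := inl_injective (add_right_cancel e)
      simpa using this
    rfl

open Classical in
/-- The number of skew braces lying over a skew brace and a character of it. -/
noncomputable def fiberCard (θ T : Q →* (ZMod p)ˣ) : ℕ :=
  (if θ = 1 ∨ θ = T then 1 else p) + (if T = 1 then 0 else if θ = 1 ∨ θ = T⁻¹ then 1 else p)

theorem natCard_lies [Fact p.Prime] [Finite Q] (h : SylowCondition p (Nat.card Q))
    (x : (S : SkewBraceOn Q) × S.Character p) :
    Nat.card {s : SkewBraceOn (CharExt p θ) // Lies s x} = fiberCard θ x.2.1 := by
  let := x.1.1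
  have := x.1.2
  rw [fiberCard, ← natCard_fiber h x.2.2]
  exact Nat.card_congr
    { toFun := fun s => ⟨s.1.1, s.1.2, s.2⟩
      invFun := fun s => ⟨⟨s.1, s.2.1⟩, s.2.2⟩
      left_inv := fun _ => rfl
      right_inv := fun _ => rfl }

/-- Summation over the skew braces on an extension. -/
theorem sum_skewBraceOn [Fact p.Prime] [Finite Q] (h : SylowCondition p (Nat.card Q))
    [Fintype (SkewBraceOn (CharExt p θ))] [Fintype (SkewBraceOn Q)]
    [∀ S : SkewBraceOn Q, Fintype (S.Character p)]
    (w : SkewBraceOn (CharExt p θ) → ℕ) (w' : (S : SkewBraceOn Q) → S.Character p → ℕ)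
    (hw : ∀ s x, Lies s x → w s = w' x.1 x.2) :
    ∑ s, w s = ∑ S : SkewBraceOn Q, ∑ T : S.Character p, fiberCard θ T.1 * w' S T := by
  classical
  choose f hf1 hf2 using existsUnique_lies (θ := θ) h
  have hf : ∀ s x, f s = x ↔ Lies s x := fun s x =>
    ⟨fun e => e ▸ hf1 s, fun hl => (hf2 s x hl).symm⟩
  rw [Finset.sum_sigma' Finset.univ (fun _ => Finset.univ)
    (fun (S : SkewBraceOn Q) (T : S.Character p) => fiberCard θ T.1 * w' S T),
    Finset.univ_sigma_univ, ← Finset.sum_fiberwise Finset.univ f]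
  refine Finset.sum_congr rfl fun x _ => ?_
  rw [Finset.sum_congr rfl (g := fun _ => w' x.1 x.2)
    (fun s hs => hw s x ((hf s x).1 (Finset.mem_filter.1 hs).2)), Finset.sum_const, smul_eq_mul,
    ← natCard_lies (θ := θ) h x, Nat.card_eq_fintype_card, Fintype.card_subtype]
  simp only [hf]

end CharExt
-- Characters of the middle skew brace
open IsSkewBrace

noncomputable instance MonoidHom.fintypeZModUnits {A : Type*} [Group A] [Finite A] (p : ℕ)
    [NeZero p] : Fintype (A →* (ZMod p)ˣ) := Fintype.ofFinite _

noncomputable instance SkewBraceOn.fintype {A : Type*} [Group A] [Finite A] :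
    Fintype (SkewBraceOn A) := Fintype.ofFinite _

noncomputable instance SkewBraceOn.Character.fintype {A : Type*} [Group A] [Finite A]
    (S : SkewBraceOn A) (p : ℕ) [NeZero p] : Fintype (S.Character p) := Fintype.ofFinite _

/-- Two groups are isomorphic. -/
abbrev GroupIso (A B : Type*) [Group A] [Group B] : Prop := Nonempty (A ≃* B)

theorem groupIso_congr_left {A A' : Type*} [Group A] [Group A'] (e : A ≃* A') (B : Type*) [Group B] :
    GroupIso A B ↔ GroupIso A' B :=
  ⟨fun ⟨f⟩ => ⟨e.symm.trans f⟩, fun ⟨f⟩ => ⟨e.trans f⟩⟩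

namespace CharExt

variable {q r : ℕ} {C : Type*} [Group C] {α : C →* (ZMod q)ˣ}

/-- The character is trivial on the kernel of the extension. -/
def TrivOnKernel (T : CharExt q α →* (ZMod r)ˣ) : Prop := ∀ z, T (inl α z) = 1

theorem trivOnKernel_iff {T : CharExt q α →* (ZMod r)ˣ} :
    TrivOnKernel T ↔ ∃ b : C →* (ZMod r)ˣ, b.comp (sndHom α) = T := by
  constructor
  · intro h
    refine ⟨T.comp (inr α), ?_⟩
    ext a
    conv_rhs => rw [eq_inl_mul_inr a, map_mul, h, one_mul]
    rfl
  · rintro ⟨b, rfl⟩ z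
    exact map_one b

theorem comp_sndHom_injective :
    Function.Injective (fun b : C →* (ZMod r)ˣ => b.comp (sndHom α)) := fun b b' e => by
  ext c
  have := DFunLike.congr_fun e (inr α c)
  exact congrArg Units.val this

theorem inl_injOn_of_not_triv [Fact q.Prime] {T : CharExt q α →* (ZMod r)ˣ}
    (hT : ¬ TrivOnKernel T) : Function.Injective (fun z => T (inl α z)) := by
  let f : Multiplicative (ZMod q) →* (ZMod r)ˣ :=
    { toFun := fun z => T (inl α z.toAdd)
      map_one' := map_one T
      map_mul' := fun z w => by rw [← map_mul, inl_mul]; rfl }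
  have hf : Function.Injective f := by
    rw [injective_iff_map_eq_one]
    by_contra! hc
    obtain ⟨z, hz, hz1⟩ := hc
    apply hT
    intro w
    have hz0 : z.toAdd ≠ 0 := hz1
    have : inl α w = inl α z.toAdd ^ (w * z.toAdd⁻¹).val := by
      rw [inl_pow, ZMod.natCast_val, ZMod.cast_id, inv_mul_cancel_right₀ hz0]
    rw [this, map_pow]
    change f z ^ _ = 1
    rw [hz, one_pow]
  exact hf

theorem eq_one_of_not_triv [Fact q.Prime] {T : CharExt q α →* (ZMod r)ˣ}
    (hT : ¬ TrivOnKernel T) {a : C →* (ZMod q)ˣ}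
    (h : ∀ c z, T (inl α (a c * z)) = T (inl α z)) : a = 1 := by
  ext c
  have := inl_injOn_of_not_triv hT (h c 1)
  simpa using this

/-- A character takes equal values at z and at its conjugate α(c)z, and it is injective on the
kernel of prime order. -/
theorem char_eq_one_of_not_triv [Fact q.Prime] {T : CharExt q α →* (ZMod r)ˣ}
    (hT : ¬ TrivOnKernel T) : α = 1 := by
  apply eq_one_of_not_triv hT
  intro c z
  have e : inr α c * inl α z = inl α (α c * z) * inr α c := by ext <;> simp
  have := congrArg T e
  rw [map_mul, map_mul, mul_comm] at this
  exact (mul_right_cancel this).symm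

theorem conj_char_eq_one_of_not_triv [Fact q.Prime] [AddGroup C] [AddGroup (CharExt q α)]
    {a : C →* (ZMod q)ˣ} (ho : IsOver α a) {T : CharExt q α →* (ZMod r)ˣ}
    (hadd : ∀ x y : CharExt q α, T (x + y) = T x * T y) (hT : ¬ TrivOnKernel T) : a = 1 := by
  apply eq_one_of_not_triv hT
  intro c z
  have := congrArg T (ho.add_inl (inr α c) z)
  rw [hadd, hadd, mul_comm] at this
  exact (mul_right_cancel this).symm

/-- When both characters are 1 the term with the parameter u in `exists_add_fst` vanishes, and
multiplication is all that remains. -/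
theorem add_eq_mul_of_isOver_one [Fact q.Prime] [Finite C] [AddGroup C]
    [AddGroup (CharExt q (1 : C →* (ZMod q)ˣ))] [IsSkewBrace (CharExt q (1 : C →* (ZMod q)ˣ))]
    (h : SylowCondition q (Nat.card C)) (hC : ∀ c c' : C, c + c' = c * c')
    (ho : IsOver (1 : C →* (ZMod q)ˣ) 1) (x y : CharExt q (1 : C →* (ZMod q)ˣ)) :
    x + y = x * y := by
  have hl : IsLeftType (1 : C →* (ZMod q)ˣ) 1 := by
    refine isLeftType_iff.2 ⟨ho, ?_⟩
    rcases ho.left_or_right h (fun _ _ => (mul_one _).symm) with h1 | h1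
    · exact h1
    · intro a z
      have := ho.add_inl a z
      rw [MonoidHom.one_apply, Units.val_one, one_mul] at this
      rw [← this, h1]
  have : IsSkewBrace C := isSkewBrace_of_isOver ho.add_snd
  obtain ⟨u, hu⟩ := hl.exists_add_fst h.coprime (fun _ _ => (mul_one _).symm)
  ext
  · rw [hu, mul_fst]
    simp
  · rw [ho.add_snd, hC, mul_snd]

/-- The additive group of a skew brace on which addition is multiplication. -/
def mulEquivOfAddEqMul {A : Type*} [Group A] [AddGroup A] (h : ∀ a b : A, a + b = a * b) :
    Multiplicative A ≃* A where
  toFun a := a.toAdd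
  invFun a := .ofAdd a
  left_inv _ := rfl
  right_inv _ := rfl
  map_mul' a b := h a.toAdd b.toAdd

section Count

variable [Fact q.Prime] [Fact r.Prime] [Finite C]

theorem exists_mulEquiv_of_isOver [AddGroup C] [IsSkewBrace C] [AddGroup (CharExt q α)]
    [IsSkewBrace (CharExt q α)] (h : SylowCondition q (Nat.card C))
    (hC : ∀ c c' : C, c + c' = c * c') {a : C →* (ZMod q)ˣ}
    (ha : ∀ c c' : C, a (c + c') = a c * a c') (ho : IsOver α a) :
    ∃ ψ : Multiplicative (CharExt q α) ≃* CharExt q a, ∀ x, (ψ x).snd = x.toAdd.snd := by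
  obtain ⟨ψ, hψ⟩ := ho.exists_mulEquiv h ha
  let e : CharExt q (addChar ha) ≃* CharExt q a := congrEquiv (mulEquivOfAddEqMul hC) rfl
  exact ⟨ψ.trans e, fun x => congrArg Multiplicative.toAdd (hψ x)⟩

-- Characters trivial on the kernel are inflated from C, hence automatically compatible with
-- addition. Any other forces α = a = 1; then addition is multiplication and every group character
-- is admitted.
open Classical in
theorem sum_character [AddGroup C] [IsSkewBrace C] [S : AddGroup (CharExt q α)]
    [hS : IsSkewBrace (CharExt q α)] (h : SylowCondition q (Nat.card C))
    (hC : ∀ c c' : C, c + c' = c * c') {a : C →* (ZMod q)ˣ}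
    (ha : ∀ c c' : C, a (c + c') = a c * a c') (ho : IsOver α a)
    (w : (CharExt q α →* (ZMod r)ˣ) → ℕ) (G : Type*) [Group G] :
    ∑ T : SkewBraceOn.Character ⟨S, hS⟩ r,
      w T.1 * (if GroupIso (CharExt r (addChar T.2)) G then 1 else 0) =
    (∑ b : C →* (ZMod r)ˣ, w (b.comp (sndHom α)) *
      (if GroupIso (CharExt r (b.comp (sndHom a))) G then 1 else 0)) +
    if α = 1 ∧ a = 1 then ∑ T : CharExt q α →* (ZMod r)ˣ with ¬ TrivOnKernel T,
      w T * (if GroupIso (CharExt r T) G then 1 else 0) else 0 := by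
  rw [← Finset.sum_filter_add_sum_filter_not Finset.univ
    (fun T : SkewBraceOn.Character ⟨S, hS⟩ r => TrivOnKernel T.1)]
  congr 1
  · symm
    have hadd : ∀ b : C →* (ZMod r)ˣ, ∀ x y, b.comp (sndHom α) (x + y) =
        b.comp (sndHom α) x * b.comp (sndHom α) y := fun b x y => by
      rw [← map_mul]
      change b (x + y).snd = b (x.snd * y.snd)
      rw [ho.add_snd, hC]
    refine Finset.sum_bij (fun b _ => ⟨b.comp (sndHom α), hadd b⟩) ?_ ?_ ?_ ?_
    · intro b _
      rw [Finset.mem_filter]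
      exact ⟨Finset.mem_univ _, trivOnKernel_iff.2 ⟨b, rfl⟩⟩
    · intro b _ b' _ e
      exact comp_sndHom_injective (congrArg Subtype.val e)
    · rintro ⟨T, hT⟩ hT'
      obtain ⟨b, rfl⟩ := trivOnKernel_iff.1 (Finset.mem_filter.1 hT').2
      exact ⟨b, Finset.mem_univ _, rfl⟩
    · intro b _
      obtain ⟨ψ, hψ⟩ := exists_mulEquiv_of_isOver h hC ha ho
      have e : CharExt r (addChar (hadd b)) ≃* CharExt r (b.comp (sndHom a)) :=
        congrEquiv ψ (by
          refine MonoidHom.ext fun x => Units.ext ?_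
          change ((b (ψ x).snd : (ZMod r)ˣ) : ZMod r) = b x.toAdd.snd
          rw [hψ])
      rw [groupIso_congr_left e]
  · split_ifs with h1
    · obtain ⟨rfl, rfl⟩ := h1
      have hm := add_eq_mul_of_isOver_one h hC ho
      refine Finset.sum_bij (fun T _ => T.1) ?_ ?_ ?_ ?_
      · intro T hT
        simpa using hT
      · intro T _ T' _ e
        exact Subtype.ext e
      · intro T hT
        refine ⟨⟨T, fun x y => ?_⟩, ?_, rfl⟩
        · exact (congrArg T (hm x y)).trans (map_mul T x y)
        · simpa using hT
      · intro T _
        have e : CharExt r (addChar T.2) ≃* CharExt r T.1 :=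
          congrEquiv (mulEquivOfAddEqMul hm) rfl
        rw [groupIso_congr_left e]
    · refine Finset.sum_eq_zero fun T hT => absurd ?_ h1
      have hT' := (Finset.mem_filter.1 hT).2
      exact ⟨char_eq_one_of_not_triv hT', conj_char_eq_one_of_not_triv ho T.2 hT'⟩

end Count

end CharExt
-- The counting formula for an iterated extension
open IsSkewBrace

namespace CharExt

/-- The skew brace on which addition is multiplication. -/
def trivialSkewBrace (C : Type*) [Group C] : SkewBraceOn C :=
  ⟨inferInstanceAs (AddGroup (Additive C)),
    @IsSkewBrace.mk C _ (inferInstanceAs (AddGroup (Additive C))) fun a b c => by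
      change a * (b * c) = (a * b) / a * (a * c)
      rw [← mul_assoc, ← mul_assoc, div_mul_cancel]⟩

variable {p q r : ℕ} {C : Type*} [Group C] {α : C →* (ZMod q)ˣ}

open Classical in
/-- The number of skew braces of a given type on an iterated extension. -/
theorem natCard_skewBraceOfType [Fact p.Prime] [Fact q.Prime] [Fact r.Prime] (hC : Nat.card C = p)
    [Finite C] (h : SylowCondition q (Nat.card C))
    (h' : SylowCondition r (Nat.card (CharExt q α))) (θ : CharExt q α →* (ZMod r)ˣ)
    (G : Type*) [Group G] :
    Nat.card (SkewBraceOfType (CharExt r θ) G) =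
      (∑ a : C →* (ZMod q)ˣ, fiberCard α a *
        ∑ b : C →* (ZMod r)ˣ, fiberCard θ (b.comp (sndHom α)) *
          (if GroupIso (CharExt r (b.comp (sndHom a))) G then 1 else 0)) +
      if α = 1 then ∑ T : CharExt q α →* (ZMod r)ˣ with ¬ TrivOnKernel T,
        fiberCard θ T * (if GroupIso (CharExt r T) G then 1 else 0) else 0 := by
  have hp : p.Prime := Fact.out
  let w : SkewBraceOn (CharExt r θ) → ℕ := fun s =>
    if @GroupIso (Multiplicative (CharExt r θ)) G (@Multiplicative.group _ s.1) _ then 1 else 0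
  let w' : (S : SkewBraceOn (CharExt q α)) → S.Character r → ℕ := fun S T =>
    if @GroupIso (@CharExt r (Multiplicative (CharExt q α)) (@Multiplicative.group _ S.1)
      (@addChar r _ _ S.1 S.2 T.1 T.2)) G (@instGroup r _ (@Multiplicative.group _ S.1) _) _
    then 1 else 0
  let w'' : (C →* (ZMod q)ˣ) → ℕ := fun a =>
    (∑ b : C →* (ZMod r)ˣ, fiberCard θ (b.comp (sndHom α)) *
      (if GroupIso (CharExt r (b.comp (sndHom a))) G then 1 else 0)) +
    if α = 1 ∧ a = 1 then ∑ T : CharExt q α →* (ZMod r)ˣ with ¬ TrivOnKernel T,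
      fiberCard θ T * (if GroupIso (CharExt r T) G then 1 else 0) else 0
  have h0 : Nat.card (SkewBraceOfType (CharExt r θ) G) = ∑ s, w s := by
    rw [Finset.sum_boole, Nat.cast_id, ← Fintype.card_subtype, ← Nat.card_eq_fintype_card]
    exact Nat.card_congr
      { toFun := fun s => ⟨⟨s.1, s.2.1⟩, s.2.2⟩
        invFun := fun s => ⟨s.1.1, s.1.2, s.2⟩
        left_inv := fun _ => rfl
        right_inv := fun _ => rfl }
  have h1 : ∑ s, w s = ∑ S, ∑ T, fiberCard θ T.1 * w' S T := by
    refine sum_skewBraceOn h' w w' ?_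
    rintro ⟨s, hs⟩ ⟨⟨S, hS⟩, ⟨T, hT⟩⟩ hl
    obtain ⟨ψ, -⟩ := @IsOver.exists_mulEquiv r _ _ θ _ _ S hS s hs h' T hT hl
    change (if _ then 1 else 0) = (if _ then 1 else 0)
    rw [groupIso_congr_left ψ]
  have h2 : ∑ S, ∑ T, fiberCard θ T.1 * w' S T =
      ∑ S : SkewBraceOn C, ∑ a : S.Character q, fiberCard α a.1 * w'' a.1 := by
    refine sum_skewBraceOn h (fun S => ∑ T : S.Character r, fiberCard θ T.1 * w' S T)
      (fun S a => w'' a.1) ?_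
    rintro ⟨s, hs⟩ ⟨⟨S, hS⟩, ⟨a, ha⟩⟩ hl
    exact sum_character h (fun c c' => (mul_eq_add_of_card_prime hp hC c c').symm) ha hl _ G
  have h3 : ∑ S : SkewBraceOn C, ∑ a : S.Character q, fiberCard α a.1 * w'' a.1 =
      ∑ a, fiberCard α a * w'' a := by
    have : Subsingleton (SkewBraceOn C) := by
      refine ⟨fun S S' => Subtype.ext (AddGroup.ext ?_)⟩
      funext a b
      exact (@mul_eq_add_of_card_prime C _ S.1 S.2 p hp hC a b).symm.trans
        (@mul_eq_add_of_card_prime C _ S'.1 S'.2 p hp hC a b)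
    rw [Fintype.sum_subsingleton _ (trivialSkewBrace C)]
    refine Fintype.sum_bijective Subtype.val ⟨Subtype.val_injective, fun a => ?_⟩ _ _ fun _ => rfl
    exact ⟨⟨a, fun x y => map_mul a x y⟩, rfl⟩
  rw [h0, h1, h2, h3]
  simp only [w'', mul_add, Finset.sum_add_distrib]
  congr 1
  -- Only a = 1 contributes to the extra term, with weight `fiberCard 1 1`, which is 1.
  split_ifs with hα
  · subst hα
    simp [fiberCard]
  · simp [hα]

end CharExt
-- Isomorphism classes of the iterated extensions
open IsSkewBrace

theorem MonoidHom.injective_of_prime_card {C H : Type*} [Group C] [Group H] {p : ℕ}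
    [Fact p.Prime] (hC : Nat.card C = p) {f : C →* H} (hf : f ≠ 1) : Function.Injective f := by
  have : Fact (Nat.card C).Prime := by rw [hC]; infer_instance
  rw [← MonoidHom.ker_eq_bot_iff]
  refine (Subgroup.eq_bot_or_eq_top_of_prime_card f.ker).resolve_right fun h => hf ?_
  ext x
  have : x ∈ f.ker := h ▸ Subgroup.mem_top x
  exact this

theorem eq_one_of_pow_of_pow {G : Type*} [Group G] {x : G} {m n : ℕ} (h : Nat.Coprime m n)
    (hm : x ^ m = 1) (hn : x ^ n = 1) : x = 1 :=
  orderOf_eq_one_iff.1 (Nat.eq_one_of_dvd_coprimes h (orderOf_dvd_of_pow_eq_one hm)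
    (orderOf_dvd_of_pow_eq_one hn))

namespace CharExt

theorem groupIso_iff {p : ℕ} [Fact p.Prime] {Q Q' : Type*} [Group Q] [Group Q'] [Finite Q]
    [Finite Q'] (hQ : p.Coprime (Nat.card Q)) {θ : Q →* (ZMod p)ˣ} {θ' : Q' →* (ZMod p)ˣ} :
    GroupIso (CharExt p θ) (CharExt p θ') ↔ ∃ ψ : Q ≃* Q', θ'.comp ψ.toMonoidHom = θ := by
  constructor
  · rintro ⟨φ⟩
    obtain ⟨ψ, hψ, -⟩ := exists_of_mulEquiv hQ φ
    exact ⟨ψ, hψ⟩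
  · rintro ⟨ψ, hψ⟩
    exact ⟨congrEquiv ψ hψ⟩

variable {q r : ℕ} [Fact q.Prime] [Fact r.Prime] {C C' : Type*} [Group C] [Finite C] [Group C']
  [Finite C']

section Models

variable {a : C →* (ZMod q)ˣ} {a' : C' →* (ZMod q)ˣ}

theorem groupIso_inflation_iff (hq : q.Coprime (Nat.card C))
    (hr : r.Coprime (Nat.card (CharExt q a))) {b : C →* (ZMod r)ˣ} {b' : C' →* (ZMod r)ˣ} :
    GroupIso (CharExt r (b.comp (sndHom a))) (CharExt r (b'.comp (sndHom a'))) ↔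
      ∃ ψ : C ≃* C', a'.comp ψ.toMonoidHom = a ∧ b'.comp ψ.toMonoidHom = b := by
  rw [groupIso_iff hr]
  constructor
  · rintro ⟨φ, hφ⟩
    obtain ⟨ψ, hψ, hψ'⟩ := exists_of_mulEquiv hq φ
    refine ⟨ψ, hψ, MonoidHom.ext fun c => ?_⟩
    have := DFunLike.congr_fun hφ (inr a c)
    exact (congrArg b' (hψ' (inr a c))).trans this
  · rintro ⟨ψ, hψ, hψ'⟩
    exact ⟨congrEquiv ψ hψ, MonoidHom.ext fun x => DFunLike.congr_fun hψ' x.snd⟩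

/-- Both kernels are characteristic, so triviality on the subgroup of order q is an isomorphism
invariant. It separates the first four types from the last two. -/
theorem trivOnKernel_of_groupIso (hq : q.Coprime (Nat.card C))
    (hr : r.Coprime (Nat.card (CharExt q a))) {T : CharExt q a →* (ZMod r)ˣ}
    {T' : CharExt q a' →* (ZMod r)ˣ} (e : GroupIso (CharExt r T) (CharExt r T'))
    (hT' : TrivOnKernel T') : TrivOnKernel T := by
  obtain ⟨φ, rfl⟩ := (groupIso_iff hr).1 e
  obtain ⟨ψ, -, hψ⟩ := exists_of_mulEquiv hq φ
  intro z
  have h1 : (φ (inl a z)).snd = 1 := by rw [← hψ, inl_snd, map_one]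
  change T' (φ (inl a z)) = 1
  rw [eq_inl_of_snd h1, hT']

end Models

section Direct

variable {p : ℕ} [Fact p.Prime]

/-- The inclusion of the kernel as a homomorphism. -/
def inlHom (a : C →* (ZMod q)ˣ) : Multiplicative (ZMod q) →* CharExt q a where
  toFun z := inl a z.toAdd
  map_one' := rfl
  map_mul' z w := (inl_mul z.toAdd w.toAdd).symm

omit [Finite C] in
theorem trivOnKernel_iff_comp {a : C →* (ZMod q)ˣ} {T : CharExt q a →* (ZMod r)ˣ} :
    TrivOnKernel T ↔ T.comp (inlHom a) = 1 :=
  ⟨fun h => MonoidHom.ext fun z => h z.toAdd, fun h z => DFunLike.congr_fun h (.ofAdd z)⟩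

variable (q r C) in
/-- A character of a direct product is a pair of characters. -/
def charEquiv :
    (CharExt q (1 : C →* (ZMod q)ˣ) →* (ZMod r)ˣ) ≃
      (Multiplicative (ZMod q) →* (ZMod r)ˣ) × (C →* (ZMod r)ˣ) where
  toFun T := (T.comp (inlHom 1), T.comp (inr 1))
  invFun f :=
    { toFun := fun x => f.1 (.ofAdd x.fst) * f.2 x.snd
      map_one' := by rw [one_fst, one_snd, ofAdd_zero, map_one, map_one, one_mul]
      map_mul' := fun x y => by
        rw [mul_fst, mul_snd, MonoidHom.one_apply, Units.val_one, one_mul, ofAdd_add, map_mul f.1,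
          map_mul f.2, mul_mul_mul_comm] }
  left_inv T := by
    ext x
    conv_rhs => rw [eq_inl_mul_inr x, map_mul]
    rfl
  right_inv f := by
    refine Prod.ext (MonoidHom.ext fun z => ?_) (MonoidHom.ext fun c => ?_)
    · change f.1 z * f.2 1 = f.1 z
      rw [map_one, mul_one]
    · change f.1 1 * f.2 c = f.2 c
      rw [map_one, one_mul]

variable {T T' : CharExt q (1 : C →* (ZMod q)ˣ) →* (ZMod r)ˣ}

omit [Finite C] in
theorem apply_inl_pow (z : ZMod q) : T (inl 1 z) ^ q = 1 := by
  rw [← map_pow, inl_pow, CharP.cast_eq_zero, zero_mul, inl_zero, map_one]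

-- Expresses triviality on C without reference to the decomposition, hence in a form invariant under
-- automorphisms.
omit [Finite C] in
theorem comp_inr_eq_one_iff (hq : q.Coprime (Nat.card C)) :
    T.comp (inr 1) = 1 ↔ ∀ x, T x ^ q = 1 := by
  constructor
  · intro h x
    have : T (inr 1 x.snd) = 1 := DFunLike.congr_fun h x.snd
    rw [eq_inl_mul_inr x, map_mul, this, mul_one, apply_inl_pow]
  · intro h
    refine MonoidHom.ext fun c => eq_one_of_pow_of_pow hq (h (inr 1 c)) ?_
    rw [← map_pow, pow_card_eq_one', map_one]

omit [Finite C] in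
theorem injective_of_not_triv (hC : Nat.card C = p) (hq : q.Coprime (Nat.card C))
    (hT : ¬ TrivOnKernel T) (hT' : T.comp (inr 1) ≠ 1) : Function.Injective T := by
  rw [injective_iff_map_eq_one]
  intro x hx
  have h1 : T (inl 1 x.fst) * T (inr 1 x.snd) = 1 := by
    rw [← map_mul, ← eq_inl_mul_inr, hx]
  have h2 : T (inr 1 x.snd) = 1 := by
    refine eq_one_of_pow_of_pow hq ?_
      (by rw [← map_pow, ← map_pow, pow_card_eq_one', map_one, map_one])
    have := congrArg (· ^ q) h1
    simp only [mul_pow, apply_inl_pow, one_mul, one_pow] at this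
    exact this
  have h3 : x.snd = 1 :=
    (injective_iff_map_eq_one _).1 (MonoidHom.injective_of_prime_card hC hT') _ h2
  rw [h2, mul_one] at h1
  have h4 : x.fst = 0 := inl_injOn_of_not_triv hT (h1.trans (map_one T).symm)
  ext
  · rw [h4]; rfl
  · rw [h3]; rfl

/-- If both characters are trivial on C, an automorphism of the factor of order q relates them.
Otherwise both are injective, and injective characters of a finite group differ by an automorphism.
-/
theorem groupIso_direct_iff (hC : Nat.card C = p) (hq : q.Coprime (Nat.card C))
    (hr : r.Coprime (Nat.card (CharExt q (1 : C →* (ZMod q)ˣ)))) (hT : ¬ TrivOnKernel T)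
    (hT' : ¬ TrivOnKernel T') :
    GroupIso (CharExt r T) (CharExt r T') ↔ (T.comp (inr 1) = 1 ↔ T'.comp (inr 1) = 1) := by
  rw [groupIso_iff hr]
  constructor
  · rintro ⟨φ, rfl⟩
    rw [comp_inr_eq_one_iff hq, comp_inr_eq_one_iff hq]
    exact ⟨fun h x => by simpa using h (φ.symm x), fun h x => h (φ x)⟩
  · intro h
    by_cases h1 : T.comp (inr 1) = 1
    · have h2 := h.1 h1
      have hi : ∀ {S : CharExt q (1 : C →* (ZMod q)ˣ) →* (ZMod r)ˣ}, ¬ TrivOnKernel S →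
          Function.Injective (S.comp (inlHom 1)) := fun hS => inl_injOn_of_not_triv hS
      obtain ⟨ψ, hψ⟩ := exists_mulAut_comp_eq (hi hT) (hi hT')
      let φ : CharExt q (1 : C →* (ZMod q)ˣ) ≃* CharExt q (1 : C →* (ZMod q)ˣ) :=
        { toFun := fun x => ⟨(ψ (.ofAdd x.fst)).toAdd, x.snd⟩
          invFun := fun x => ⟨(ψ.symm (.ofAdd x.fst)).toAdd, x.snd⟩
          left_inv := fun x => by simp
          right_inv := fun x => by simp
          map_mul' := fun x y => by ext <;> simp }
      refine ⟨φ, (charEquiv q r C).injective (Prod.ext ?_ ?_)⟩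
      · exact (MonoidHom.ext fun z => DFunLike.congr_fun hψ z)
      · refine Eq.trans (MonoidHom.ext fun c => ?_) (h2.trans h1.symm)
        change T' ⟨(ψ 1).toAdd, c⟩ = T' (inr 1 c)
        rw [map_one]
        rfl
    · exact exists_mulAut_comp_eq (injective_of_not_triv hC hq hT h1)
        (injective_of_not_triv hC hq hT' fun h2 => h1 (h.2 h2))

end Direct

end CharExt
-- Character sums of `fiberCard` and orbits of automorphisms
open IsSkewBrace

/-- The multiplicative cyclic group of order `p`. -/
abbrev Cyc (p : ℕ) : Type := Multiplicative (ZMod p)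

theorem natCard_cyc (p : ℕ) : Nat.card (Cyc p) = p := Nat.card_zmod p

theorem card_cyc_char {p q : ℕ} [Fact p.Prime] [Fact q.Prime] (h : q ≡ 1 [MOD p]) :
    Fintype.card (Cyc p →* (ZMod q)ˣ) = p := by
  have hq : q.Prime := Fact.out
  have : NeZero (q - 1) := ⟨by have := hq.two_le; omega⟩
  have : HasEnoughRootsOfUnity (ZMod q) (Nat.card (Cyc p)) := by
    rw [natCard_cyc]
    exact HasEnoughRootsOfUnity.of_dvd _ ((Nat.modEq_iff_dvd' hq.one_le).1 h.symm)
  obtain ⟨e⟩ := IsCyclic.monoidHom_equiv_self (Cyc p) (ZMod q)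
  rw [← Nat.card_eq_fintype_card, Nat.card_congr e.toEquiv, natCard_cyc]

open Classical in
theorem card_cyc_char_ne_one {p q : ℕ} [Fact p.Prime] [Fact q.Prime] (h : q ≡ 1 [MOD p]) :
    ((Finset.univ.filter fun a : Cyc p →* (ZMod q)ˣ => a ≠ 1).card : ℤ) = p - 1 := by
  have hp : p.Prime := Fact.out
  rw [Finset.filter_ne', Finset.card_erase_of_mem (Finset.mem_univ _), Finset.card_univ,
    card_cyc_char h, Nat.cast_sub hp.one_le, Nat.cast_one]

namespace CharExt

section FiberCard

variable {p : ℕ} {Q : Type*} [Group Q] {θ T : Q →* (ZMod p)ˣ}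

theorem fiberCard_one_right (θ : Q →* (ZMod p)ˣ) [Decidable (θ = 1)] :
    fiberCard θ 1 = if θ = 1 then 1 else p := by
  simp [fiberCard]

theorem fiberCard_one_left (hT : T ≠ 1) : fiberCard 1 T = 2 := by
  simp [fiberCard, hT]

open Classical in
theorem fiberCard_of_ne (hθ : θ ≠ 1) (hT : T ≠ 1) : (fiberCard θ T : ℤ) =
    2 * p - (p - 1) * ((if θ = T then 1 else 0) + (if θ⁻¹ = T then 1 else 0)) := by
  have h : θ = T⁻¹ ↔ θ⁻¹ = T := 
    ⟨fun e => e ▸ MonoidHom.ext fun x => inv_inv (T x),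
      fun e => e ▸ MonoidHom.ext fun x => (inv_inv (θ x)).symm⟩
  simp only [fiberCard, hθ, hT, h, false_or, if_false]
  split_ifs <;> push_cast <;> ring

theorem fiberCard_inflation {q : ℕ} {α : Q →* (ZMod q)ˣ} (β b : Q →* (ZMod p)ˣ) :
    fiberCard (β.comp (sndHom α)) (b.comp (sndHom α)) = fiberCard β b := by
  have h : ∀ f g : Q →* (ZMod p)ˣ, f.comp (sndHom α) = g.comp (sndHom α) ↔ f = g := fun f g =>
    comp_sndHom_injective.eq_iff
  have h1 : ∀ f : Q →* (ZMod p)ˣ, f.comp (sndHom α) = 1 ↔ f = 1 := fun f => by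
    rw [← h, MonoidHom.one_comp]
  have h2 : (b.comp (sndHom α))⁻¹ = b⁻¹.comp (sndHom α) := rfl
  unfold fiberCard
  rw [h1, h1, h, h2, h]

open Classical in
theorem sum_fiberCard_one (S : Finset (Q →* (ZMod p)ˣ)) (h1 : 1 ∉ S) :
    ∑ T ∈ S, (fiberCard (1 : Q →* (ZMod p)ˣ) T : ℤ) = 2 * S.card := by
  rw [Finset.sum_congr rfl (g := fun _ => 2)
    (fun T hT => by rw [fiberCard_one_left (fun e => h1 (e ▸ hT))]; rfl)]
  simp [mul_comm]

-- The indicators of θ and of θ⁻¹ contribute equally because S is stable under inversion.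
open Classical in
theorem sum_fiberCard (S : Finset (Q →* (ZMod p)ˣ)) (h1 : 1 ∉ S) (hinv : ∀ T, T⁻¹ ∈ S ↔ T ∈ S)
    (hθ : θ ≠ 1) : ∑ T ∈ S, (fiberCard θ T : ℤ) =
      2 * p * S.card - if θ ∈ S then 2 * ((p : ℤ) - 1) else 0 := by
  rw [Finset.sum_congr rfl
    (fun T hT => fiberCard_of_ne hθ (fun e => h1 (e ▸ hT)))]
  rw [Finset.sum_sub_distrib, Finset.sum_const, ← Finset.mul_sum, Finset.sum_add_distrib,
    Finset.sum_ite_eq, Finset.sum_ite_eq, if_congr (hinv θ) rfl rfl, nsmul_eq_mul]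
  split_ifs <;> ring

end FiberCard

section Orbits

variable {p q r : ℕ} [Fact p.Prime] [Fact q.Prime] [Fact r.Prime]

noncomputable instance : Fintype (Cyc p ≃* Cyc p) :=
  have : Finite (Cyc p ≃* Cyc p) := DFunLike.finite _
  Fintype.ofFinite _

theorem comp_injective {β : Cyc p →* (ZMod r)ˣ} (hβ : β ≠ 1) :
    Function.Injective (fun ψ : Cyc p ≃* Cyc p => β.comp ψ.toMonoidHom) := fun _ _ e =>
  MulEquiv.ext fun c =>
    MonoidHom.injective_of_prime_card (natCard_cyc p) hβ (DFunLike.congr_fun e c)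

theorem comp_eq_one_iff {β : Cyc p →* (ZMod r)ˣ} (ψ : Cyc p ≃* Cyc p) :
    β.comp ψ.toMonoidHom = 1 ↔ β = 1 := by
  constructor
  · intro h
    refine MonoidHom.ext fun c => ?_
    have := DFunLike.congr_fun h (ψ.symm c)
    simpa using this
  · rintro rfl
    rfl

theorem exists_comp_eq {β β' : Cyc p →* (ZMod r)ˣ} (hβ : β ≠ 1) (hβ' : β' ≠ 1) :
    ∃ ψ : Cyc p ≃* Cyc p, β'.comp ψ.toMonoidHom = β :=
  exists_mulAut_comp_eq (MonoidHom.injective_of_prime_card (natCard_cyc p) hβ)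
    (MonoidHom.injective_of_prime_card (natCard_cyc p) hβ')

open Classical in
theorem sum_mulAut {β' : Cyc p →* (ZMod r)ˣ} (hβ' : β' ≠ 1) (F : (Cyc p →* (ZMod r)ˣ) → ℤ) :
    ∑ ψ : Cyc p ≃* Cyc p, F (β'.comp ψ.toMonoidHom) = ∑ b with b ≠ 1, F b := by
  refine Finset.sum_bij (fun ψ _ => β'.comp ψ.toMonoidHom) ?_ ?_ ?_ ?_
  · intro ψ _
    exact Finset.mem_filter.2 ⟨Finset.mem_univ _, fun e => hβ' ((comp_eq_one_iff ψ).1 e)⟩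
  · intro ψ _ ψ' _ e
    exact comp_injective hβ' e
  · intro b hb
    obtain ⟨ψ, hψ⟩ := exists_comp_eq (Finset.mem_filter.1 hb).2 hβ'
    exact ⟨ψ, Finset.mem_univ _, hψ⟩
  · intro ψ _
    rfl

-- Automorphisms act freely on pairs with a nontrivial member, so a sum over an orbit is a sum over
-- the automorphism group.
open Classical in
theorem sum_orbit {α' : Cyc p →* (ZMod q)ˣ} {β' : Cyc p →* (ZMod r)ˣ} (h : α' ≠ 1 ∨ β' ≠ 1)
    (F : (Cyc p →* (ZMod q)ˣ) → (Cyc p →* (ZMod r)ˣ) → ℤ) :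
    ∑ a, ∑ b, (if ∃ ψ : Cyc p ≃* Cyc p, α'.comp ψ.toMonoidHom = a ∧ β'.comp ψ.toMonoidHom = b
      then F a b else 0) =
    ∑ ψ : Cyc p ≃* Cyc p, F (α'.comp ψ.toMonoidHom) (β'.comp ψ.toMonoidHom) := by
  rw [← Fintype.sum_prod_type' (fun a b => if ∃ ψ : Cyc p ≃* Cyc p, α'.comp ψ.toMonoidHom = a ∧
    β'.comp ψ.toMonoidHom = b then F a b else 0), ← Finset.sum_filter]
  symm
  refine Finset.sum_bij (fun ψ _ => (α'.comp ψ.toMonoidHom, β'.comp ψ.toMonoidHom)) ?_ ?_ ?_ ?_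
  · intro ψ _
    exact Finset.mem_filter.2 ⟨Finset.mem_univ _, ψ, rfl, rfl⟩
  · intro ψ _ ψ' _ e
    rcases h with h | h
    · exact comp_injective h (congrArg Prod.fst e)
    · exact comp_injective h (congrArg Prod.snd e)
  · rintro ⟨a, b⟩ hb
    obtain ⟨ψ, rfl, rfl⟩ := (Finset.mem_filter.1 hb).2
    exact ⟨ψ, Finset.mem_univ _, rfl⟩
  · intro ψ _
    rfl

end Orbits

end CharExt
-- Chains of primes, and the count for each kind of type
open IsSkewBrace

/-- `p < q < r` and each of the numbers is congruent to `1` modulo the smaller ones. -/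
structure PrimeChain (p q r : ℕ) : Prop where
  lt₁ : p < q
  lt₂ : q < r
  modEq₁ : q ≡ 1 [MOD p]
  modEq₂ : r ≡ 1 [MOD p]
  modEq₃ : r ≡ 1 [MOD q]

namespace PrimeChain

variable {p q r : ℕ} [hp : Fact p.Prime] [hq : Fact q.Prime] [hr : Fact r.Prime]
  (h : PrimeChain p q r)

omit hr in
include h in
theorem coprime₁ : Nat.Coprime q p := (Nat.coprime_primes hq.1 hp.1).2 h.lt₁.ne'

include h in
theorem coprime₂ : Nat.Coprime r (q * p) :=
  Nat.Coprime.mul_right ((Nat.coprime_primes hr.1 hq.1).2 h.lt₂.ne')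
    ((Nat.coprime_primes hr.1 hp.1).2 (h.lt₁.trans h.lt₂).ne')

omit hr in
include h in
theorem sylow₁ : SylowCondition q p := by
  refine ⟨h.coprime₁, fun d hd hd' => ?_⟩
  have hlt : d < q := (Nat.le_of_dvd hp.1.pos hd).trans_lt h.lt₁
  exact Nat.ModEq.eq_of_lt_of_lt hd' hlt hq.1.one_lt

-- A divisor d ≥ r of qp must be q·d₂ with d₂ ≤ p. Writing d = 1 + rl and r = 1 + qk gives q ∣ l +
-- 1, so d ≥ 1 + r(q − 1), which exceeds qp.
include h in
theorem sylow₂ : SylowCondition r (q * p) := by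
  refine ⟨h.coprime₂, fun d hd hd' => ?_⟩
  by_cases hlt : d < r
  · exact Nat.ModEq.eq_of_lt_of_lt hd' hlt hr.1.one_lt
  exfalso
  obtain ⟨d₁, d₂, h1, h2, rfl⟩ := (Nat.dvd_mul.1 hd)
  obtain rfl : d₁ = q := by
    refine ((Nat.dvd_prime hq.1).1 h1).resolve_left ?_
    rintro rfl
    have := Nat.le_of_dvd hp.1.pos h2
    have := h.lt₁
    have := h.lt₂
    omega
  have h3 : d₂ ≤ p := Nat.le_of_dvd hp.1.pos h2
  have hpos : 0 < d₂ := Nat.pos_of_dvd_of_pos h2 hp.1.pos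
  have hge : 1 ≤ d₁ * d₂ := Nat.mul_pos hq.1.pos hpos
  obtain ⟨l, hl⟩ := (Nat.modEq_iff_dvd' hge).1 hd'.symm
  obtain ⟨k, hk⟩ := (Nat.modEq_iff_dvd' hr.1.one_le).1 h.modEq₃.symm
  have e1 : d₁ * d₂ = 1 + r * l := by omega
  have e2 : r = 1 + d₁ * k := by have := hr.1.one_le; omega
  have h4 : d₁ ∣ l + 1 := by
    have : d₁ * d₂ = (l + 1) + d₁ * (k * l) := by rw [e1, e2]; ring
    exact (Nat.dvd_add_left (Dvd.intro _ rfl)).1 (this ▸ Dvd.intro _ rfl)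
  have h5 : d₁ ≤ l + 1 := Nat.le_of_dvd (Nat.succ_pos _) h4
  have h6 := h.lt₁
  have h7 := h.lt₂
  nlinarith

end PrimeChain

namespace CharExt

variable {p q r : ℕ} [hp : Fact p.Prime] [hq : Fact q.Prime] [hr : Fact r.Prime]

theorem natCard_cyc_ext {α : Cyc p →* (ZMod q)ˣ} : Nat.card (CharExt q α) = q * p := by
  rw [natCard, natCard_cyc]

section Columns

variable (h : PrimeChain p q r)
include h

variable {α α' : Cyc p →* (ZMod q)ˣ} (θ : CharExt q α →* (ZMod r)ˣ)

-- The extra term of the counting formula vanishes because inflated types are trivial on the kernel;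
-- in the main sum only the orbit of (α′, β′) survives.
open Classical in
theorem natCard_inflation_type {β' : Cyc p →* (ZMod r)ˣ} :
    (Nat.card (SkewBraceOfType (CharExt r θ) (CharExt r (β'.comp (sndHom α')))) : ℤ) =
      ∑ a, ∑ b, (if ∃ ψ : Cyc p ≃* Cyc p, α'.comp ψ.toMonoidHom = a ∧ β'.comp ψ.toMonoidHom = b
        then (fiberCard α a : ℤ) * fiberCard θ (b.comp (sndHom α)) else 0) := by
  have h1 : q.Coprime (Nat.card (Cyc p)) := by rw [natCard_cyc]; exact h.coprime₁
  have h2 : ∀ a : Cyc p →* (ZMod q)ˣ, r.Coprime (Nat.card (CharExt q a)) := fun a => by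
    rw [natCard_cyc_ext]; exact h.coprime₂
  have hnat := natCard_skewBraceOfType (natCard_cyc p) (by rw [natCard_cyc]; exact h.sylow₁)
    (by rw [natCard_cyc_ext]; exact h.sylow₂) θ (CharExt r (β'.comp (sndHom α')))
  have hz : ∑ T : CharExt q α →* (ZMod r)ˣ with ¬ TrivOnKernel T,
      fiberCard θ T * (if GroupIso (CharExt r T) (CharExt r (β'.comp (sndHom α')))
        then 1 else 0) = 0 := by
    refine Finset.sum_eq_zero fun T hT => ?_
    rw [if_neg, mul_zero]
    exact fun e => (Finset.mem_filter.1 hT).2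
      (trivOnKernel_of_groupIso h1 (h2 _) e (trivOnKernel_iff.2 ⟨β', rfl⟩))
  rw [hz, ite_self, add_zero] at hnat
  rw [hnat]
  push_cast
  refine Finset.sum_congr rfl fun a _ => ?_
  rw [Finset.mul_sum]
  refine Finset.sum_congr rfl fun b _ => ?_
  rw [if_congr (groupIso_inflation_iff h1 (h2 a)) rfl rfl]
  split_ifs <;> ring

theorem natCard_type_one : (Nat.card (SkewBraceOfType (CharExt r θ)
    (CharExt r (1 : CharExt q (1 : Cyc p →* (ZMod q)ˣ) →* (ZMod r)ˣ))) : ℤ) =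
      fiberCard α 1 * fiberCard θ 1 := by
  classical
  have := natCard_inflation_type h θ (α' := 1) (β' := 1)
  rw [MonoidHom.one_comp] at this
  rw [this, Finset.sum_eq_single 1, Finset.sum_eq_single 1]
  · rw [if_pos ⟨MulEquiv.refl _, rfl, rfl⟩, MonoidHom.one_comp]
  · intro b _ hb
    rw [if_neg]
    rintro ⟨ψ, -, e⟩
    exact hb e.symm
  · simp
  · intro a _ ha
    refine Finset.sum_eq_zero fun b _ => ?_
    rw [if_neg]
    rintro ⟨ψ, e, -⟩
    exact ha e.symm
  · simp

theorem natCard_type_orbit {β' : Cyc p →* (ZMod r)ˣ} (h' : α' ≠ 1 ∨ β' ≠ 1) :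
    (Nat.card (SkewBraceOfType (CharExt r θ) (CharExt r (β'.comp (sndHom α')))) : ℤ) =
      ∑ ψ : Cyc p ≃* Cyc p, (fiberCard α (α'.comp ψ.toMonoidHom) : ℤ) *
        fiberCard θ ((β'.comp ψ.toMonoidHom).comp (sndHom α)) := by
  classical
  rw [natCard_inflation_type h θ, sum_orbit h'
    (fun a b => (fiberCard α a : ℤ) * fiberCard θ (b.comp (sndHom α)))]

open Classical in
theorem natCard_type_left (hα' : α' ≠ 1) :
    (Nat.card (SkewBraceOfType (CharExt r θ) (CharExt r (1 : CharExt q α' →* (ZMod r)ˣ))) : ℤ) =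
      (∑ a with a ≠ 1, (fiberCard α a : ℤ)) * fiberCard θ 1 := by
  have := natCard_type_orbit h θ (α' := α') (β' := 1) (Or.inl hα')
  rw [MonoidHom.one_comp] at this
  rw [this, ← sum_mulAut hα' (fun a => (fiberCard α a : ℤ)), Finset.sum_mul]
  rfl

open Classical in
theorem natCard_type_right {β' : Cyc p →* (ZMod r)ˣ} (hβ' : β' ≠ 1) :
    (Nat.card (SkewBraceOfType (CharExt r θ)
      (CharExt r (β'.comp (sndHom (1 : Cyc p →* (ZMod q)ˣ))))) : ℤ) =
      fiberCard α 1 * ∑ b : Cyc p →* (ZMod r)ˣ with b ≠ 1, (fiberCard θ (b.comp (sndHom α)) : ℤ) := by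
  rw [natCard_type_orbit h θ (Or.inr hβ'),
    ← sum_mulAut hβ' (fun b => (fiberCard θ (b.comp (sndHom α)) : ℤ)), Finset.mul_sum]
  rfl

theorem natCard_type_direct_eq_zero (hα : α ≠ 1)
    {T' : CharExt q (1 : Cyc p →* (ZMod q)ˣ) →* (ZMod r)ˣ} (hT' : ¬ TrivOnKernel T') :
    Nat.card (SkewBraceOfType (CharExt r θ) (CharExt r T')) = 0 := by
  have h1 : q.Coprime (Nat.card (Cyc p)) := by rw [natCard_cyc]; exact h.coprime₁
  have h2 : ∀ a : Cyc p →* (ZMod q)ˣ, r.Coprime (Nat.card (CharExt q a)) := fun a => by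
    rw [natCard_cyc_ext]; exact h.coprime₂
  rw [natCard_skewBraceOfType (natCard_cyc p) (by rw [natCard_cyc]; exact h.sylow₁)
    (by rw [natCard_cyc_ext]; exact h.sylow₂) θ (CharExt r T'), if_neg hα, add_zero]
  refine Finset.sum_eq_zero fun a _ => ?_
  rw [Finset.sum_eq_zero, mul_zero]
  intro b _
  rw [if_neg, mul_zero]
  rintro ⟨e⟩
  exact hT' (trivOnKernel_of_groupIso h1 (h2 _) ⟨e.symm⟩ (trivOnKernel_iff.2 ⟨b, rfl⟩))

open Classical in
theorem natCard_type_direct (θ : CharExt q (1 : Cyc p →* (ZMod q)ˣ) →* (ZMod r)ˣ)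
    {T' : CharExt q (1 : Cyc p →* (ZMod q)ˣ) →* (ZMod r)ˣ} (hT' : ¬ TrivOnKernel T') :
    (Nat.card (SkewBraceOfType (CharExt r θ) (CharExt r T')) : ℤ) =
      ∑ T : CharExt q (1 : Cyc p →* (ZMod q)ˣ) →* (ZMod r)ˣ with
        ¬ TrivOnKernel T ∧ (T.comp (inr 1) = 1 ↔ T'.comp (inr 1) = 1), (fiberCard θ T : ℤ) := by
  have h1 : q.Coprime (Nat.card (Cyc p)) := by rw [natCard_cyc]; exact h.coprime₁
  have h2 : ∀ a : Cyc p →* (ZMod q)ˣ, r.Coprime (Nat.card (CharExt q a)) := fun a => by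
    rw [natCard_cyc_ext]; exact h.coprime₂
  rw [natCard_skewBraceOfType (natCard_cyc p) (by rw [natCard_cyc]; exact h.sylow₁)
    (by rw [natCard_cyc_ext]; exact h.sylow₂) θ (CharExt r T'), if_pos rfl, Finset.sum_eq_zero,
    zero_add, ← Finset.filter_filter, Finset.sum_filter _ (fun T => (fiberCard θ T : ℤ))]
  · push_cast
    refine Finset.sum_congr rfl fun T hT => ?_
    rw [if_congr (groupIso_direct_iff (natCard_cyc p) h1 (h2 1) (Finset.mem_filter.1 hT).2 hT')
      rfl rfl]
    split_ifs <;> simp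
  · intro a _
    rw [Finset.sum_eq_zero, mul_zero]
    intro b _
    rw [if_neg, mul_zero]
    rintro ⟨e⟩
    exact hT' (trivOnKernel_of_groupIso h1 (h2 _) ⟨e.symm⟩ (trivOnKernel_iff.2 ⟨b, rfl⟩))

end Columns

end CharExt
-- Values of the sums
open IsSkewBrace

namespace CharExt

theorem fiberCard_one_one {p : ℕ} {Q : Type*} [Group Q] :
    (fiberCard (1 : Q →* (ZMod p)ˣ) 1 : ℤ) = 1 := by
  classical
  rw [fiberCard_one_right, if_pos rfl, Nat.cast_one]

theorem fiberCard_ne_one {p : ℕ} {Q : Type*} [Group Q] {θ : Q →* (ZMod p)ˣ} (hθ : θ ≠ 1) :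
    (fiberCard θ 1 : ℤ) = p := by
  classical
  rw [fiberCard_one_right, if_neg hθ]

variable {p q r : ℕ} [hp : Fact p.Prime] [hr : Fact r.Prime]

theorem inv_eq_one_iff_char {p : ℕ} {Q : Type*} [Group Q] {T : Q →* (ZMod p)ˣ} :
    T⁻¹ = 1 ↔ T = 1 := by
  constructor
  · intro e
    refine MonoidHom.ext fun x => ?_
    have : (T x)⁻¹ = 1 := DFunLike.congr_fun e x
    exact inv_eq_one.1 this
  · rintro rfl
    exact MonoidHom.ext fun x => inv_one

section Values

open Classical

theorem sum_ne_one_of_eq [hq : Fact q.Prime] (h : q ≡ 1 [MOD p]) :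
    ∑ a : Cyc p →* (ZMod q)ˣ with a ≠ 1, (fiberCard (1 : Cyc p →* (ZMod q)ˣ) a : ℤ) =
      2 * (p - 1) := by
  rw [sum_fiberCard_one _ (by simp), card_cyc_char_ne_one h]

theorem sum_ne_one_of_ne [hq : Fact q.Prime] (h : q ≡ 1 [MOD p]) {α : Cyc p →* (ZMod q)ˣ} (hα : α ≠ 1) :
    ∑ a : Cyc p →* (ZMod q)ˣ with a ≠ 1, (fiberCard α a : ℤ) =
      2 * q * (p - 1) - 2 * (q - 1) := by
  rw [sum_fiberCard _ (by simp) (fun T => by simp [inv_eq_one_iff_char]) hα,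
    card_cyc_char_ne_one h, if_pos (by simpa using hα)]

variable {α : Cyc p →* (ZMod q)ˣ}

theorem sum_inflation_of_eq (h : r ≡ 1 [MOD p]) :
    ∑ b : Cyc p →* (ZMod r)ˣ with b ≠ 1,
      (fiberCard (1 : CharExt q α →* (ZMod r)ˣ) (b.comp (sndHom α)) : ℤ) = 2 * (p - 1) := by
  have e : (1 : CharExt q α →* (ZMod r)ˣ) = (1 : Cyc p →* (ZMod r)ˣ).comp (sndHom α) := rfl
  rw [e]
  simp only [fiberCard_inflation]
  exact sum_ne_one_of_eq h

theorem sum_inflation_of_inflation (h : r ≡ 1 [MOD p]) {β : Cyc p →* (ZMod r)ˣ} (hβ : β ≠ 1) :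
    ∑ b : Cyc p →* (ZMod r)ˣ with b ≠ 1,
      (fiberCard (β.comp (sndHom α)) (b.comp (sndHom α)) : ℤ) =
        2 * r * (p - 1) - 2 * (r - 1) := by
  simp only [fiberCard_inflation]
  exact sum_ne_one_of_ne h hβ

theorem ne_one_of_not_triv {θ : CharExt q α →* (ZMod r)ˣ} (hθ : ¬ TrivOnKernel θ) : θ ≠ 1 := by
  rintro rfl
  exact hθ fun _ => rfl

theorem trivOnKernel_inv {θ : CharExt q α →* (ZMod r)ˣ} :
    TrivOnKernel θ⁻¹ ↔ TrivOnKernel θ :=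
  forall_congr' fun z => inv_eq_one (a := θ (inl α z))

/-- No inflated character equals θ or θ⁻¹, so every weight is 2r. -/
theorem sum_inflation_of_not_triv (h : r ≡ 1 [MOD p]) {θ : CharExt q α →* (ZMod r)ˣ}
    (hθ : ¬ TrivOnKernel θ) :
    ∑ b : Cyc p →* (ZMod r)ˣ with b ≠ 1, (fiberCard θ (b.comp (sndHom α)) : ℤ) =
      2 * r * (p - 1) := by
  rw [Finset.sum_congr rfl (g := fun _ => 2 * (r : ℤ)), Finset.sum_const, nsmul_eq_mul,
    card_cyc_char_ne_one h, mul_comm]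
  intro b hb
  have hb' : b.comp (sndHom α) ≠ 1 := fun e =>
    (Finset.mem_filter.1 hb).2 (comp_sndHom_injective (e.trans (MonoidHom.one_comp _).symm))
  rw [fiberCard_of_ne (ne_one_of_not_triv hθ) hb', if_neg, if_neg]
  · ring
  · intro e
    exact hθ (trivOnKernel_inv.1 (trivOnKernel_iff.2 ⟨b, e.symm⟩))
  · intro e
    exact hθ (trivOnKernel_iff.2 ⟨b, e.symm⟩)

variable [hq : Fact q.Prime]

/-- The characters of a direct product that are nontrivial on the first factor, and trivial on the
second factor if and only if `T'` is. -/
noncomputable def similarChars (T' : CharExt q (1 : Cyc p →* (ZMod q)ˣ) →* (ZMod r)ˣ) :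
    Finset (CharExt q (1 : Cyc p →* (ZMod q)ˣ) →* (ZMod r)ˣ) :=
  Finset.univ.filter fun T => ¬ TrivOnKernel T ∧ (T.comp (inr 1) = 1 ↔ T'.comp (inr 1) = 1)

/-- Split a character into its two components: q − 1 nontrivial ones on the first factor, and 1 or p
− 1 on the second. -/
theorem card_similarChars (h : PrimeChain p q r)
    (T' : CharExt q (1 : Cyc p →* (ZMod q)ˣ) →* (ZMod r)ˣ) :
    ((similarChars T').card : ℤ) =
      (q - 1) * if T'.comp (inr 1) = 1 then 1 else (p : ℤ) - 1 := by
  have key : (similarChars T').card =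
      ((Finset.univ.filter fun a : Cyc q →* (ZMod r)ˣ => a ≠ 1) ×ˢ
        (Finset.univ.filter fun b : Cyc p →* (ZMod r)ˣ => b = 1 ↔ T'.comp (inr 1) = 1)).card := by
    refine Finset.card_equiv (charEquiv q r (Cyc p)) fun T => ?_
    rw [similarChars, Finset.mem_filter, Finset.mem_product, Finset.mem_filter, Finset.mem_filter,
      trivOnKernel_iff_comp]
    simp only [Finset.mem_univ, true_and]
    rfl
  rw [key, Finset.card_product, Nat.cast_mul, card_cyc_char_ne_one h.modEq₃]
  congr 1
  split_ifs with h1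
  · simp [h1, Finset.filter_eq']
  · simp only [h1, iff_false]
    exact card_cyc_char_ne_one h.modEq₂

variable {T' : CharExt q (1 : Cyc p →* (ZMod q)ˣ) →* (ZMod r)ˣ}

theorem one_notMem_similarChars : 1 ∉ similarChars T' := fun hm =>
  (Finset.mem_filter.1 hm).2.1 fun _ => rfl

theorem sum_similarChars_one :
    ∑ T ∈ similarChars T', (fiberCard (1 : CharExt q (1 : Cyc p →* (ZMod q)ˣ) →* (ZMod r)ˣ) T : ℤ) =
      2 * (similarChars T').card :=
  sum_fiberCard_one _ one_notMem_similarChars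

theorem sum_similarChars {θ : CharExt q (1 : Cyc p →* (ZMod q)ˣ) →* (ZMod r)ˣ} (hθ : θ ≠ 1) :
    ∑ T ∈ similarChars T', (fiberCard θ T : ℤ) = 2 * r * (similarChars T').card -
      if ¬ TrivOnKernel θ ∧ (θ.comp (inr 1) = 1 ↔ T'.comp (inr 1) = 1) then 2 * ((r : ℤ) - 1)
      else 0 := by
  rw [sum_fiberCard _ one_notMem_similarChars _ hθ]
  · congr 1
    refine if_congr ?_ rfl rfl
    rw [similarChars, Finset.mem_filter]
    simp
  · intro T
    have e : T⁻¹.comp (inr 1) = (T.comp (inr 1))⁻¹ := rfl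
    rw [similarChars, Finset.mem_filter, Finset.mem_filter, trivOnKernel_inv, e,
      inv_eq_one_iff_char]
    simp

end Values

section Four

variable [hq : Fact q.Prime]

theorem card_mulAut_cyc (h : r ≡ 1 [MOD p]) : (Fintype.card (Cyc p ≃* Cyc p) : ℤ) = p - 1 := by
  classical
  have : Nontrivial (Cyc p →* (ZMod r)ˣ) := by
    rw [← Fintype.one_lt_card_iff_nontrivial, card_cyc_char h]
    exact hp.1.one_lt
  obtain ⟨β, hβ⟩ := exists_ne (1 : Cyc p →* (ZMod r)ˣ)
  have := sum_mulAut hβ (fun _ => 1)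
  rw [← card_cyc_char_ne_one h]
  simpa using this

/-- The composite of an automorphism with the inversion. -/
def twist (ψ : Cyc p ≃* Cyc p) : Cyc p ≃* Cyc p := (MulEquiv.inv (Cyc p)).trans ψ

theorem twist_apply (ψ : Cyc p ≃* Cyc p) (c : Cyc p) : twist ψ c = (ψ c)⁻¹ := map_inv ψ c

theorem twist_twist (ψ : Cyc p ≃* Cyc p) : twist (twist ψ) = ψ :=
  MulEquiv.ext fun c => by rw [twist_apply, twist_apply, inv_inv]

theorem comp_twist (β : Cyc p →* (ZMod r)ˣ) (ψ : Cyc p ≃* Cyc p) :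
    β.comp (twist ψ).toMonoidHom = (β.comp ψ.toMonoidHom)⁻¹ :=
  MonoidHom.ext fun c => (congrArg β (twist_apply ψ c)).trans (map_inv β _)

theorem twist_ne (h : 2 < p) (ψ : Cyc p ≃* Cyc p) : twist ψ ≠ ψ := by
  intro e
  have h1 := twist_apply ψ (ψ.symm (.ofAdd 1))
  rw [e, ψ.apply_symm_apply] at h1
  have h2 : (1 : ZMod p) = -1 := h1
  have h3 : ((2 : ℕ) : ZMod p) = 0 := by
    push_cast
    linear_combination h2
  have := Nat.le_of_dvd two_pos ((ZMod.natCast_eq_zero_iff 2 p).1 h3)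
  omega

theorem fiberCard_orbit {β β' : Cyc p →* (ZMod r)ˣ} (hβ : β ≠ 1) (hβ' : β' ≠ 1)
    {ψ₀ : Cyc p ≃* Cyc p} (hψ₀ : β'.comp ψ₀.toMonoidHom = β) (ψ : Cyc p ≃* Cyc p)
    [DecidableEq (Cyc p ≃* Cyc p)] :
    (fiberCard β (β'.comp ψ.toMonoidHom) : ℤ) =
      2 * r - (r - 1) * ((if ψ₀ = ψ then 1 else 0) + (if twist ψ₀ = ψ then 1 else 0)) := by
  classical
  have e1 : β = β'.comp ψ.toMonoidHom ↔ ψ₀ = ψ := by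
    rw [← hψ₀]
    exact (comp_injective hβ').eq_iff
  have e2 : β⁻¹ = β'.comp ψ.toMonoidHom ↔ twist ψ₀ = ψ := by
    rw [← hψ₀, ← comp_twist]
    exact (comp_injective hβ').eq_iff
  rw [fiberCard_of_ne hβ (fun e => hβ' ((comp_eq_one_iff ψ).1 e))]
  simp only [e1, e2]

/-- The weights are 2q − (q−1)u and 2r − (r−1)v, where u and v indicate ψ₁ and ψ₂ together with
their composites with inversion. Only the sum of uv over automorphisms depends on how ψ₁ and ψ₂ are
related; each coincidence is counted twice in it. -/
theorem natCard_type_four (h : PrimeChain p q r) {α α' : Cyc p →* (ZMod q)ˣ}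
    {β β' : Cyc p →* (ZMod r)ˣ} (hα : α ≠ 1) (hα' : α' ≠ 1) (hβ : β ≠ 1) (hβ' : β' ≠ 1)
    {ψ₁ ψ₂ : Cyc p ≃* Cyc p} (h₁ : α'.comp ψ₁.toMonoidHom = α) (h₂ : β'.comp ψ₂.toMonoidHom = β)
    [DecidableEq (Cyc p ≃* Cyc p)] :
    (Nat.card (SkewBraceOfType (CharExt r (β.comp (sndHom α)))
      (CharExt r (β'.comp (sndHom α')))) : ℤ) =
      4 * q * r * (p - 1) - 4 * q * (r - 1) - 4 * r * (q - 1) + 2 * (q - 1) * (r - 1) *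
        ((if ψ₁ = ψ₂ then 1 else 0) + (if ψ₁ = twist ψ₂ then 1 else 0)) := by
  rw [natCard_type_orbit h _ (Or.inl hα')]
  simp only [fiberCard_inflation, fiberCard_orbit hα hα' h₁, fiberCard_orbit hβ hβ' h₂]
  set u : (Cyc p ≃* Cyc p) → ℤ :=
    fun ψ => (if ψ₁ = ψ then 1 else 0) + (if twist ψ₁ = ψ then 1 else 0) with hu
  set v : (Cyc p ≃* Cyc p) → ℤ :=
    fun ψ => (if ψ₂ = ψ then 1 else 0) + (if twist ψ₂ = ψ then 1 else 0) with hv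
  have hsu : ∀ F : (Cyc p ≃* Cyc p) → ℤ, ∑ ψ, u ψ * F ψ = F ψ₁ + F (twist ψ₁) := fun F => by
    simp [hu, add_mul, Finset.sum_add_distrib]
  have hsv : ∑ ψ, v ψ = 2 := by simp [hv, Finset.sum_add_distrib]
  have hsu' : ∑ ψ, u ψ = 2 := by simp [hu, Finset.sum_add_distrib]
  have e : ∀ ψ, (2 * (q : ℤ) - (q - 1) * u ψ) * (2 * r - (r - 1) * v ψ) =
      4 * q * r - 2 * q * (r - 1) * v ψ - 2 * r * (q - 1) * u ψ +
        (q - 1) * (r - 1) * (u ψ * v ψ) := fun ψ => by ring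
  have hc : ∑ _ψ : Cyc p ≃* Cyc p, (4 * q * r : ℤ) = 4 * q * r * (p - 1) := by
    rw [Finset.sum_const, Finset.card_univ, nsmul_eq_mul, card_mulAut_cyc h.modEq₂, mul_comm]
  calc _ = ∑ ψ, (2 * (q : ℤ) - (q - 1) * u ψ) * (2 * r - (r - 1) * v ψ) := rfl
    _ = _ := by
      simp only [e, Finset.sum_add_distrib, Finset.sum_sub_distrib, ← Finset.mul_sum, hsu, hsv,
        hsu', hc]
      have e1 : (ψ₂ = twist ψ₁) ↔ ψ₁ = twist ψ₂ :=
        ⟨fun e => by rw [e, twist_twist], fun e => by rw [e, twist_twist]⟩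
      have e2 : (twist ψ₂ = twist ψ₁) ↔ ψ₁ = ψ₂ :=
        
        ⟨fun e => (twist_twist ψ₁).symm.trans ((congrArg twist e.symm).trans (twist_twist ψ₂)),
          fun e => by rw [e]⟩
      simp only [hv, e1, e2, eq_comm (a := ψ₂) (b := ψ₁), eq_comm (a := twist ψ₂) (b := ψ₁)]
      ring

end Four

end CharExt
-- Comparison with the tables
open IsSkewBrace

namespace CharExt

variable {p q r : ℕ} [hp : Fact p.Prime] [hq : Fact q.Prime] [hr : Fact r.Prime]

/-- The six kinds of groups, in terms of the two characters defining them. -/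
inductive Pattern {α : Cyc p →* (ZMod q)ˣ} (θ : CharExt q α →* (ZMod r)ˣ) : Fin 6 → Prop
  | cyclic (hα : α = 1) (hθ : θ = 1) : Pattern θ 0
  | left (hα : α ≠ 1) (hθ : θ = 1) : Pattern θ 1
  | right (hα : α = 1) (β : Cyc p →* (ZMod r)ˣ) (hβ : β ≠ 1) (hθ : θ = β.comp (sndHom α)) :
    Pattern θ 2
  | both (hα : α ≠ 1) (β : Cyc p →* (ZMod r)ˣ) (hβ : β ≠ 1) (hθ : θ = β.comp (sndHom α)) :
    Pattern θ 3
  | kernel (hθ : ¬ TrivOnKernel θ) (hθ' : θ.comp (inr α) = 1) : Pattern θ 4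
  | faithful (hθ : ¬ TrivOnKernel θ) (hθ' : θ.comp (inr α) ≠ 1) : Pattern θ 5

theorem exists_pattern {α : Cyc p →* (ZMod q)ˣ} (θ : CharExt q α →* (ZMod r)ˣ) :
    ∃ i, Pattern θ i := by
  by_cases hT : TrivOnKernel θ
  · obtain ⟨β, rfl⟩ := trivOnKernel_iff.1 hT
    by_cases hα : α = 1
    · by_cases hβ : β = 1
      · exact ⟨0, .cyclic hα (by rw [hβ]; rfl)⟩
      · exact ⟨2, .right hα β hβ rfl⟩
    · by_cases hβ : β = 1
      · exact ⟨1, .left hα (by rw [hβ]; rfl)⟩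
      · exact ⟨3, .both hα β hβ rfl⟩
  · by_cases h : θ.comp (inr α) = 1
    · exact ⟨4, .kernel hT h⟩
    · exact ⟨5, .faithful hT h⟩

theorem inflation_ne_one {α : Cyc p →* (ZMod q)ˣ} {β : Cyc p →* (ZMod r)ˣ} (hβ : β ≠ 1) :
    β.comp (sndHom α) ≠ 1 := fun e =>
  hβ (comp_sndHom_injective (e.trans (MonoidHom.one_comp _).symm))

theorem triv_inflation {α : Cyc p →* (ZMod q)ˣ} (β : Cyc p →* (ZMod r)ˣ) :
    TrivOnKernel (β.comp (sndHom α)) := trivOnKernel_iff.2 ⟨β, rfl⟩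

/-- The number of skew braces agrees with the table. -/
theorem natCard_eq_table (h : PrimeChain p q r) {α α' : Cyc p →* (ZMod q)ˣ}
    {θ : CharExt q α →* (ZMod r)ˣ} {θ' : CharExt q α' →* (ZMod r)ˣ} {i j : Fin 6}
    (hi : Pattern θ i) (hj : Pattern θ' j) (hij : i ≠ 3 ∨ j ≠ 3) (c : ℤ) :
    (Nat.card (SkewBraceOfType (CharExt r θ) (CharExt r θ')) : ℤ) = tableOdd p q r c i j := by
  cases hj with
  | cyclic hα' hθ' =>
    subst hα' hθ'
    rw [natCard_type_one h]
    cases hi with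
    | cyclic hα hθ =>
      subst hα hθ
      rw [fiberCard_one_one, fiberCard_one_one]
      simp [tableOdd]
    | left hα hθ =>
      subst hθ
      rw [fiberCard_ne_one hα, fiberCard_one_one]
      simp [tableOdd]
    | right hα β hβ hθ =>
      subst hα hθ
      rw [fiberCard_one_one, fiberCard_ne_one (inflation_ne_one hβ)]
      simp [tableOdd]
    | both hα β hβ hθ =>
      subst hθ
      rw [fiberCard_ne_one hα, fiberCard_ne_one (inflation_ne_one hβ)]
      simp [tableOdd]
    | kernel hθ hθ' =>
      obtain rfl := char_eq_one_of_not_triv hθ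
      rw [fiberCard_one_one, fiberCard_ne_one (ne_one_of_not_triv hθ)]
      simp [tableOdd]
    | faithful hθ hθ' =>
      obtain rfl := char_eq_one_of_not_triv hθ
      rw [fiberCard_one_one, fiberCard_ne_one (ne_one_of_not_triv hθ)]
      simp [tableOdd]
  | left hα' hθ' =>
    subst hθ'
    rw [natCard_type_left h _ hα']
    cases hi with
    | cyclic hα hθ =>
      subst hα hθ
      rw [sum_ne_one_of_eq h.modEq₁, fiberCard_one_one]
      simp [tableOdd]
    | left hα hθ =>
      subst hθ
      rw [sum_ne_one_of_ne h.modEq₁ hα, fiberCard_one_one]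
      simp [tableOdd]
      ring
    | right hα β hβ hθ =>
      subst hα hθ
      rw [sum_ne_one_of_eq h.modEq₁, fiberCard_ne_one (inflation_ne_one hβ)]
      simp [tableOdd]
    | both hα β hβ hθ =>
      subst hθ
      rw [sum_ne_one_of_ne h.modEq₁ hα, fiberCard_ne_one (inflation_ne_one hβ)]
      simp [tableOdd]
      ring
    | kernel hθ hθ' =>
      obtain rfl := char_eq_one_of_not_triv hθ
      rw [sum_ne_one_of_eq h.modEq₁, fiberCard_ne_one (ne_one_of_not_triv hθ)]
      simp [tableOdd]
    | faithful hθ hθ' =>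
      obtain rfl := char_eq_one_of_not_triv hθ
      rw [sum_ne_one_of_eq h.modEq₁, fiberCard_ne_one (ne_one_of_not_triv hθ)]
      simp [tableOdd]
  | right hα' β' hβ' hθ' =>
    subst hα' hθ'
    rw [natCard_type_right h _ hβ']
    cases hi with
    | cyclic hα hθ =>
      subst hα hθ
      rw [fiberCard_one_one, sum_inflation_of_eq h.modEq₂]
      simp [tableOdd]
    | left hα hθ =>
      subst hθ
      rw [fiberCard_ne_one hα, sum_inflation_of_eq h.modEq₂]
      simp [tableOdd]
      ring
    | right hα β hβ hθ =>
      subst hα hθ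
      rw [fiberCard_one_one, sum_inflation_of_inflation h.modEq₂ hβ]
      simp [tableOdd]
      ring
    | both hα β hβ hθ =>
      subst hθ
      rw [fiberCard_ne_one hα, sum_inflation_of_inflation h.modEq₂ hβ]
      simp [tableOdd]
      ring
    | kernel hθ hθ' =>
      obtain rfl := char_eq_one_of_not_triv hθ
      rw [fiberCard_one_one, sum_inflation_of_not_triv h.modEq₂ hθ]
      simp [tableOdd]
      ring
    | faithful hθ hθ' =>
      obtain rfl := char_eq_one_of_not_triv hθ
      rw [fiberCard_one_one, sum_inflation_of_not_triv h.modEq₂ hθ]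
      simp [tableOdd]
      ring
  | both hα' β' hβ' hθ' =>
    subst hθ'
    rw [natCard_type_orbit h _ (Or.inl hα')]
    -- For α = 1 the first weight is constantly 2, so the orbit sum is twice the sum over nontrivial
    -- b.
    have key : ∀ θ : CharExt q (1 : Cyc p →* (ZMod q)ˣ) →* (ZMod r)ˣ,
        ∑ ψ : Cyc p ≃* Cyc p, (fiberCard 1 (α'.comp ψ.toMonoidHom) : ℤ) *
          fiberCard θ ((β'.comp ψ.toMonoidHom).comp (sndHom 1)) =
        2 * ∑ b : Cyc p →* (ZMod r)ˣ with b ≠ 1, (fiberCard θ (b.comp (sndHom 1)) : ℤ) := by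
      intro θ
      rw [← sum_mulAut hβ' (fun b => (fiberCard θ (b.comp (sndHom 1)) : ℤ)), Finset.mul_sum]
      refine Finset.sum_congr rfl fun ψ _ => ?_
      rw [fiberCard_one_left fun e => hα' ((comp_eq_one_iff ψ).1 e)]
      rfl
    cases hi with
    | cyclic hα hθ =>
      subst hα hθ
      rw [key, sum_inflation_of_eq h.modEq₂]
      simp [tableOdd]
      ring
    | left hα hθ =>
      subst hθ
      have e : ∀ ψ : Cyc p ≃* Cyc p, (fiberCard (1 : CharExt q α →* (ZMod r)ˣ)
          ((β'.comp ψ.toMonoidHom).comp (sndHom α)) : ℤ) = 2 := fun ψ => by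
        rw [fiberCard_one_left (inflation_ne_one fun e => hβ' ((comp_eq_one_iff ψ).1 e))]
        rfl
      simp only [e]
      rw [← Finset.sum_mul, sum_mulAut hα' (fun a => (fiberCard α a : ℤ)),
        sum_ne_one_of_ne h.modEq₁ hα]
      simp [tableOdd]
      ring
    | right hα β hβ hθ =>
      subst hα hθ
      rw [key, sum_inflation_of_inflation h.modEq₂ hβ]
      simp [tableOdd]
      ring
    | both hα β hβ hθ => simp at hij
    | kernel hθ hθ' =>
      obtain rfl := char_eq_one_of_not_triv hθ
      rw [key, sum_inflation_of_not_triv h.modEq₂ hθ]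
      simp [tableOdd]
      ring
    | faithful hθ hθ' =>
      obtain rfl := char_eq_one_of_not_triv hθ
      rw [key, sum_inflation_of_not_triv h.modEq₂ hθ]
      simp [tableOdd]
      ring
  | kernel hT' hT'' =>
    obtain rfl := char_eq_one_of_not_triv hT'
    have hd := card_similarChars h θ'
    rw [if_pos hT''] at hd
    cases hi with
    | cyclic hα hθ =>
      subst hα hθ
      rw [natCard_type_direct h _ hT']
      refine sum_similarChars_one.trans ?_
      rw [hd]
      simp [tableOdd]
    | left hα hθ =>
      rw [natCard_type_direct_eq_zero h _ hα hT']
      simp [tableOdd]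
    | right hα β hβ hθ =>
      subst hα hθ
      rw [natCard_type_direct h _ hT']
      refine (sum_similarChars (inflation_ne_one hβ)).trans ?_
      rw [hd, if_neg (fun e => e.1 (triv_inflation β))]
      simp [tableOdd]
      ring
    | both hα β hβ hθ =>
      rw [natCard_type_direct_eq_zero h _ hα hT']
      simp [tableOdd]
    | kernel hθ hθ' =>
      obtain rfl := char_eq_one_of_not_triv hθ
      rw [natCard_type_direct h _ hT']
      refine (sum_similarChars (ne_one_of_not_triv hθ)).trans ?_
      rw [hd, if_pos ⟨hθ, by simp [hθ', hT'']⟩]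
      simp [tableOdd]
      ring
    | faithful hθ hθ' =>
      obtain rfl := char_eq_one_of_not_triv hθ
      rw [natCard_type_direct h _ hT']
      refine (sum_similarChars (ne_one_of_not_triv hθ)).trans ?_
      rw [hd, if_neg (fun e => hθ' (e.2.2 hT''))]
      simp [tableOdd]
      ring
  | faithful hT' hT'' =>
    obtain rfl := char_eq_one_of_not_triv hT'
    have hd := card_similarChars h θ'
    rw [if_neg hT''] at hd
    cases hi with
    | cyclic hα hθ =>
      subst hα hθ
      rw [natCard_type_direct h _ hT']
      refine sum_similarChars_one.trans ?_
      rw [hd]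
      simp [tableOdd]
      ring
    | left hα hθ =>
      rw [natCard_type_direct_eq_zero h _ hα hT']
      simp [tableOdd]
    | right hα β hβ hθ =>
      subst hα hθ
      rw [natCard_type_direct h _ hT']
      refine (sum_similarChars (inflation_ne_one hβ)).trans ?_
      rw [hd, if_neg (fun e => e.1 (triv_inflation β))]
      simp [tableOdd]
      ring
    | both hα β hβ hθ =>
      rw [natCard_type_direct_eq_zero h _ hα hT']
      simp [tableOdd]
    | kernel hθ hθ' =>
      obtain rfl := char_eq_one_of_not_triv hθ
      rw [natCard_type_direct h _ hT']
      refine (sum_similarChars (ne_one_of_not_triv hθ)).trans ?_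
      rw [hd, if_neg (fun e => hT'' (e.2.1 hθ'))]
      simp [tableOdd]
      ring
    | faithful hθ hθ' =>
      obtain rfl := char_eq_one_of_not_triv hθ
      rw [natCard_type_direct h _ hT']
      refine (sum_similarChars (ne_one_of_not_triv hθ)).trans ?_
      rw [hd, if_pos ⟨hθ, by simp [hθ', hT'']⟩]
      simp [tableOdd]
      ring

/-- The group of order 2 has no nontrivial automorphism, so both indicators in `natCard_type_four`
are 1. -/
theorem natCard_both_of_two (h : PrimeChain 2 q r) {α α' : Cyc 2 →* (ZMod q)ˣ}
    {β β' : Cyc 2 →* (ZMod r)ˣ} (hα : α ≠ 1) (hα' : α' ≠ 1) (hβ : β ≠ 1) (hβ' : β' ≠ 1) :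
    (Nat.card (SkewBraceOfType (CharExt r (β.comp (sndHom α)))
      (CharExt r (β'.comp (sndHom α')))) : ℤ) = 4 := by
  classical
  have : Fact (Nat.Prime 2) := ⟨Nat.prime_two⟩
  obtain ⟨ψ₁, h₁⟩ := exists_comp_eq hα hα'
  obtain ⟨ψ₂, h₂⟩ := exists_comp_eq hβ hβ'
  have hc := card_mulAut_cyc (p := 2) h.modEq₂
  have hs : Subsingleton (Cyc 2 ≃* Cyc 2) :=
    Fintype.card_le_one_iff_subsingleton.1 (by push_cast at hc; omega)
  rw [natCard_type_four h hα hα' hβ hβ' h₁ h₂, if_pos (hs.elim _ _), if_pos (hs.elim _ _)]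
  push_cast
  ring

-- For p > 2 inversion is nontrivial, so at most one of the two indicators is 1, and either one
-- yields the same value.
open Classical in
theorem natCard_both (hp2 : 2 < p) (h : PrimeChain p q r) {α α' : Cyc p →* (ZMod q)ˣ}
    {β β' : Cyc p →* (ZMod r)ˣ} (hα : α ≠ 1) (hα' : α' ≠ 1) (hβ : β ≠ 1) (hβ' : β' ≠ 1) :
    (Nat.card (SkewBraceOfType (CharExt r (β.comp (sndHom α)))
      (CharExt r (β'.comp (sndHom α')))) : ℤ) =
      if ∃ ψ : Cyc p ≃* Cyc p, α'.comp ψ.toMonoidHom = α ∧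
        (β'.comp ψ.toMonoidHom = β ∨ β'.comp ψ.toMonoidHom = β⁻¹) then
        4 * (p : ℤ) * q * r - 10 * q * r + 2 * q + 2 * r + 2
      else 4 * (p : ℤ) * q * r - 12 * q * r + 4 * q + 4 * r := by
  obtain ⟨ψ₁, h₁⟩ := exists_comp_eq hα hα'
  obtain ⟨ψ₂, h₂⟩ := exists_comp_eq hβ hβ'
  have key : (∃ ψ : Cyc p ≃* Cyc p, α'.comp ψ.toMonoidHom = α ∧
      (β'.comp ψ.toMonoidHom = β ∨ β'.comp ψ.toMonoidHom = β⁻¹)) ↔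
        ψ₁ = ψ₂ ∨ ψ₁ = twist ψ₂ := by
    constructor
    · rintro ⟨ψ, e1, e2⟩
      obtain rfl : ψ = ψ₁ := comp_injective hα' (e1.trans h₁.symm)
      refine e2.imp (fun e => comp_injective hβ' (e.trans h₂.symm)) fun e =>
        comp_injective hβ' (e.trans ?_)
      rw [← h₂, ← comp_twist]
    · intro e
      refine ⟨ψ₁, h₁, e.imp (fun e => by rw [e, h₂]) fun e => by rw [e, comp_twist, h₂]⟩
  rw [natCard_type_four h hα hα' hβ hβ' h₁ h₂, if_congr key rfl rfl]
  by_cases e1 : ψ₁ = ψ₂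
  · have e2 : ψ₁ ≠ twist ψ₂ := fun e => twist_ne hp2 ψ₂ (e.symm.trans e1)
    rw [if_pos e1, if_neg e2, if_pos (Or.inl e1)]
    ring
  · by_cases e2 : ψ₁ = twist ψ₂
    · rw [if_neg e1, if_pos e2, if_pos (Or.inr e2)]
      ring
    · rw [if_neg e1, if_neg e2, if_neg (not_or.2 ⟨e1, e2⟩)]
      ring

theorem tableTwo_eq (q r : ℤ) (i j : Fin 6) : tableTwo q r i j = tableOdd 2 q r 4 i j := by
  fin_cases i <;> fin_cases j <;> simp [tableTwo, tableOdd] <;>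
    first | ring1 | exact Or.inl (by ring)

end CharExt
-- Groups of order pqr as iterated extensions
open IsSkewBrace

namespace CharExt

/-- A group with a normal Sylow subgroup of prime order is an extension by a character. -/
theorem exists_charExt {p m : ℕ} [Fact p.Prime] {X : Type u} [Group X]
    (hX : Nat.card X = p * m) (hm : m ≠ 0) (h : SylowCondition p m) :
    ∃ (Q : Type u) (_ : Group Q) (_ : Finite Q) (θ : Q →* (ZMod p)ˣ),
      Nat.card Q = m ∧ GroupIso X (CharExt p θ) := by
  have hp : p.Prime := Fact.out
  have : Finite X := Nat.finite_of_card_ne_zero (by rw [hX]; exact mul_ne_zero hp.ne_zero hm)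
  obtain ⟨N, hN, hcard, -⟩ := exists_normal_sylow hX hm h
  let e : Cyc p ≃* N := mulEquivOfPrimeCardEq (p := p) (natCard_cyc p) hcard
  let ι : Cyc p →* X := N.subtype.comp e.toMonoidHom
  have hι : Function.Injective ι := N.subtype_injective.comp e.injective
  have hrange : ι.range = N := by
    rw [MonoidHom.range_comp, MonoidHom.range_eq_top.2 e.surjective, ← MonoidHom.range_eq_map,
      Subgroup.range_subtype]
  have hconj : ∀ x z, ∃ w, ι w = x * ι z * x⁻¹ := fun x z => by
    have : x * ι z * x⁻¹ ∈ ι.range := by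
      rw [hrange]
      exact hN.conj_mem _ (e z).2 x
    exact this
  choose f hf using hconj
  -- Conjugation by x on N, read in `ZMod p`; it is multiplication by F x 1, which is the desired
  -- character.
  let F : X → ZMod p →+ ZMod p := fun x =>
    { toFun := fun z => (f x (.ofAdd z)).toAdd
      map_zero' := by
        have : f x 1 = 1 := hι (by rw [hf, map_one, mul_one, mul_inv_cancel])
        exact this
      map_add' := fun z w => by
        have : f x (.ofAdd z * .ofAdd w) = f x (.ofAdd z) * f x (.ofAdd w) :=
          hι (by rw [hf, map_mul, map_mul, hf, hf]; group)
        exact this }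
  have hF : ∀ x z, F x z = F x 1 * z := fun x z => by
    have := ZMod.map_smul (F x) z 1
    rwa [smul_eq_mul, mul_one, smul_eq_mul, mul_comm] at this
  have hx : ∀ x (z : ZMod p), ι (.ofAdd (F x 1 * z)) = x * ι (.ofAdd z) * x⁻¹ := fun x z => by
    rw [← hF, ← hf]
    rfl
  let t : X →* ZMod p :=
    { toFun := fun x => F x 1
      map_one' := by
        have : ι (.ofAdd (F 1 1 * 1)) = ι (.ofAdd 1) := by rw [hx]; simp
        have := hι this
        rw [mul_one] at this
        exact this
      map_mul' := fun x y => by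
        have : ι (.ofAdd (F (x * y) 1 * 1)) = ι (.ofAdd (F x 1 * (F y 1 * 1))) := by
          rw [hx, hx, hx]
          group
        have := hι this
        rw [mul_one, mul_one] at this
        exact this }
  have ht : ∀ n ∈ N, t.toHomUnits n = 1 := by
    intro n hn
    rw [← hrange] at hn
    obtain ⟨z, rfl⟩ := hn
    apply Units.ext
    have : ι (.ofAdd (F (ι z) 1 * 1)) = ι (.ofAdd 1) := by
      rw [hx, ← map_mul, mul_comm z, map_mul, mul_inv_cancel_right]
    have := hι this
    rw [mul_one] at this
    exact this
  have hQ : Nat.card (X ⧸ N) = m := by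
    have := N.card_mul_index
    rw [hcard, hX] at this
    exact Nat.eq_of_mul_eq_mul_left hp.pos this
  let θ : X ⧸ N →* (ZMod p)ˣ := QuotientGroup.lift N t.toHomUnits ht
  obtain ⟨ψ, -⟩ := exists_mulEquiv (θ := θ) (by rw [hQ]; exact h.coprime) (QuotientGroup.mk' N)
    (QuotientGroup.mk'_surjective N) ι hι (by rw [hrange, QuotientGroup.ker_mk']) (fun x z => by
      have : (θ (QuotientGroup.mk' N x) : ZMod p) = F x 1 := rfl
      rw [this, hx, inv_mul_cancel_right])
  exact ⟨X ⧸ N, inferInstance, inferInstance, θ, hQ, ⟨ψ⟩⟩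

theorem exists_congr {p : ℕ} {Q Q' : Type*} [Group Q] [Group Q'] (θ : Q →* (ZMod p)ˣ)
    (e : Q ≃* Q') : ∃ θ' : Q' →* (ZMod p)ˣ, GroupIso (CharExt p θ) (CharExt p θ') :=
  ⟨θ.comp e.symm.toMonoidHom, ⟨congrEquiv e (MonoidHom.ext fun x =>
    congrArg θ (e.symm_apply_apply x))⟩⟩

variable {p q r : ℕ} [hp : Fact p.Prime] [hq : Fact q.Prime] [hr : Fact r.Prime]

/-- Groups of order `p q r` are iterated extensions. -/
theorem exists_model (h : PrimeChain p q r) {X : Type u} [Group X]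
    (hX : Nat.card X = p * q * r) :
    ∃ (α : Cyc p →* (ZMod q)ˣ) (θ : CharExt q α →* (ZMod r)ˣ), GroupIso X (CharExt r θ) := by
  obtain ⟨Q, _, _, θ, hQ, ⟨e⟩⟩ := exists_charExt (p := r) (m := q * p) (by rw [hX]; ring)
    (mul_ne_zero hq.1.ne_zero hp.1.ne_zero) h.sylow₂
  obtain ⟨C, _, _, α, hC, ⟨e'⟩⟩ := exists_charExt hQ hp.1.ne_zero h.sylow₁
  obtain ⟨α', ⟨e''⟩⟩ := exists_congr α (mulEquivOfPrimeCardEq (p := p) hC (natCard_cyc p))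
  obtain ⟨θ', ⟨e'''⟩⟩ := exists_congr θ (e'.trans e'')
  exact ⟨α', θ', ⟨e.trans e'''⟩⟩

end CharExt
-- Metacyclic groups: order, centre and commutator subgroup
open IsSkewBrace

section Generic

open scoped commutatorElement

variable {X : Type*} [Group X] {s t : X} {d g z : ℕ} {k : ℤ} (hst : t * s * t⁻¹ = s ^ k)
include hst

theorem mul_zpow_of_conj (a : ℤ) : t * s ^ a = s ^ (k * a) * t := by
  rw [zpow_mul, ← hst, conj_zpow]
  group

theorem exists_eq_zpow_mul_zpow_of_conj (hd : 0 < d) (ht : t ^ d = 1) {x : X}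
    (hx : x ∈ Subgroup.closure {s, t}) : ∃ a b : ℤ, x = s ^ a * t ^ b := by
  have h1 : ∀ y : X, (∃ a b : ℤ, y = s ^ a * t ^ b) → ∃ a b : ℤ, t * y = s ^ a * t ^ b := by
    rintro _ ⟨a, b, rfl⟩
    exact ⟨k * a, 1 + b, by rw [← mul_assoc, mul_zpow_of_conj hst, mul_assoc, zpow_one_add]⟩
  have h2 : ∀ (n : ℕ) (y : X), (∃ a b : ℤ, y = s ^ a * t ^ b) →
      ∃ a b : ℤ, t ^ n * y = s ^ a * t ^ b := by
    intro n
    induction n with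
    | zero => intro y hy; simpa using hy
    | succ n ih => intro y hy; rw [pow_succ, mul_assoc]; exact ih _ (h1 y hy)
  have h3 : t⁻¹ = t ^ (d - 1) :=
    inv_eq_of_mul_eq_one_left (by rw [← pow_succ, Nat.sub_add_cancel hd, ht])
  induction hx using Subgroup.closure_induction_left with
  | one => exact ⟨0, 0, by simp⟩
  | mul_left y hy z hz ih =>
    obtain rfl | rfl := hy
    · obtain ⟨a, b, rfl⟩ := ih
      exact ⟨1 + a, b, by rw [zpow_one_add, mul_assoc]⟩
    · exact h1 _ ih
  | inv_mul_cancel y hy z hz ih =>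
    obtain rfl | rfl := hy
    · obtain ⟨a, b, rfl⟩ := ih
      exact ⟨-1 + a, b, by rw [zpow_add, zpow_neg_one, mul_assoc]⟩
    · rw [h3]
      exact h2 (d - 1) _ ih

theorem conj_pow_of_conj (n : ℕ) : t ^ n * s * (t ^ n)⁻¹ = s ^ (k ^ n) := by
  induction n with
  | zero => simp
  | succ n ih =>
    calc _ = t * (t ^ n * s * (t ^ n)⁻¹) * t⁻¹ := by rw [pow_succ']; group
      _ = _ := by rw [ih, ← conj_zpow, hst, ← zpow_mul, pow_succ']

omit hst in
theorem exists_sub_one_eq (hz : 0 < z) (h : Int.gcd (k - 1) ((g * z : ℕ) : ℤ) = z) :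
    ∃ m : ℤ, k - 1 = z * m ∧ IsCoprime (g : ℤ) m := by
  have h1 : (z : ℤ) ∣ k - 1 := by
    have := Int.gcd_dvd_left (k - 1) ((g * z : ℕ) : ℤ)
    rwa [h] at this
  obtain ⟨m, hm⟩ := h1
  refine ⟨m, hm, ?_⟩
  rw [hm, Nat.cast_mul, mul_comm (g : ℤ), Int.gcd_mul_left, Int.natAbs_natCast] at h
  have h2 : Int.gcd m g = 1 := Nat.eq_of_mul_eq_mul_left hz (by rw [h, mul_one])
  exact (Int.isCoprime_iff_gcd_eq_one.2 h2).symm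

variable (hz : 0 < z) (h : IsParameter d g z k) (hs : orderOf s = g * z)
include hz h hs

/-- If s^a t^b commutes with s, then t^b = 1 because k has order d modulo gz. Commuting with t then
gives gz ∣ (k − 1)a, that is g ∣ a, since k − 1 is z times a number prime to g. So the centre is
generated by s^g. -/
theorem natCard_center_of_conj (hd : 0 < d) (hg : 0 < g) (ht : orderOf t = d)
    (hX : ∀ x : X, ∃ a b : ℤ, x = s ^ a * t ^ b) : Nat.card (Subgroup.center X) = z := by
  obtain ⟨m, hm, hco⟩ := exists_sub_one_eq hz h.2.2
  have hs' : ∀ n : ℤ, s ^ n = 1 ↔ ((g * z : ℕ) : ℤ) ∣ n := fun n => by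
    rw [← orderOf_dvd_iff_zpow_eq_one, hs]
  have key : Subgroup.center X = Subgroup.zpowers (s ^ g) := by
    apply le_antisymm
    · intro x hx
      rw [Subgroup.mem_center_iff] at hx
      obtain ⟨a, b, rfl⟩ := hX x
      -- `conj_pow_of_conj` concerns natural exponents only.
      have hb : t ^ b = t ^ (b % d).toNat := by
        rw [← zpow_natCast, Int.toNat_of_nonneg (Int.emod_nonneg _ (by omega)), ← ht,
          zpow_mod_orderOf]
      rw [hb] at hx ⊢
      have hb1 : t ^ (b % d).toNat = 1 := by
        have h1 := hx s
        have h2 := conj_pow_of_conj hst (b % d).toNat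
        have h3 : s ^ (k ^ (b % d).toNat) = s := by
          rw [← h2]
          rw [← mul_assoc, ← zpow_one_add, add_comm, zpow_add_one, mul_assoc, mul_assoc,
            mul_right_inj] at h1
          rw [← h1, mul_inv_cancel_right]
        have h4 : s ^ (k ^ (b % d).toNat - 1) = 1 := by
          rw [zpow_sub_one, h3, mul_inv_cancel]
        rw [hs', ← ZMod.intCast_zmod_eq_zero_iff_dvd, Int.cast_sub, sub_eq_zero, Int.cast_one,
          Int.cast_pow] at h4
        have h5 := orderOf_dvd_of_pow_eq_one h4
        rw [h.2.1] at h5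
        exact orderOf_dvd_iff_pow_eq_one.1 (ht.dvd.trans h5)
      rw [hb1, mul_one] at hx ⊢
      have h1 := hx t
      rw [mul_zpow_of_conj hst, mul_left_inj] at h1
      have h2 : s ^ (k * a - a) = 1 := by rw [zpow_sub, h1, mul_inv_cancel]
      rw [hs'] at h2
      have h3 : (z : ℤ) * g ∣ z * (m * a) := by
        convert h2 using 1
        · push_cast; ring
        · linear_combination -a * hm
      have h4 := hco.dvd_of_dvd_mul_left ((mul_dvd_mul_iff_left (by omega)).1 h3)
      obtain ⟨c, rfl⟩ := h4
      exact ⟨c, by simp only [zpow_mul, zpow_natCast]⟩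
    · rw [Subgroup.zpowers_le, Subgroup.mem_center_iff]
      have h1 : Commute t (s ^ g) := by
        have h2 : s ^ (k * g - g) = 1 := (hs' _).2
          ⟨m, by push_cast; linear_combination (g : ℤ) * hm⟩
        rw [zpow_sub, mul_inv_eq_one] at h2
        have h3 := mul_zpow_of_conj hst (g : ℤ)
        rw [h2, zpow_natCast] at h3
        exact h3
      intro x
      obtain ⟨a, b, rfl⟩ := hX x
      exact Commute.mul_left (((Commute.refl _).pow_right g).zpow_left a) (h1.zpow_left b)
  rw [key, Nat.card_zpowers, orderOf_pow' _ hg.ne', hs, Nat.gcd_eq_right ⟨z, rfl⟩,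
    Nat.mul_div_cancel_left z hg]

/-- The commutator of t and s is s^(k−1), whose order is divisible by g. -/
theorem dvd_natCard_commutator_of_conj : g ∣ Nat.card (commutator X) := by
  obtain ⟨m, hm, hco⟩ := exists_sub_one_eq hz h.2.2
  have hs' : ∀ n : ℤ, s ^ n = 1 ↔ ((g * z : ℕ) : ℤ) ∣ n := fun n => by
    rw [← orderOf_dvd_iff_zpow_eq_one, hs]
  have h1 : s ^ (k - 1) ∈ commutator X := by
    have : ⁅t, s⁆ = s ^ (k - 1) := by rw [commutatorElement_def, hst, zpow_sub_one]
    rw [← this]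
    exact Subgroup.commutator_mem_commutator (Subgroup.mem_top _) (Subgroup.mem_top _)
  have h3 := Subgroup.card_dvd_of_le (Subgroup.zpowers_le.2 h1)
  rw [Nat.card_zpowers] at h3
  refine dvd_trans ?_ h3
  have h4 := pow_orderOf_eq_one (s ^ (k - 1))
  rw [← zpow_natCast, ← zpow_mul, hs'] at h4
  have h5 : (z : ℤ) * g ∣ z * (m * orderOf (s ^ (k - 1))) := by
    convert h4 using 1
    · push_cast; ring
    · rw [hm]; ring
  exact Int.natCast_dvd_natCast.1
    (hco.dvd_of_dvd_mul_left ((mul_dvd_mul_iff_left (by omega)).1 h5))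

omit hst hz h hs in
theorem natCard_commutator_dvd [Finite X] (hd : 0 < d) (hz : 0 < z)
    (hX : Nat.card X = d * (g * z)) {B : Type*} [CommGroup B] (hB : Nat.card B = d * z)
    {f : X →* B} (hf : Function.Surjective f) : Nat.card (commutator X) ∣ g := by
  have hle : commutator X ≤ f.ker := by
    rw [commutator_def, Subgroup.commutator_le]
    intro x _ y _
    rw [MonoidHom.mem_ker, map_commutatorElement, commutatorElement_eq_one_iff_mul_comm, mul_comm]
  have hker : Nat.card f.ker = g := by
    have h3 := f.ker.card_mul_index
    rw [Subgroup.index_ker, MonoidHom.range_eq_top.2 hf, Subgroup.card_top, hX, hB] at h3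
    exact Nat.eq_of_mul_eq_mul_right (Nat.mul_pos hd hz) (by rw [h3]; ring)
  exact hker ▸ Subgroup.card_dvd_of_le hle

end Generic

namespace MetacyclicGroup

variable {d e : ℕ} {k : ℤ}

variable (d e k) in
/-- The generator `σ`. -/
def sigma : MetacyclicGroup d e k := PresentedGroup.of 0

variable (d e k) in
/-- The generator `τ`. -/
def tau : MetacyclicGroup d e k := PresentedGroup.of 1

theorem sigma_pow : sigma d e k ^ e = 1 := by
  have : PresentedGroup.mk _ (FreeGroup.of 0 ^ e) = (1 : MetacyclicGroup d e k) :=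
    PresentedGroup.one_of_mem (by simp)
  rwa [map_pow] at this

theorem tau_pow : tau d e k ^ d = 1 := by
  have : PresentedGroup.mk _ (FreeGroup.of 1 ^ d) = (1 : MetacyclicGroup d e k) :=
    PresentedGroup.one_of_mem (by simp)
  rwa [map_pow] at this

theorem conj_sigma : tau d e k * sigma d e k * (tau d e k)⁻¹ = sigma d e k ^ k := by
  have : PresentedGroup.mk _ (FreeGroup.of 1 * FreeGroup.of 0 * (FreeGroup.of 1)⁻¹ *
      ((FreeGroup.of 0) ^ k)⁻¹) = (1 : MetacyclicGroup d e k) :=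
    PresentedGroup.one_of_mem (by simp)
  simp only [map_mul, map_inv, map_zpow] at this
  exact mul_inv_eq_one.1 this

theorem exists_eq_zpow_mul_zpow (hd : 0 < d) (x : MetacyclicGroup d e k) :
    ∃ a b : ℤ, x = sigma d e k ^ a * tau d e k ^ b := by
  refine exists_eq_zpow_mul_zpow_of_conj conj_sigma hd tau_pow ?_
  have h1 : Set.range (PresentedGroup.of (rels := _)) = {sigma d e k, tau d e k} := by
    ext y
    constructor
    · rintro ⟨i, rfl⟩
      fin_cases i
      · exact Or.inl rfl
      · exact Or.inr rfl
    · rintro (rfl | rfl)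
      · exact ⟨0, rfl⟩
      · exact ⟨1, rfl⟩
  rw [← h1, PresentedGroup.closure_range_of]
  trivial

theorem finite_and_natCard_le (hd : 0 < d) (he : 0 < e) :
    Finite (MetacyclicGroup d e k) ∧
      Nat.card (MetacyclicGroup d e k) ≤ orderOf (sigma d e k) * orderOf (tau d e k) := by
  have hs : IsOfFinOrder (sigma d e k) := isOfFinOrder_iff_pow_eq_one.2 ⟨e, he, sigma_pow⟩
  have ht : IsOfFinOrder (tau d e k) := isOfFinOrder_iff_pow_eq_one.2 ⟨d, hd, tau_pow⟩
  have hfs : Finite (Subgroup.zpowers (sigma d e k)) := finite_zpowers.2 hs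
  have hft : Finite (Subgroup.zpowers (tau d e k)) := finite_zpowers.2 ht
  let f : Subgroup.zpowers (sigma d e k) × Subgroup.zpowers (tau d e k) →
    MetacyclicGroup d e k := fun y => y.1 * y.2
  have hf : Function.Surjective f := fun x => by
    obtain ⟨a, b, rfl⟩ := exists_eq_zpow_mul_zpow hd x
    exact ⟨(⟨_, a, rfl⟩, ⟨_, b, rfl⟩), rfl⟩
  refine ⟨Finite.of_surjective f hf, ?_⟩
  rw [← Nat.card_zpowers, ← Nat.card_zpowers, ← Nat.card_prod]
  exact Nat.card_le_card_of_surjective f hf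

theorem natCard_le (hd : 0 < d) (he : 0 < e) : Nat.card (MetacyclicGroup d e k) ≤ d * e := by
  refine (finite_and_natCard_le hd he).2.trans ?_
  rw [mul_comm]
  exact Nat.mul_le_mul (Nat.le_of_dvd hd (orderOf_dvd_of_pow_eq_one tau_pow))
    (Nat.le_of_dvd he (orderOf_dvd_of_pow_eq_one sigma_pow))

/-- A group is metacyclic as soon as it has generators of the right orders. -/
theorem groupIso_of_orderOf {X : Type*} [Group X] (hd : 0 < d) (he : 0 < e)
    (hde : d.Coprime e) (hX : Nat.card X = d * e) {s t : X} (hs : orderOf s = e)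
    (ht : orderOf t = d) (hst : t * s * t⁻¹ = s ^ k) : GroupIso X (MetacyclicGroup d e k) := by
  have hpos : 0 < d * e := Nat.mul_pos hd he
  have : Finite X := Nat.finite_of_card_ne_zero (by omega)
  obtain ⟨hfin, -⟩ := finite_and_natCard_le (k := k) hd he
  let f : MetacyclicGroup d e k →* X := PresentedGroup.toGroup (f := ![s, t]) (by
    rintro y (rfl | rfl | rfl)
    · simp [← hs, pow_orderOf_eq_one]
    · simp [← ht, pow_orderOf_eq_one]
    · simp [hst])
  have h1 : s ∈ f.range := ⟨PresentedGroup.of 0, PresentedGroup.toGroup.of _⟩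
  have h2 : t ∈ f.range := ⟨PresentedGroup.of 1, PresentedGroup.toGroup.of _⟩
  have h3 : d * e ∣ Nat.card f.range := by
    refine hde.mul_dvd_of_dvd_of_dvd ?_ ?_
    · have := Subgroup.card_dvd_of_le (Subgroup.zpowers_le.2 h2)
      rwa [Nat.card_zpowers, ht] at this
    · have := Subgroup.card_dvd_of_le (Subgroup.zpowers_le.2 h1)
      rwa [Nat.card_zpowers, hs] at this
  have hf : Function.Surjective f := by
    rw [← MonoidHom.range_eq_top]
    refine Subgroup.eq_top_of_le_card _ ?_
    rw [hX]
    exact Nat.le_of_dvd Nat.card_pos h3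
  have hb : Function.Bijective f := (Nat.bijective_iff_surjective_and_card f).2
    ⟨hf, le_antisymm (by rw [hX]; exact natCard_le hd he) (Nat.card_le_card_of_surjective f hf)⟩
  exact ⟨(MulEquiv.ofBijective f hb).symm⟩

/-- Relators alone only bound the orders from above; the order of the group is at most the product
of the two orders, so full order forces equality in both. -/
theorem orderOf_sigma_and_tau (hd : 0 < d) (he : 0 < e)
    (hcard : Nat.card (MetacyclicGroup d e k) = d * e) :
    orderOf (sigma d e k) = e ∧ orderOf (tau d e k) = d := by
  have h1 := Nat.le_of_dvd hd (orderOf_dvd_of_pow_eq_one (tau_pow (d := d) (e := e) (k := k)))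
  have h2 := Nat.le_of_dvd he (orderOf_dvd_of_pow_eq_one (sigma_pow (d := d) (e := e) (k := k)))
  have h3 := (finite_and_natCard_le (k := k) hd he).2
  rw [hcard] at h3
  constructor
  · by_contra hne
    have := Nat.mul_lt_mul_of_lt_of_le (lt_of_le_of_ne h2 hne) h1 hd
    rw [mul_comm e] at this
    omega
  · by_contra hne
    have := Nat.mul_lt_mul_of_le_of_lt h2 (lt_of_le_of_ne h1 hne) he
    rw [mul_comm e] at this
    omega

variable {g z : ℕ}

variable (hd : 0 < d) (hg : 0 < g) (hz : 0 < z) (h : IsParameter d g z k)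
  (hcard : Nat.card (MetacyclicGroup d (g * z) k) = d * (g * z))
include hd hg hz h hcard

theorem natCard_center : Nat.card (Subgroup.center (MetacyclicGroup d (g * z) k)) = z := by
  obtain ⟨hs, ht⟩ := orderOf_sigma_and_tau hd (Nat.mul_pos hg hz) hcard
  exact natCard_center_of_conj conj_sigma hz h hs hd hg ht (exists_eq_zpow_mul_zpow hd)

theorem natCard_commutator : Nat.card (commutator (MetacyclicGroup d (g * z) k)) = g := by
  have he := Nat.mul_pos hg hz
  obtain ⟨hs, ht⟩ := orderOf_sigma_and_tau hd he hcard
  obtain ⟨m, hm, -⟩ := exists_sub_one_eq hz h.2.2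
  obtain ⟨hfin, -⟩ := finite_and_natCard_le (k := k) hd he
  have hkz : (k : ZMod z) = 1 := by
    have : ((k - 1 : ℤ) : ZMod z) = 0 := by rw [hm]; simp
    rwa [Int.cast_sub, sub_eq_zero, Int.cast_one] at this
  -- An abelian quotient of order dz: k is 1 modulo z, so the conjugation relation becomes trivial
  -- there.
  let f : MetacyclicGroup d (g * z) k →* Multiplicative (ZMod d × ZMod z) :=
    PresentedGroup.toGroup (f := ![.ofAdd (0, 1), .ofAdd (1, 0)]) (by
      rintro y (rfl | rfl | rfl) <;> apply Multiplicative.toAdd.injective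
      · ext <;> simp
      · ext <;> simp
      · ext <;> simp [hkz])
  have hfs : f (sigma d (g * z) k) = .ofAdd (0, 1) := PresentedGroup.toGroup.of _
  have hft : f (tau d (g * z) k) = .ofAdd (1, 0) := PresentedGroup.toGroup.of _
  have hf : Function.Surjective f := fun y => by
    have : NeZero d := ⟨hd.ne'⟩
    have : NeZero z := ⟨hz.ne'⟩
    refine ⟨tau d (g * z) k ^ y.toAdd.1.val * sigma d (g * z) k ^ y.toAdd.2.val, ?_⟩
    rw [map_mul, map_pow, map_pow, hfs, hft]
    apply Multiplicative.toAdd.injective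
    ext <;> simp
  refine Nat.dvd_antisymm (natCard_commutator_dvd hd hz hcard ?_ hf)
    (dvd_natCard_commutator_of_conj conj_sigma hz h hs)
  rw [Nat.card_congr Multiplicative.toAdd, Nat.card_prod, Nat.card_zmod, Nat.card_zmod]

end MetacyclicGroup

/-- The centre and the commutator subgroup determine the factorisation. -/
theorem ComesFrom.natCard {X : Type u} [Group X] {d g z : ℕ} (hd : 0 < d) (hg : 0 < g)
    (hz : 0 < z) (hX : Nat.card X = d * (g * z)) (h : ComesFrom X d g z) :
    Nat.card (Subgroup.center X) = z ∧ Nat.card (commutator X) = g := by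
  obtain ⟨k, hk, ⟨e⟩⟩ := h
  have hc : Nat.card (MetacyclicGroup d (g * z) k) = d * (g * z) := by
    rw [← hX, Nat.card_congr e.toEquiv]
  refine ⟨(Nat.card_congr (Subgroup.centerCongr e).toEquiv).trans
    (MetacyclicGroup.natCard_center hd hg hz hk hc),
    Eq.trans ?_ (MetacyclicGroup.natCard_commutator hd hg hz hk hc)⟩
  have : commutator (MetacyclicGroup d (g * z) k) = (commutator X).map e.toMonoidHom := by
    rw [commutator_def, commutator_def, Subgroup.map_commutator,
      Subgroup.map_top_of_surjective _ e.surjective]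
  rw [this]
  exact Nat.card_congr ((commutator X).equivMapOfInjective _ e.injective).toEquiv

theorem ComesFrom.of_mulEquiv {X : Type u} {Y : Type v} [Group X] [Group Y] (e : X ≃* Y)
    {d g z : ℕ} (h : ComesFrom X d g z) : ComesFrom Y d g z := by
  obtain ⟨k, hk, ⟨e'⟩⟩ := h
  exact ⟨k, hk, ⟨e.symm.trans e'⟩⟩
-- Explicit generators and parameters for the six patterns
open IsSkewBrace

/-- Elements of orders `e` and `d`, the second acting on the first by `k`-th powers. -/
structure ConjPair {X : Type*} [Group X] (s t : X) (d e : ℕ) (k : ℤ) : Prop where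
  orderOf_left : orderOf s = e
  orderOf_right : orderOf t = d
  conj : t * s * t⁻¹ = s ^ k

namespace CharExt

variable {r : ℕ} [hr : Fact r.Prime] {Q : Type*} [Group Q] {θ : Q →* (ZMod r)ˣ}

theorem orderOf_inr (y : Q) : orderOf (inr θ y) = orderOf y :=
  orderOf_injective _ (fun _ _ e => congrArg snd e) y

theorem orderOf_inl_one : orderOf (inl θ 1) = r := by
  refine orderOf_eq_prime ?_ fun e => one_ne_zero (congrArg fst e)
  rw [inl_pow, CharP.cast_eq_zero, zero_mul, inl_zero]

theorem inl_zpow (x : ZMod r) (n : ℤ) : inl θ x ^ n = inl θ (n * x) := by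
  cases n with
  | ofNat n => simp [inl_pow]
  | negSucc n =>
    rw [zpow_negSucc, inl_pow, inv_eq_iff_mul_eq_one, inl_mul, ← inl_zero]
    congr 1
    push_cast
    ring

/-- Lifting of conjugation relations to an extension. -/
theorem conjPair_lift [Finite Q] (hQ : r.Coprime (Nat.card Q)) {c y : Q} {d e : ℕ} {k : ℤ}
    (h : ConjPair c y d e k) (hc : θ c = 1) (hy : ((θ y : (ZMod r)ˣ) : ZMod r) = k) :
    ConjPair (inl θ 1 * inr θ c) (inr θ y) d (e * r) k := by
  have hcomm : ∀ x, Commute (inl θ x) (inr θ c) := fun x => by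
    ext <;> simp [hc]
  refine ⟨?_, by rw [orderOf_inr, h.orderOf_right], ?_⟩
  · rw [(hcomm 1).orderOf_mul_eq_mul_orderOf_of_coprime, orderOf_inl_one, orderOf_inr,
      h.orderOf_left, mul_comm]
    rw [orderOf_inl_one, orderOf_inr]
    exact hQ.coprime_dvd_right (orderOf_dvd_natCard c)
  · rw [(hcomm 1).mul_zpow, inl_zpow, mul_one, ← map_zpow, ← h.conj, map_mul, map_mul, map_inv,
      ← mul_assoc, ← mul_assoc, ← mul_assoc]
    congr 2
    ext <;> simp [hy]

end CharExt

section Cyc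

variable {p : ℕ}

variable (p) in
/-- The standard generator. -/
def Cyc.gen : Cyc p := .ofAdd 1

theorem Cyc.orderOf_gen : orderOf (Cyc.gen p) = p := by
  rw [Cyc.gen, orderOf_ofAdd_eq_addOrderOf, ZMod.addOrderOf_one]

theorem Cyc.eq_gen_zpow (x : Cyc p) : ∃ n : ℤ, x = Cyc.gen p ^ n := by
  obtain ⟨n, hn⟩ := ZMod.intCast_surjective x.toAdd
  refine ⟨n, ?_⟩
  apply Multiplicative.toAdd.injective
  rw [Cyc.gen, toAdd_zpow, toAdd_ofAdd, zsmul_one, hn]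

theorem Cyc.hom_ext {H : Type*} [Group H] {f f' : Cyc p →* H}
    (h : f (Cyc.gen p) = f' (Cyc.gen p)) : f = f' := MonoidHom.ext fun x => by
  obtain ⟨n, rfl⟩ := Cyc.eq_gen_zpow x
  rw [map_zpow, map_zpow, h]

theorem Cyc.exists_hom {H : Type*} [CommGroup H] {x : H} (hx : x ^ p = 1) :
    ∃ f : Cyc p →* H, f (Cyc.gen p) = x := by
  let f : ZMod p →+ Additive H := ZMod.lift p ⟨zmultiplesHom (Additive H) (.ofMul x), by
    rw [zmultiplesHom_apply, natCast_zsmul, ← ofMul_pow, hx, ofMul_one]⟩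
  refine ⟨AddMonoidHom.toMultiplicativeLeft f, ?_⟩
  have h1 : f ((1 : ℤ) : ZMod p) = .ofMul x := by
    rw [ZMod.lift_coe]
    simp
  rw [Int.cast_one] at h1
  exact congrArg Additive.toMul h1

end Cyc

section Parameter

variable {d g z : ℕ} {k : ℤ}

theorem exists_intCast_eq {m n : ℕ} [NeZero m] [NeZero n] (h : m.Coprime n) (a : ZMod m)
    (b : ZMod n) : ∃ k : ℤ, (k : ZMod m) = a ∧ (k : ZMod n) = b := by
  obtain ⟨x, h1, h2⟩ := Nat.chineseRemainder h a.val b.val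
  refine ⟨x, ?_, ?_⟩
  · rw [Int.cast_natCast, (ZMod.natCast_eq_natCast_iff _ _ _).2 h1, ZMod.natCast_zmod_val]
  · rw [Int.cast_natCast, (ZMod.natCast_eq_natCast_iff _ _ _).2 h2, ZMod.natCast_zmod_val]

theorem orderOf_intCast_mul {m n : ℕ} (h : m.Coprime n) :
    orderOf (k : ZMod (m * n)) = (orderOf (k : ZMod m)).lcm (orderOf (k : ZMod n)) := by
  have h1 := orderOf_injective (ZMod.chineseRemainder h).toRingHom.toMonoidHom
    (ZMod.chineseRemainder h).injective (k : ZMod (m * n))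
  rw [← h1, Prod.orderOf]
  simp

theorem gcd_sub_one_of_prime {m : ℕ} (hm : m.Prime) (hk : (k : ZMod m) ≠ 1) :
    Int.gcd (k - 1) m = 1 := by
  rw [Int.gcd_comm, Int.gcd_def, Int.natAbs_natCast]
  refine (Nat.Prime.coprime_iff_not_dvd hm).2 fun h => ?_
  rw [← Int.natCast_dvd, ← ZMod.intCast_zmod_eq_zero_iff_dvd] at h
  apply hk
  rwa [Int.cast_sub, Int.cast_one, sub_eq_zero] at h

theorem isParameter_of (hgz : g.Coprime z) (hd : d.Coprime (g * z))
    (hk : orderOf (k : ZMod g) = d) (hz : (k : ZMod z) = 1) (hg : Int.gcd (k - 1) g = 1) :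
    IsParameter d g z k := by
  refine ⟨hd, ?_, ?_⟩
  · rw [orderOf_intCast_mul hgz, hk, hz, orderOf_one, Nat.lcm_one_right]
  · have h1 : (z : ℤ) ∣ k - 1 := by
      rw [← ZMod.intCast_zmod_eq_zero_iff_dvd, Int.cast_sub, hz, Int.cast_one, sub_self]
    rw [Int.gcd_def, Int.natAbs_natCast] at hg ⊢
    rw [Nat.Coprime.gcd_mul _ hgz, hg, one_mul]
    exact Nat.gcd_eq_right (Int.natCast_dvd.1 h1)

end Parameter
open IsSkewBrace

namespace CharExt

variable {p q r : ℕ} [hp : Fact p.Prime] [hq : Fact q.Prime] [hr : Fact r.Prime]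

theorem conjPair_gen (k : ℤ) : ConjPair (1 : Cyc p) (Cyc.gen p) p 1 k :=
  ⟨orderOf_one, Cyc.orderOf_gen, by simp⟩

theorem natCard_model {α : Cyc p →* (ZMod q)ˣ} {θ : CharExt q α →* (ZMod r)ˣ} :
    Nat.card (CharExt r θ) = r * (q * p) := by rw [natCard, natCard_cyc_ext]

variable (h : PrimeChain p q r)
include h

omit hr in
theorem coprime_cyc : q.Coprime (Nat.card (Cyc p)) := by rw [natCard_cyc]; exact h.coprime₁

theorem coprime_cyc_ext {α : Cyc p →* (ZMod q)ˣ} : r.Coprime (Nat.card (CharExt q α)) := by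
  rw [natCard_cyc_ext]
  exact h.coprime₂

/-- An extension by two characters of the same quotient is metacyclic. -/
theorem groupIso_inflation {α : Cyc p →* (ZMod q)ˣ} {β : Cyc p →* (ZMod r)ˣ} {k : ℤ}
    (hα : ((α (Cyc.gen p) : (ZMod q)ˣ) : ZMod q) = k)
    (hβ : ((β (Cyc.gen p) : (ZMod r)ˣ) : ZMod r) = k) :
    GroupIso (CharExt r (β.comp (sndHom α))) (MetacyclicGroup p (q * r) k) := by
  have h1 := conjPair_lift (coprime_cyc h) (conjPair_gen k) (map_one α) hα
  have h2 := conjPair_lift (θ := β.comp (sndHom α)) (coprime_cyc_ext h) h1 (by simp) hβ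
  rw [one_mul] at h2
  refine MetacyclicGroup.groupIso_of_orderOf hp.1.pos (Nat.mul_pos hq.1.pos hr.1.pos) ?_ ?_
    h2.1 h2.2 h2.3
  · exact Nat.Coprime.mul_right h.coprime₁.symm (h.coprime₂.coprime_mul_left_right).symm
  · rw [natCard_model]; ring

omit hr h in
theorem orderOf_char_gen {α : Cyc p →* (ZMod q)ˣ} (hα : α ≠ 1) :
    orderOf ((α (Cyc.gen p) : (ZMod q)ˣ) : ZMod q) = p := by
  rw [orderOf_units, orderOf_injective α
    (MonoidHom.injective_of_prime_card (natCard_cyc p) hα), Cyc.orderOf_gen]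

omit hr h in
theorem char_gen_ne_one {α : Cyc p →* (ZMod q)ˣ} (hα : α ≠ 1) :
    ((α (Cyc.gen p) : (ZMod q)ˣ) : ZMod q) ≠ 1 := fun e =>
  hα (Cyc.hom_ext (Units.ext e))

theorem isParameter_both {k : ℤ} (hq' : orderOf (k : ZMod q) = p)
    (hr' : orderOf (k : ZMod r) = p) : IsParameter p (q * r) 1 k := by
  have hqr : q.Coprime r := h.coprime₂.coprime_mul_right_right.symm
  have h1 : ∀ {m : ℕ}, orderOf (k : ZMod m) = p → (k : ZMod m) ≠ 1 := fun e e' =>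
    hp.1.one_lt.ne (by rw [← e, e', orderOf_one])
  refine isParameter_of (Nat.coprime_one_right _) ?_ ?_ (Subsingleton.elim _ _) ?_
  · rw [mul_one]
    exact Nat.Coprime.mul_right h.coprime₁.symm (h.coprime₂.coprime_mul_left_right).symm
  · rw [orderOf_intCast_mul hqr, hq', hr', Nat.lcm_self]
  · have h2 := gcd_sub_one_of_prime hq.1 (h1 hq')
    have h3 := gcd_sub_one_of_prime hr.1 (h1 hr')
    rw [Int.gcd_def, Int.natAbs_natCast] at h2 h3 ⊢
    exact Nat.Coprime.mul_right h2 h3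

/-- The factorisation of an iterated extension. -/
theorem Pattern.hasFactorisation {α : Cyc p →* (ZMod q)ˣ} {θ : CharExt q α →* (ZMod r)ˣ}
    {i : Fin 6} (hi : Pattern θ i) : HasFactorisation p q r (CharExt r θ) i := by
  have hqp : q.Coprime p := h.coprime₁
  have hrp : r.Coprime p := h.coprime₂.coprime_mul_left_right
  have hrq : r.Coprime q := h.coprime₂.coprime_mul_right_right
  have hcard : Nat.card (CharExt r θ) = r * (q * p) := natCard_model
  cases hi with
  | cyclic hα hθ =>
    change ComesFrom _ 1 1 (p * q * r)
    subst hα hθ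
    have h0 : ConjPair (Cyc.gen p) 1 1 p 1 := ⟨Cyc.orderOf_gen, orderOf_one, by simp⟩
    have h1 := conjPair_lift (θ := (1 : Cyc p →* (ZMod q)ˣ)) (coprime_cyc h) h0 rfl (by simp)
    have h2 := conjPair_lift (θ := (1 : CharExt q (1 : Cyc p →* (ZMod q)ˣ) →* (ZMod r)ˣ))
      (coprime_cyc_ext h) h1 rfl (by simp)
    refine ⟨1, isParameter_of (Nat.coprime_one_left _) (Nat.coprime_one_left _)
      (by rw [Int.cast_one, orderOf_one]) (by simp) (by simp),
      MetacyclicGroup.groupIso_of_orderOf one_pos ?_ (Nat.coprime_one_left _) ?_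
        (h2.1.trans (one_mul _).symm) h2.2 h2.3⟩
    · exact Nat.mul_pos one_pos (Nat.mul_pos (Nat.mul_pos hp.1.pos hq.1.pos) hr.1.pos)
    · rw [hcard]
      ring
  | left hα hθ =>
    change ComesFrom _ p q r
    subst hθ
    -- Modulo q, k is the scalar by which the generator of order p acts; modulo r, where the action
    -- is trivial, it is 1.
    obtain ⟨k, hk, hk'⟩ := exists_intCast_eq hrq.symm
      ((α (Cyc.gen p) : (ZMod q)ˣ) : ZMod q) (1 : ZMod r)
    refine ⟨k, isParameter_of hrq.symm (Nat.Coprime.mul_right hqp.symm hrp.symm)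
      (by rw [hk]; exact orderOf_char_gen hα) hk'
      (gcd_sub_one_of_prime hq.1 (by rw [hk]; exact char_gen_ne_one hα)), ?_⟩
    exact groupIso_inflation h (β := 1) hk.symm hk'.symm
  | right hα β hβ hθ =>
    change ComesFrom _ p r q
    subst hα hθ
    obtain ⟨k, hk, hk'⟩ := exists_intCast_eq hrq
      ((β (Cyc.gen p) : (ZMod r)ˣ) : ZMod r) (1 : ZMod q)
    refine ⟨k, isParameter_of hrq (Nat.Coprime.mul_right hrp.symm hqp.symm)
      (by rw [hk]; exact orderOf_char_gen hβ) hk'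
      (gcd_sub_one_of_prime hr.1 (by rw [hk]; exact char_gen_ne_one hβ)), ?_⟩
    have := groupIso_inflation h (α := 1) (k := k) hk'.symm hk.symm
    rw [mul_comm] at this
    exact this
  | both hα β hβ hθ =>
    change ComesFrom _ p (q * r) 1
    subst hθ
    obtain ⟨k, hk, hk'⟩ := exists_intCast_eq hrq.symm
      ((α (Cyc.gen p) : (ZMod q)ˣ) : ZMod q) ((β (Cyc.gen p) : (ZMod r)ˣ) : ZMod r)
    refine ⟨k, isParameter_both h (by rw [hk]; exact orderOf_char_gen hα)
      (by rw [hk']; exact orderOf_char_gen hβ), ?_⟩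
    have := groupIso_inflation h hk.symm hk'.symm
    rw [← mul_one (q * r)] at this
    exact this
  | kernel hθ hθ' =>
    change ComesFrom _ q r p
    obtain rfl := char_eq_one_of_not_triv hθ
    obtain ⟨k, hk, hk'⟩ := exists_intCast_eq hrp
      ((θ (inl 1 1) : (ZMod r)ˣ) : ZMod r) (1 : ZMod p)
    -- The roles are exchanged here: the element of order q acts, while that of order p joins the
    -- cyclic normal subgroup.
    have h0 : ConjPair (inr (1 : Cyc p →* (ZMod q)ˣ) (Cyc.gen p)) (inl 1 1) q p k := by
      refine ⟨by rw [orderOf_inr, Cyc.orderOf_gen], orderOf_inl_one, ?_⟩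
      have h1 : Cyc.gen p ^ k = Cyc.gen p := by
        have : Cyc.gen p ^ (k - 1) = 1 := by
          rw [← orderOf_dvd_iff_zpow_eq_one, Cyc.orderOf_gen,
            ← ZMod.intCast_zmod_eq_zero_iff_dvd, Int.cast_sub, hk', Int.cast_one, sub_self]
        rwa [zpow_sub_one, mul_inv_eq_one] at this
      rw [← map_zpow, h1, mul_inv_eq_iff_eq_mul]
      ext <;> simp
    have h1 := conjPair_lift (coprime_cyc_ext h) h0 (DFunLike.congr_fun hθ' (Cyc.gen p)) hk.symm
    have h2 : orderOf ((θ (inl 1 1) : (ZMod r)ˣ) : ZMod r) = q := by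
      rw [orderOf_units]
      have := orderOf_injective (θ.comp (inlHom 1)) (inl_injOn_of_not_triv hθ) (Cyc.gen q)
      rw [Cyc.orderOf_gen] at this
      exact this
    have h3 : ((θ (inl 1 1) : (ZMod r)ˣ) : ZMod r) ≠ 1 := fun e =>
      hq.1.one_lt.ne (by rw [← h2, e, orderOf_one])
    have hd : q.Coprime (r * p) := Nat.Coprime.mul_right hrq.symm hqp
    refine ⟨k, isParameter_of hrp hd (by rw [hk]; exact h2) hk'
      (gcd_sub_one_of_prime hr.1 (by rw [hk]; exact h3)),
      MetacyclicGroup.groupIso_of_orderOf hq.1.pos (Nat.mul_pos hr.1.pos hp.1.pos) hd ?_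
        (h1.1.trans (mul_comm _ _)) h1.2 h1.3⟩
    rw [hcard]
    ring
  | faithful hθ hθ' =>
    change ComesFrom _ (p * q) r 1
    obtain rfl := char_eq_one_of_not_triv hθ
    -- A generator of the cyclic group of order pq, which acts faithfully on the kernel of order r.
    let y : CharExt q (1 : Cyc p →* (ZMod q)ˣ) := inl 1 1 * inr 1 (Cyc.gen p)
    have hy : orderOf y = p * q := by
      have h0 : ConjPair (Cyc.gen p) 1 1 p 1 := ⟨Cyc.orderOf_gen, orderOf_one, by simp⟩
      exact (conjPair_lift (θ := (1 : Cyc p →* (ZMod q)ˣ)) (coprime_cyc h) h0 rfl (by simp)).1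
    obtain ⟨k, hk⟩ := ZMod.intCast_surjective ((θ y : (ZMod r)ˣ) : ZMod r)
    have h0 : ConjPair 1 y (p * q) 1 k := ⟨orderOf_one, hy, by simp⟩
    have h1 := conjPair_lift (coprime_cyc_ext h) h0 (map_one θ) hk.symm
    have h2 : orderOf ((θ y : (ZMod r)ˣ) : ZMod r) = p * q := by
      rw [orderOf_units, orderOf_injective θ
        (injective_of_not_triv (natCard_cyc p) (coprime_cyc h) hθ hθ'), hy]
    have h3 : ((θ y : (ZMod r)ˣ) : ZMod r) ≠ 1 := fun e => by
      rw [e, orderOf_one] at h2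
      exact hq.1.one_lt.ne (Nat.eq_one_of_mul_eq_one_left h2.symm).symm
    have hd : (p * q).Coprime (r * 1) := by
      rw [mul_one, mul_comm]
      exact h.coprime₂.symm
    refine ⟨k, isParameter_of (Nat.coprime_one_right _) hd (by rw [hk]; exact h2)
      (Subsingleton.elim _ _) (gcd_sub_one_of_prime hr.1 (by rw [hk]; exact h3)),
      MetacyclicGroup.groupIso_of_orderOf (Nat.mul_pos hp.1.pos hq.1.pos)
        (Nat.mul_pos hr.1.pos one_pos) hd ?_ (h1.1.trans (mul_comm _ _)) h1.2 h1.3⟩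
    rw [hcard]
    ring

end CharExt
-- Transport of structure, uniqueness of the factorisation, and the conclusion
open IsSkewBrace

namespace SkewBraceOfType

variable {A B : Type*} [Group A] [Group B]

/-- Transport of skew brace structures along an isomorphism. -/
def transport (e : A ≃* B) (G : Type*) [Group G] (S : SkewBraceOfType A G) :
    SkewBraceOfType B G :=
  let _ : AddGroup A := S.1
  let _ : AddGroup B := e.symm.toEquiv.addGroup
  have hadd : ∀ x y, e.symm (x + y) = e.symm x + e.symm y :=
    e.symm.toEquiv.addEquiv.map_add
  have hsub : ∀ x y, e.symm (x - y) = e.symm x - e.symm y :=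
    map_sub e.symm.toEquiv.addEquiv
  ⟨inferInstance, ⟨fun a b c => e.symm.injective (by
      have := S.2.1.mul_add_eq (e.symm a) (e.symm b) (e.symm c)
      rw [map_mul, hadd, hadd, hsub, map_mul, map_mul]
      exact this)⟩,
    S.2.2.map fun f => (AddEquiv.toMultiplicative e.symm.toEquiv.addEquiv).trans f⟩

theorem transport_injective (e : A ≃* B) (G : Type*) [Group G] :
    Function.Injective (transport e G) := fun S T h => by
  refine SkewBraceOfType.ext fun a b => e.injective ?_
  have h1 : e (S.1.add (e.symm (e a)) (e.symm (e b))) = e (T.1.add (e.symm (e a)) (e.symm (e b))) :=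
    congrArg (fun U : SkewBraceOfType B G => U.1.add (e a) (e b)) h
  rwa [e.symm_apply_apply, e.symm_apply_apply] at h1

theorem natCard_congr [Finite A] (e : A ≃* B) {G H : Type*} [Group G] [Group H] (f : G ≃* H) :
    Nat.card (SkewBraceOfType A G) = Nat.card (SkewBraceOfType B H) := by
  have : Finite B := Finite.of_equiv A e.toEquiv
  rw [le_antisymm (Nat.card_le_card_of_injective _ (transport_injective e G))
    (Nat.card_le_card_of_injective _ (transport_injective e.symm G))]
  exact Nat.card_congr (Equiv.subtypeEquivRight fun S => and_congr_right fun _ =>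
    ⟨fun h => h.map (·.trans f), fun h => h.map (·.trans f.symm)⟩)

end SkewBraceOfType

namespace CharExt

variable {p q r : ℕ} [hp : Fact p.Prime] [hq : Fact q.Prime] [hr : Fact r.Prime]
  (h : PrimeChain p q r)

-- The pair (z, g), recovered as the orders of the centre and the commutator subgroup, takes six
-- distinct values.
include h in
theorem hasFactorisation_unique {X : Type u} [Group X] (hX : Nat.card X = p * q * r)
    {i j : Fin 6} (hi : HasFactorisation p q r X i) (hj : HasFactorisation p q r X j) :
    i = j := by
  have hp0 := hp.1.pos
  have hq0 := hq.1.pos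
  have hr0 := hr.1.pos
  have hpq : 0 < p * q := Nat.mul_pos hp0 hq0
  have hqr : 0 < q * r := Nat.mul_pos hq0 hr0
  have hpqr : 0 < p * q * r := Nat.mul_pos hpq hr0
  have key : ∀ i, HasFactorisation p q r X i →
      Nat.card (Subgroup.center X) = (factorisation p q r i).2.2 ∧
      Nat.card (commutator X) = (factorisation p q r i).2.1 := by
    intro i hi
    refine ComesFrom.natCard ?_ ?_ ?_ ?_ hi
    · fin_cases i <;> simp [factorisation, hp0, hq0]
    · fin_cases i <;> simp [factorisation, hq0, hr0]
    · fin_cases i <;> simp [factorisation, hp0, hq0, hr0]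
    · rw [hX]
      fin_cases i <;> simp [factorisation] <;> ring
  obtain ⟨i1, i2⟩ := key i hi
  obtain ⟨j1, j2⟩ := key j hj
  rw [i1] at j1
  rw [i2] at j2
  have h1 := h.lt₁
  have h2 := h.lt₂
  have h3 := hp.1.one_lt
  have h4 : r < q * r := lt_mul_left hr0 hq.1.one_lt
  have h5 : q * r < p * q * r := by rw [mul_assoc]; exact lt_mul_left hqr h3
  clear hi hj key i1 i2 hX
  -- Products become opaque symbols ordered by r < M < N, so that the remaining comparisons are
  -- linear.
  generalize hN : p * q * r = N at *
  generalize hM : q * r = M at *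
  revert j1 j2
  fin_cases i <;> fin_cases j <;> simp [factorisation, hN, hM] <;> omega

-- Inverting the parameter modulo r alone replaces β by β⁻¹ and leaves α unchanged.
include h in
theorem isHat_iff {α : Cyc p →* (ZMod q)ˣ} {β : Cyc p →* (ZMod r)ˣ} (hα : α ≠ 1) (hβ : β ≠ 1)
    {Γ : Type u} [Group Γ] {G : Type v} [Group G]
    (e : GroupIso Γ (CharExt r (β.comp (sndHom α)))) :
    IsHat p q r Γ G ↔ GroupIso G (CharExt r (β⁻¹.comp (sndHom α))) := by
  obtain ⟨e⟩ := e
  constructor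
  · rintro ⟨κ, κ', hκ, h1, h2, ⟨e1⟩, ⟨e2⟩⟩
    have h3 : ((κ ^ p - 1 : ℤ) : ZMod (q * r * 1)) = 0 := by
      have := pow_orderOf_eq_one (κ : ZMod (q * r * 1))
      rw [hκ.2.1] at this
      rw [Int.cast_sub, Int.cast_pow, this, Int.cast_one, sub_self]
    rw [mul_one, ZMod.intCast_zmod_eq_zero_iff_dvd, Nat.cast_mul] at h3
    have h4 : (κ : ZMod q) ^ p = 1 := by
      have := (ZMod.intCast_zmod_eq_zero_iff_dvd _ _).2 (dvd_of_mul_right_dvd h3)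
      rwa [Int.cast_sub, Int.cast_pow, Int.cast_one, sub_eq_zero] at this
    have h5 : (κ : ZMod r) ^ p = 1 := by
      have := (ZMod.intCast_zmod_eq_zero_iff_dvd _ _).2 (dvd_of_mul_left_dvd h3)
      rwa [Int.cast_sub, Int.cast_pow, Int.cast_one, sub_eq_zero] at this
    obtain ⟨α₁, hα₁⟩ := Cyc.exists_hom (Units.pow_ofPowEqOne h4 hp.1.ne_zero)
    obtain ⟨β₁, hβ₁⟩ := Cyc.exists_hom (Units.pow_ofPowEqOne h5 hp.1.ne_zero)
    have hα₁' := congrArg Units.val hα₁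
    have hβ₁' := congrArg Units.val hβ₁
    rw [Units.val_ofPowEqOne] at hα₁' hβ₁'
    obtain ⟨e3⟩ := groupIso_inflation h hα₁' hβ₁'
    -- The characters with values κ agree with α and β only up to an automorphism ψ of the group of
    -- order p; the same ψ matches the inverses of the second characters.
    obtain ⟨ψ, hψ, hψ'⟩ := (groupIso_inflation_iff (coprime_cyc h) (coprime_cyc_ext h)).1
      ⟨(e.symm.trans e1).trans e3.symm⟩
    obtain ⟨e4⟩ := (groupIso_inflation_iff (b := β⁻¹) (b' := β₁⁻¹) (coprime_cyc h)
      (coprime_cyc_ext h)).2 ⟨ψ, hψ, by rw [← hψ']; rfl⟩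
    have h6 : (κ : ZMod q) = κ' := ((ZMod.intCast_eq_intCast_iff _ _ _).2 h1).symm
    have h7 : (κ : ZMod r) * κ' = 1 := by
      have := (ZMod.intCast_eq_intCast_iff _ _ _).2 h2
      rwa [Int.cast_mul, Int.cast_one] at this
    obtain ⟨e5⟩ := groupIso_inflation h (β := β₁⁻¹) (hα₁'.trans h6)
      (Units.inv_eq_of_mul_eq_one_right (by rw [hβ₁', h7]))
    exact ⟨(e2.trans e5.symm).trans e4.symm⟩
  · rintro ⟨e'⟩
    have hqr : q.Coprime r := h.coprime₂.coprime_mul_right_right.symm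
    obtain ⟨κ, hκ, hκ'⟩ := exists_intCast_eq hqr
      ((α (Cyc.gen p) : (ZMod q)ˣ) : ZMod q) ((β (Cyc.gen p) : (ZMod r)ˣ) : ZMod r)
    obtain ⟨κ', hκ₁, hκ₁'⟩ := exists_intCast_eq hqr
      ((α (Cyc.gen p) : (ZMod q)ˣ) : ZMod q) ((β⁻¹ (Cyc.gen p) : (ZMod r)ˣ) : ZMod r)
    obtain ⟨e1⟩ := groupIso_inflation h hκ.symm hκ'.symm
    obtain ⟨e2⟩ := groupIso_inflation h hκ₁.symm hκ₁'.symm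
    refine ⟨κ, κ', isParameter_both h (by rw [hκ]; exact orderOf_char_gen hα)
      (by rw [hκ']; exact orderOf_char_gen hβ), ?_, ?_, ⟨e.trans e1⟩, ⟨e'.trans e2⟩⟩
    · rw [← ZMod.intCast_eq_intCast_iff, hκ₁, hκ]
    · rw [← ZMod.intCast_eq_intCast_iff, Int.cast_mul, hκ', hκ₁', Int.cast_one,
        MonoidHom.inv_apply, Units.mul_inv]

end CharExt

open CharExt in
theorem mainTheorem2 (p₁ p₂ p₃ : ℕ) (hp₁ : p₁.Prime) (hp₂ : p₂.Prime) (hp₃ : p₃.Prime)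
    (h₁₂ : p₁ < p₂) (h₂₃ : p₂ < p₃)
    (hc₂₁ : p₂ ≡ 1 [MOD p₁]) (hc₃₁ : p₃ ≡ 1 [MOD p₁]) (hc₃₂ : p₃ ≡ 1 [MOD p₂])
    (Γ : Type*) [Group Γ] (hΓ : Nat.card Γ = p₁ * p₂ * p₃)
    (G : Type*) [Group G] (hG : Nat.card G = p₁ * p₂ * p₃) :
    (∃! i, HasFactorisation p₁ p₂ p₃ Γ i) ∧
    (∃! j, HasFactorisation p₁ p₂ p₃ G j) ∧
    ∀ (K : Type u) (L : Type v) [Field K] [Field L] [Algebra K L] [FiniteDimensional K L]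
      [IsGalois K L], Nonempty (Gal(L/K) ≃* Γ) →
      Finite (HopfGaloisOfType K L G) ∧
      ∀ i j : Fin 6, HasFactorisation p₁ p₂ p₃ Γ i → HasFactorisation p₁ p₂ p₃ G j →
        (p₁ = 2 → (Nat.card (HopfGaloisOfType K L G) : ℤ) = tableTwo p₂ p₃ i j) ∧
        (2 < p₁ → (Nat.card (HopfGaloisOfType K L G) : ℤ) =
          tableOdd p₁ p₂ p₃ (entryFourFour p₁ p₂ p₃ Γ G) i j) := by
  have := Fact.mk hp₁
  have := Fact.mk hp₂
  have := Fact.mk hp₃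
  have h : PrimeChain p₁ p₂ p₃ := ⟨h₁₂, h₂₃, hc₂₁, hc₃₁, hc₃₂⟩
  obtain ⟨α, θ, ⟨e⟩⟩ := exists_model h hΓ
  obtain ⟨α', θ', ⟨e'⟩⟩ := exists_model h hG
  obtain ⟨i₀, hi₀⟩ := exists_pattern θ
  obtain ⟨j₀, hj₀⟩ := exists_pattern θ'
  have hΓi : HasFactorisation p₁ p₂ p₃ Γ i₀ := ComesFrom.of_mulEquiv e.symm (hi₀.hasFactorisation h)
  have hGj : HasFactorisation p₁ p₂ p₃ G j₀ :=
    ComesFrom.of_mulEquiv e'.symm (hj₀.hasFactorisation h)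
  refine ⟨⟨i₀, hΓi, fun i hi => hasFactorisation_unique h hΓ hi hΓi⟩,
    ⟨j₀, hGj, fun j hj => hasFactorisation_unique h hG hj hGj⟩, ?_⟩
  rintro K L _ _ _ _ _ ⟨f⟩
  have hcard : Nat.card (HopfGaloisOfType K L G) =
      Nat.card (SkewBraceOfType (CharExt p₃ θ) (CharExt p₃ θ')) := by
    rw [Nat.card_congr (hopfGaloisOfTypeEquiv K L G), SkewBraceOfType.natCard_congr (f.trans e) e']
  refine ⟨Finite.of_equiv _ (hopfGaloisOfTypeEquiv K L G).symm, fun i j hi hj => ?_⟩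
  obtain rfl := hasFactorisation_unique h hΓ hi hΓi
  obtain rfl := hasFactorisation_unique h hG hj hGj
  rw [hcard]
  by_cases hij : i ≠ 3 ∨ j ≠ 3
  · refine ⟨fun h2 => ?_, fun _ => natCard_eq_table h hi₀ hj₀ hij _⟩
    subst h2
    rw [natCard_eq_table h hi₀ hj₀ hij 4, tableTwo_eq]
    rfl
  · push Not at hij
    obtain ⟨rfl, rfl⟩ := hij
    obtain ⟨hα, β, hβ, rfl⟩ : α ≠ 1 ∧ ∃ β : Cyc p₁ →* (ZMod p₃)ˣ, β ≠ 1 ∧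
        θ = β.comp (sndHom α) := by
      cases hi₀ with
      | both hα β hβ hθ => exact ⟨hα, β, hβ, hθ⟩
    obtain ⟨hα', β', hβ', rfl⟩ : α' ≠ 1 ∧ ∃ β' : Cyc p₁ →* (ZMod p₃)ˣ, β' ≠ 1 ∧
        θ' = β'.comp (sndHom α') := by
      cases hj₀ with
      | both hα β hβ hθ => exact ⟨hα, β, hβ, hθ⟩
    constructor
    · intro h2
      subst h2
      rw [natCard_both_of_two h hα hα' hβ hβ']
      rfl
    · intro h2
      rw [natCard_both h2 h hα hα' hβ hβ']
      -- Reaching β means that G is isomorphic to Γ; reaching β⁻¹ means that G is isomorphic to its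
      -- hat.
      have key : (∃ ψ : Cyc p₁ ≃* Cyc p₁, α'.comp ψ.toMonoidHom = α ∧
          (β'.comp ψ.toMonoidHom = β ∨ β'.comp ψ.toMonoidHom = β⁻¹)) ↔
          Nonempty (G ≃* Γ) ∨ IsHat p₁ p₂ p₃ Γ G := by
        have h3 : ∀ b : Cyc p₁ →* (ZMod p₃)ˣ, GroupIso G (CharExt p₃ (b.comp (sndHom α))) ↔
            ∃ ψ : Cyc p₁ ≃* Cyc p₁, α'.comp ψ.toMonoidHom = α ∧ β'.comp ψ.toMonoidHom = b := by
          intro b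
          rw [← groupIso_inflation_iff (coprime_cyc h) (coprime_cyc_ext h)]
          exact ⟨fun ⟨x⟩ => ⟨x.symm.trans e'⟩, fun ⟨x⟩ => ⟨e'.trans x.symm⟩⟩
        have h4 : Nonempty (G ≃* Γ) ↔ GroupIso G (CharExt p₃ (β.comp (sndHom α))) :=
          ⟨fun ⟨x⟩ => ⟨x.trans e⟩, fun ⟨x⟩ => ⟨x.trans e.symm⟩⟩
        rw [isHat_iff h hα hβ ⟨e⟩, h4, h3, h3, ← exists_or]
        simp only [and_or_left]
      have h5 : ∀ c : ℤ, tableOdd p₁ p₂ p₃ c 3 3 = c := fun _ => rfl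
      rw [h5, entryFourFour]
      split_ifs with h6 h7 h7
      · rfl
      · exact absurd (key.1 h6) h7
      · exact absurd (key.2 h7) h6
      · rfl
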